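/- Let $\ell>0$ and let $\Omega\subset\mathbb R^2$ be an (open) 30-60-90 triangle whose hypotenuse has length $\ell$. A Dirichlet eigenvalue of $\Omega$ is a real number $\lambda$ for which there is a nonzero $u\in H^2(\Omega)$ with $\Delta u+\lambda u=0$ in $\Omega$ and $u=0$ on $\partial\Omega$; its multiplicity is the dimension of the space of all such $u$ (together with $0$). The Dirichlet eigenvalues are positive and have finite multiplicity. The spectral zeta function $$\zeta(s)=\sum_{\lambda}\lambda^{-s},$$ where the sum is over the Dirichlet eigenvalues counted with multiplicity, converges absolutely for $\operatorname{Re}s>1$ and extends (uniquely) to a meromorphic function on $\mathbb C$ which is holomorphic at $0$. The zeta-regularized determinant of $\Omega$ is $e^{-\zeta'(0)}$, where $\zeta'(0)$ is equivalently given by $$\zeta'(0)=\frac56\log\Big(\frac{\ell}{2}\Big)+\frac7{12}\log 3+\frac{\pi\sqrt3}{72}+\frac13\sum_{n=1}^\infty\frac{(-1)^n}{n\,e^{\pi n\sqrt3}}\sum_{d\mid n}d,$$ $$\zeta'(0)=\frac13\log\Big(\frac{3\ell}{2|\eta(z)|}\Big)+\frac14\log 3+\frac12\log\Big(\frac{\ell}{2}\Big),\qquad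 z=\frac{-3+i\sqrt3}{2}.$$ The series over $n$ converges absolutely, and $\eta$ is the Dedekind eta function $\eta(\tau)=e^{\pi i\tau/12}\prod_{n=1}^\infty\big(1-e^{2\pi i n\tau}\big)$, $\operatorname{Im}\tau>0$. -/

import Mathlib

open scoped ContDiff Gradient InnerProductSpace Laplacian

noncomputable section

namespace DirichletSpectrum

/-- The Euclidean plane. -/
abbrev Plane : Type := EuclideanSpace ℝ (Fin 2)

open MeasureTheory Filter Topology

/-- `φ ∈ C_c^∞(Ω)`. -/
structure IsTestFunction (Ω : Set Plane) (φ : Plane → ℝ) : Prop where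
  smooth : ContDiff ℝ ∞ φ
  compact : HasCompactSupport φ
  supp : tsupport φ ⊆ Ω

/-- `u ∈ L²(Ω)`, for functions with values in a normed space. -/
def MemL2 {F : Type} [NormedAddCommGroup F] (Ω : Set Plane) (u : Plane → F) : Prop :=
  MemLp u 2 (volume.restrict Ω)

/-- The vector field `G` is the weak (distributional) gradient of `u` in `Ω`: in every
direction `v`, `∫ u ∂_v φ = - ∫ ⟪G, v⟫ φ` for all test functions `φ`. -/
def HasWeakGradient (Ω : Set Plane) (u : Plane → ℝ) (G : Plane → Plane) : Prop :=
  ∀ φ : Plane → ℝ, IsTestFunction Ω φ → ∀ v : Plane,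
    ∫ x in Ω, u x * fderiv ℝ φ x v = - ∫ x in Ω, inner ℝ (G x) v * φ x

/-- `Δ u = f` weakly (in the sense of distributions) in `Ω`. -/
def HasWeakLaplacian (Ω : Set Plane) (u f : Plane → ℝ) : Prop :=
  ∀ φ : Plane → ℝ, IsTestFunction Ω φ →
    ∫ x in Ω, u x * (Δ φ) x = ∫ x in Ω, f x * φ x

/-- `u ∈ H²(Ω)`: `u` and all its weak derivatives of order one and two are in `L²(Ω)`. -/
def MemH2 (Ω : Set Plane) (u : Plane → ℝ) : Prop :=
  MemL2 Ω u ∧ ∃ G : Plane → Plane, MemL2 Ω G ∧ HasWeakGradient Ω u G ∧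
    ∀ v : Plane, ∃ K : Plane → Plane, MemL2 Ω K ∧
      HasWeakGradient Ω (fun x => inner ℝ (G x) v) K

/-- `u ∈ H¹₀(Ω)`, the closure of `C_c^∞(Ω)` in `H¹(Ω)`: `u` vanishes on the boundary. -/
def MemH10 (Ω : Set Plane) (u : Plane → ℝ) : Prop :=
  MemL2 Ω u ∧ ∃ G : Plane → Plane, MemL2 Ω G ∧ HasWeakGradient Ω u G ∧
    ∃ φ : ℕ → Plane → ℝ, (∀ n, IsTestFunction Ω (φ n)) ∧
      Tendsto (fun n => eLpNorm (φ n - u) 2 (volume.restrict Ω)) atTop (𝓝 0) ∧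
      Tendsto (fun n => eLpNorm (∇ (φ n) - G) 2 (volume.restrict Ω)) atTop (𝓝 0)

/-- `u` solves the Dirichlet problem `Δ u + lam u = 0` in `Ω`, `u = 0` on `∂Ω`, with
`u ∈ H²(Ω)`. -/
structure SolvesHelmholtz (Ω : Set Plane) (lam : ℝ) (u : Plane → ℝ) : Prop where
  memH2 : MemH2 Ω u
  memH10 : MemH10 Ω u
  eqn : HasWeakLaplacian Ω u (fun x => - (lam * u x))

/-! ### The solutions form a linear space -/

section Linear

variable {Ω : Set Plane} {φ u u' f f' : Plane → ℝ} {G G' : Plane → Plane}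

lemma IsTestFunction.memLp (h : IsTestFunction Ω φ) : MemL2 Ω φ :=
  (h.smooth.continuous.memLp_of_hasCompactSupport h.compact).restrict Ω

lemma IsTestFunction.fderiv_memLp (h : IsTestFunction Ω φ) (v : Plane) :
    MemL2 Ω (fun x => fderiv ℝ φ x v) := by
  refine Continuous.memLp_of_hasCompactSupport (μ := volume) ?_ ?_ |>.restrict Ω
  · exact (h.smooth.continuous_fderiv (by simp)).clm_apply continuous_const
  · exact h.compact.fderiv_apply ℝ v

lemma IsTestFunction.laplacian_memLp (h : IsTestFunction Ω φ) : MemL2 Ω (Δ φ) := by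
  refine Continuous.memLp_of_hasCompactSupport (μ := volume) ?_ ?_ |>.restrict Ω
  · rw [InnerProductSpace.laplacian_eq_iteratedFDeriv_stdOrthonormalBasis]
    refine continuous_finsetSum _ fun i _ => ?_
    have := (contDiff_infty.1 h.smooth 2).continuous_iteratedFDeriv (m := 2) le_rfl
    fun_prop
  · have h2 := h.compact.iteratedFDeriv (𝕜 := ℝ) 2
    refine h2.mono fun x hx => ?_
    contrapose! hx
    simp only [Function.mem_support, not_not] at hx ⊢
    simp [InnerProductSpace.laplacian_eq_iteratedFDeriv_stdOrthonormalBasis, hx]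

lemma MemL2.integrable_mul' (hu : MemL2 Ω u) (hf : MemL2 Ω f) :
    Integrable (fun x => u x * f x) (volume.restrict Ω) :=
  MemLp.integrable_mul (p := 2) (q := 2) hu hf

lemma MemL2.inner_const (hG : MemL2 Ω G) (v : Plane) :
    MemL2 Ω (fun x => inner ℝ (G x) v) :=
  MemLp.inner_const hG v

lemma HasWeakGradient.add (hu : MemL2 Ω u) (hu' : MemL2 Ω u') (hG : MemL2 Ω G)
    (hG' : MemL2 Ω G') (h : HasWeakGradient Ω u G) (h' : HasWeakGradient Ω u' G') :
    HasWeakGradient Ω (u + u') (G + G') := by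
  intro φ hφ v
  simp only [Pi.add_apply, add_mul, inner_add_left]
  rw [integral_add (hu.integrable_mul' (hφ.fderiv_memLp v))
      (hu'.integrable_mul' (hφ.fderiv_memLp v)),
    integral_add ((hG.inner_const v).integrable_mul' hφ.memLp)
      ((hG'.inner_const v).integrable_mul' hφ.memLp), h φ hφ v, h' φ hφ v]
  ring

lemma HasWeakGradient.smul (c : ℝ) (h : HasWeakGradient Ω u G) :
    HasWeakGradient Ω (c • u) (c • G) := by
  intro φ hφ v
  simp only [Pi.smul_apply, smul_eq_mul, inner_smul_left, mul_assoc, integral_const_mul,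
    h φ hφ v]
  simp

lemma HasWeakLaplacian.add (hu : MemL2 Ω u) (hu' : MemL2 Ω u') (hf : MemL2 Ω f)
    (hf' : MemL2 Ω f') (h : HasWeakLaplacian Ω u f) (h' : HasWeakLaplacian Ω u' f') :
    HasWeakLaplacian Ω (u + u') (f + f') := by
  intro φ hφ
  simp only [Pi.add_apply, add_mul]
  rw [integral_add (hu.integrable_mul' hφ.laplacian_memLp)
      (hu'.integrable_mul' hφ.laplacian_memLp),
    integral_add (hf.integrable_mul' hφ.memLp) (hf'.integrable_mul' hφ.memLp), h φ hφ, h' φ hφ]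

lemma HasWeakLaplacian.smul (c : ℝ) (h : HasWeakLaplacian Ω u f) :
    HasWeakLaplacian Ω (c • u) (c • f) := by
  intro φ hφ
  simp only [Pi.smul_apply, smul_eq_mul, mul_assoc, integral_const_mul, h φ hφ]

lemma IsTestFunction.zero : IsTestFunction Ω (0 : Plane → ℝ) :=
  ⟨contDiff_const, HasCompactSupport.zero, by simp [tsupport]⟩

lemma IsTestFunction.add {ψ : Plane → ℝ} (h : IsTestFunction Ω φ) (h' : IsTestFunction Ω ψ) :
    IsTestFunction Ω (φ + ψ) :=
  ⟨h.smooth.add h'.smooth, h.compact.add h'.compact,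
    (tsupport_add φ ψ).trans (Set.union_subset h.supp h'.supp)⟩

lemma IsTestFunction.smul (c : ℝ) (h : IsTestFunction Ω φ) : IsTestFunction Ω (c • φ) :=
  ⟨h.smooth.const_smul c, h.compact.smul_left (f := fun _ => c),
    (tsupport_smul_subset_right (fun _ => c) φ).trans h.supp⟩

lemma IsTestFunction.gradient_aesm (h : IsTestFunction Ω φ) :
    AEStronglyMeasurable (∇ φ) (volume.restrict Ω) :=
  ((InnerProductSpace.toDual ℝ Plane).symm.continuous.comp
    (h.smooth.continuous_fderiv (by simp))).aestronglyMeasurable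

lemma MemH2.add (h : MemH2 Ω u) (h' : MemH2 Ω u') : MemH2 Ω (u + u') := by
  obtain ⟨hu, G, hG, hw, hK⟩ := h
  obtain ⟨hu', G', hG', hw', hK'⟩ := h'
  refine ⟨MemLp.add hu hu', G + G', MemLp.add hG hG', hw.add hu hu' hG hG' hw', fun v => ?_⟩
  obtain ⟨K, hK, hKw⟩ := hK v
  obtain ⟨K', hK', hKw'⟩ := hK' v
  refine ⟨K + K', MemLp.add hK hK', ?_⟩
  have := hKw.add (hG.inner_const v) (hG'.inner_const v) hK hK' hKw'
  convert this using 2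
  simp [inner_add_left]

lemma MemH2.smul (c : ℝ) (h : MemH2 Ω u) : MemH2 Ω (c • u) := by
  obtain ⟨hu, G, hG, hw, hK⟩ := h
  refine ⟨MemLp.const_smul hu c, c • G, MemLp.const_smul hG c, hw.smul c, fun v => ?_⟩
  obtain ⟨K, hK, hKw⟩ := hK v
  refine ⟨c • K, MemLp.const_smul hK c, ?_⟩
  convert hKw.smul c using 2
  simp [inner_smul_left]

lemma MemH10.add (h : MemH10 Ω u) (h' : MemH10 Ω u') : MemH10 Ω (u + u') := by
  obtain ⟨hu, G, hG, hw, φ, hφ, h1, h2⟩ := h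
  obtain ⟨hu', G', hG', hw', φ', hφ', h1', h2'⟩ := h'
  refine ⟨MemLp.add hu hu', G + G', MemLp.add hG hG', hw.add hu hu' hG hG' hw',
    fun n => φ n + φ' n, fun n => (hφ n).add (hφ' n), ?_, ?_⟩
  · refine tendsto_of_tendsto_of_tendsto_of_le_of_le tendsto_const_nhds
      (by simpa using h1.add h1') (fun _ => zero_le) fun n => ?_
    have : φ n + φ' n - (u + u') = (φ n - u) + (φ' n - u') := by abel
    simp only [this]
    exact eLpNorm_add_le ((hφ n).memLp.1.sub hu.1) ((hφ' n).memLp.1.sub hu'.1) (by norm_num)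
  · refine tendsto_of_tendsto_of_tendsto_of_le_of_le tendsto_const_nhds
      (by simpa using h2.add h2') (fun _ => zero_le) fun n => ?_
    have : ∇ (φ n + φ' n) - (G + G') = (∇ (φ n) - G) + (∇ (φ' n) - G') := by
      have e : ∇ (φ n + φ' n) = ∇ (φ n) + ∇ (φ' n) := by
        funext x
        simp only [gradient, Pi.add_apply]
        rw [fderiv_add ((hφ n).smooth.differentiable (by simp) x)
          ((hφ' n).smooth.differentiable (by simp) x), map_add]
      rw [e]; abel
    simp only [this]
    exact eLpNorm_add_le ((hφ n).gradient_aesm.sub hG.1)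
      ((hφ' n).gradient_aesm.sub hG'.1) (by norm_num)

lemma MemH10.smul (c : ℝ) (h : MemH10 Ω u) : MemH10 Ω (c • u) := by
  obtain ⟨hu, G, hG, hw, φ, hφ, h1, h2⟩ := h
  refine ⟨MemLp.const_smul hu c, c • G, MemLp.const_smul hG c, hw.smul c,
    fun n => c • φ n, fun n => (hφ n).smul c, ?_, ?_⟩
  · have e : ∀ n, eLpNorm (c • φ n - c • u) 2 (volume.restrict Ω)
        = ‖c‖ₑ * eLpNorm (φ n - u) 2 (volume.restrict Ω) := fun n => by
      rw [← smul_sub, eLpNorm_const_smul]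
    simp only [e]
    simpa using ENNReal.Tendsto.const_mul h1 (Or.inr (by simp))
  · have e : ∀ n, eLpNorm (∇ (c • φ n) - c • G) 2 (volume.restrict Ω)
        = ‖c‖ₑ * eLpNorm (∇ (φ n) - G) 2 (volume.restrict Ω) := fun n => by
      have : ∇ (c • φ n) = c • ∇ (φ n) := by
        funext x
        simp only [gradient, Pi.smul_apply]
        rw [fderiv_const_smul ((hφ n).smooth.differentiable (by simp) x)]
        simp
      rw [this, ← smul_sub, eLpNorm_const_smul]
    simp only [e]
    simpa using ENNReal.Tendsto.const_mul h2 (Or.inr (by simp))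

lemma SolvesHelmholtz.add {lam : ℝ} (h : SolvesHelmholtz Ω lam u)
    (h' : SolvesHelmholtz Ω lam u') : SolvesHelmholtz Ω lam (u + u') := by
  refine ⟨h.memH2.add h'.memH2, h.memH10.add h'.memH10, ?_⟩
  have hf : ∀ {w : Plane → ℝ}, MemL2 Ω w → MemL2 Ω (fun x => - (lam * w x)) := fun hw =>
    MemLp.neg (MemLp.const_mul hw lam)
  convert h.eqn.add h.memH2.1 h'.memH2.1 (hf h.memH2.1) (hf h'.memH2.1) h'.eqn using 1
  funext x
  simp only [Pi.add_apply]
  ring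

lemma SolvesHelmholtz.smul {lam : ℝ} (c : ℝ) (h : SolvesHelmholtz Ω lam u) :
    SolvesHelmholtz Ω lam (c • u) := by
  refine ⟨h.memH2.smul c, h.memH10.smul c, ?_⟩
  convert h.eqn.smul c using 1
  funext x
  simp only [Pi.smul_apply, smul_eq_mul]
  ring

lemma HasWeakGradient.congr (hu : u =ᵐ[volume.restrict Ω] u') (h : HasWeakGradient Ω u G) :
    HasWeakGradient Ω u' G := by
  intro φ hφ v
  rw [← h φ hφ v]
  exact integral_congr_ae (hu.mono fun x hx => by simp only [hx])

lemma SolvesHelmholtz.congr {lam : ℝ} (hu : u =ᵐ[volume.restrict Ω] u')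
    (h : SolvesHelmholtz Ω lam u) : SolvesHelmholtz Ω lam u' := by
  obtain ⟨⟨h0, G, hG, hw, hK⟩, ⟨-, G', hG', hw', φ, hφ, h1, h2⟩, h3⟩ := h
  refine ⟨⟨MemLp.ae_eq hu h0, G, hG, hw.congr hu, hK⟩,
    ⟨MemLp.ae_eq hu h0, G', hG', hw'.congr hu, φ, hφ, ?_, h2⟩, fun φ hφ => ?_⟩
  · refine h1.congr fun n => eLpNorm_congr_ae (hu.mono fun x hx => ?_)
    simp only [Pi.sub_apply, hx]
  · have e : ∫ x in Ω, u' x * (Δ φ) x = ∫ x in Ω, u x * (Δ φ) x :=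
      integral_congr_ae (hu.mono fun x hx => by simp only [hx])
    rw [e, h3 φ hφ]
    exact integral_congr_ae (hu.mono fun x hx => by simp only [hx])

lemma SolvesHelmholtz.zero {lam : ℝ} : SolvesHelmholtz Ω lam (0 : Plane → ℝ) := by
  have z : HasWeakGradient Ω (0 : Plane → ℝ) 0 := fun φ _ v => by simp
  refine ⟨⟨MemLp.zero, 0, MemLp.zero, z, fun v => ⟨0, MemLp.zero, ?_⟩⟩,
    ⟨MemLp.zero, 0, MemLp.zero, z, fun _ => 0, fun _ => IsTestFunction.zero, ?_, ?_⟩,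
    fun φ _ => by simp⟩
  · intro φ _ w
    simp
  · simp
  · have : ∇ (0 : Plane → ℝ) = 0 := by
      funext x
      simp [gradient]
    simp [this]

end Linear

/-- The space of solutions of `Δ u + lam u = 0` in `Ω`, `u = 0` on `∂Ω`, as a subspace of
`L²(Ω)`. -/
def dirichletEigenspace (Ω : Set Plane) (lam : ℝ) :
    Submodule ℝ (Lp ℝ 2 (volume.restrict Ω)) where
  carrier := {u | SolvesHelmholtz Ω lam u}
  add_mem' {u v} hu hv := (hu.add hv).congr (Lp.coeFn_add u v).symm
  zero_mem' := SolvesHelmholtz.zero.congr (Lp.coeFn_zero ℝ 2 (volume.restrict Ω)).symm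
  smul_mem' c u hu := (hu.smul c).congr (Lp.coeFn_smul c u).symm

/-- The set of Dirichlet eigenvalues of `Ω`. -/
def dirichletSpectrum (Ω : Set Plane) : Set ℝ :=
  {lam | dirichletEigenspace Ω lam ≠ ⊥}

/-- The multiplicity of `lam` as a Dirichlet eigenvalue of `Ω`. -/
def dirichletMultiplicity (Ω : Set Plane) (lam : ℝ) : ℕ :=
  Module.finrank ℝ (dirichletEigenspace Ω lam)

/-- `Z` is the spectral zeta function of `Ω`: for `Re s > 1` it is the (absolutely
convergent) sum of `lam ^ (-s)` over the Dirichlet eigenvalues, counted with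
multiplicity, and it is meromorphic on `ℂ`.  "Normal form" only means that removable
singularities are removed (and that `Z` is given the value `0` at its poles), so `Z` is
determined everywhere. -/
structure IsSpectralZeta (Ω : Set Plane) (Z : ℂ → ℂ) : Prop where
  hasSum : ∀ s : ℂ, 1 < s.re →
    HasSum (fun lam : dirichletSpectrum Ω =>
      (dirichletMultiplicity Ω lam : ℂ) * ((lam : ℝ) : ℂ) ^ (-s)) (Z s)
  meromorphic : MeromorphicNFOn Z Set.univ

open scoped Classical in
/-- The meromorphically extended spectral zeta function of `Ω` for the Dirichlet
boundary condition (junk value `0` if there is no such extension). -/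
def spectralZeta (Ω : Set Plane) : ℂ → ℂ :=
  if h : ∃ Z : ℂ → ℂ, IsSpectralZeta Ω Z then h.choose else 0

/-- The zeta-regularized determinant `exp (-ζ'(0))`. -/
def zetaRegularizedDet (Ω : Set Plane) : ℂ :=
  Complex.exp (-deriv (spectralZeta Ω) 0)

/-- `A`, `B`, `C` are the vertices of a 30-60-90 triangle with its right angle at `C` and
its hypotenuse `AB` of length `ℓ`. -/
structure IsHemiEquilateral (A B C : Plane) (ℓ : ℝ) : Prop where
  hypotenuse : dist A B = ℓ
  angle_A : EuclideanGeometry.angle B A C = Real.pi / 6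
  angle_B : EuclideanGeometry.angle A B C = Real.pi / 3
  angle_C : EuclideanGeometry.angle A C B = Real.pi / 2

/-- The open triangle with vertices `A`, `B`, `C`. -/
def openTriangle (A B C : Plane) : Set Plane :=
  interior (convexHull ℝ {A, B, C})

end DirichletSpectrum

end

open DirichletSpectrum

/-! The Dirichlet spectrum of the triangle is explicit, and its zeta function is a Chowla–Selberg
computation for the hexagonal lattice.

Spectrum. The triangle is an alcove of the affine reflection group whose point group is dihedral of
order 12. Antisymmetrizing plane waves over that group gives smooth functions vanishing on all three
walls (Lamé's modes), indexed by a lattice cone, with eigenvalues `κ * modeForm i`. They exhaust the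
spectrum because they are complete. The invariant functions `cosSum n` multiply modes into
combinations of modes (`modeFun_mul_cos`) and separate the points of the closed triangle
(`cosSum_injOn`). Hence, by Stone–Weierstrass, if `u` is orthogonal to every mode, then `u` times
the first mode is orthogonal to all continuous functions, and `u` vanishes almost everywhere
(`ae_eq_zero_of_orthogonal`). Solutions for different spectral parameters are orthogonal, so each
eigenspace is spanned by its modes (`dirichletEigenspace_eq_span`), and independence of characters
gives the multiplicity.

Zeta function. Symmetries of the form m² + mn + n² reduce the sum over the cone to the sum over a
half lattice and to Riemann zeta functions (`hasSum_modeForm`). Poisson summation in n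
(`hexTheta_eq`) splits the half-lattice theta series into a zero-frequency part, whose Mellin
transform is a multiple of Γ(s - 1/2) ζ(2s - 1), and a part that decays rapidly at both ends, whose
Mellin transform is entire. This gives the continuation `modeZeta`.

Value at 0. Since 1/Γ(s) vanishes to first order at 0, the derivative there needs only the value at
0 of the entire Mellin transform. Inverse Gaussian integrals turn it into the double series ∑ 2
q^(mk) / k with q = -exp(-π√3). Collecting terms by n = mk gives the divisor series; summing over k
first gives logarithms of 1 - q^m, that is, the eta product (`hasSum_divisor_series`,
`log_norm_eta`). -/

namespace HemiEquilateral

open MeasureTheory Filter Topology Set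

noncomputable section

section

/-! ### An inverse Gaussian integral -/

/-- The primitive of the Gaussian that vanishes at `0`. -/
def gaussPrim (x : ℝ) : ℝ := ∫ v in (0 : ℝ)..x, Real.exp (-1 * v ^ 2)

lemma hasDerivAt_gaussPrim (x : ℝ) : HasDerivAt gaussPrim (Real.exp (-1 * x ^ 2)) x := by
  have hc : Continuous fun v : ℝ => Real.exp (-1 * v ^ 2) := by fun_prop
  exact intervalIntegral.integral_hasDerivAt_right (hc.intervalIntegrable _ _)
    (hc.stronglyMeasurableAtFilter _ _) hc.continuousAt

lemma tendsto_gaussPrim_atTop : Tendsto gaussPrim atTop (𝓝 (√Real.pi / 2)) := by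
  have h := intervalIntegral_tendsto_integral_Ioi (μ := volume) (0 : ℝ)
    (integrable_exp_neg_mul_sq (b := 1) one_pos).integrableOn tendsto_id
  rw [integral_gaussian_Ioi, div_one] at h
  exact h

lemma gaussPrim_neg (x : ℝ) : gaussPrim (-x) = -gaussPrim x := by
  have := intervalIntegral.integral_comp_neg (f := fun v : ℝ => Real.exp (-1 * v ^ 2))
    (a := 0) (b := x)
  simp only [even_two.neg_pow, neg_zero] at this
  rw [gaussPrim, gaussPrim, this, intervalIntegral.integral_symm]

lemma tendsto_gaussPrim_atBot : Tendsto gaussPrim atBot (𝓝 (-(√Real.pi / 2))) := by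
  have h := (tendsto_gaussPrim_atTop.comp tendsto_neg_atBot_atTop).neg
  refine h.congr fun x => ?_
  simp [gaussPrim_neg]

lemma tendsto_div_sqrt_zero {a : ℝ} (ha : 0 < a) :
    Tendsto (fun t : ℝ => a / √t) (𝓝[>] 0) atTop := by
  have h : Tendsto (fun t : ℝ => √t) (𝓝[>] 0) (𝓝[>] 0) := by
    refine tendsto_nhdsWithin_iff.2 ⟨?_, ?_⟩
    · simpa using (Real.continuous_sqrt.tendsto 0).mono_left nhdsWithin_le_nhds
    · filter_upwards [self_mem_nhdsWithin] with t ht using Real.sqrt_pos.2 ht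
  simpa [div_eq_mul_inv] using (tendsto_inv_nhdsGT_zero.comp h).const_mul_atTop ha

/-- The primitive used for the inverse Gaussian integral. -/
def invGaussPrim (a b t : ℝ) : ℝ :=
  Real.exp (-2 * a * b) * gaussPrim (b * √t - a / √t)
    - Real.exp (2 * a * b) * gaussPrim (b * √t + a / √t)

/-- The factors exp(∓2ab) complete the square, so both Gaussians become exp(-a²/t - b²t). In the
difference the derivatives of b√t cancel and those of a/√t add up. -/
lemma hasDerivAt_invGaussPrim (a b : ℝ) {t : ℝ} (ht : 0 < t) :
    HasDerivAt (invGaussPrim a b)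
      (a / (t * √t) * Real.exp (-(a ^ 2 / t) - b ^ 2 * t)) t := by
  have hs := Real.sqrt_pos.2 ht
  have hsq : √t ^ 2 = t := Real.sq_sqrt ht.le
  have h1 : HasDerivAt (fun t => √t) (1 / (2 * √t)) t := Real.hasDerivAt_sqrt ht.ne'
  have h2 : HasDerivAt (fun t => a / √t) (-(a * (1 / (2 * √t))) / √t ^ 2) t := by
    exact ((hasDerivAt_const t a).fun_div h1 hs.ne').congr_deriv (by ring)
  have h3 := (hasDerivAt_gaussPrim (b * √t - a / √t)).comp t ((h1.const_mul b).sub h2)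
  have h4 := (hasDerivAt_gaussPrim (b * √t + a / √t)).comp t ((h1.const_mul b).add h2)
  have h5 := (h3.const_mul (Real.exp (-2 * a * b))).sub (h4.const_mul (Real.exp (2 * a * b)))
  refine h5.congr_deriv ?_
  have e1 : Real.exp (-2 * a * b) * Real.exp (-1 * (b * √t - a / √t) ^ 2)
      = Real.exp (-(a ^ 2 / t) - b ^ 2 * t) := by
    rw [← Real.exp_add]; congr 1
    have : (b * √t - a / √t) ^ 2 = b ^ 2 * √t ^ 2 - 2 * a * b + a ^ 2 / √t ^ 2 := by
      field_simp; ring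
    rw [this, hsq]; ring
  have e2 : Real.exp (2 * a * b) * Real.exp (-1 * (b * √t + a / √t) ^ 2)
      = Real.exp (-(a ^ 2 / t) - b ^ 2 * t) := by
    rw [← Real.exp_add]; congr 1
    have : (b * √t + a / √t) ^ 2 = b ^ 2 * √t ^ 2 + 2 * a * b + a ^ 2 / √t ^ 2 := by
      field_simp; ring
    rw [this, hsq]; ring
  rw [← mul_assoc, ← mul_assoc, e1, e2, ← mul_sub, mul_comm]
  congr 1
  rw [hsq]; field_simp; ring

lemma tendsto_invGaussPrim_zero {a b : ℝ} (ha : 0 < a) :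
    Tendsto (invGaussPrim a b) (𝓝[>] 0)
      (𝓝 (Real.exp (-2 * a * b) * (-(√Real.pi / 2)) - Real.exp (2 * a * b) * (√Real.pi / 2))) := by
  have h0 : Tendsto (fun t : ℝ => b * √t) (𝓝[>] 0) (𝓝 0) := by
    have : Continuous fun t : ℝ => b * √t := by fun_prop
    simpa using (this.tendsto 0).mono_left nhdsWithin_le_nhds
  have h1 := tendsto_div_sqrt_zero ha
  refine ((tendsto_gaussPrim_atBot.comp ?_).const_mul _).sub
    ((tendsto_gaussPrim_atTop.comp ?_).const_mul _)
  · simpa [sub_eq_add_neg] using h0.add_atBot (tendsto_neg_atTop_atBot.comp h1)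
  · exact h0.add_atTop h1

lemma tendsto_invGaussPrim_atTop {a b : ℝ} (hb : 0 < b) :
    Tendsto (invGaussPrim a b) atTop
      (𝓝 (Real.exp (-2 * a * b) * (√Real.pi / 2) - Real.exp (2 * a * b) * (√Real.pi / 2))) := by
  have h0 : Tendsto (fun t : ℝ => a / √t) atTop (𝓝 0) :=
    tendsto_const_nhds.div_atTop Real.tendsto_sqrt_atTop
  have h1 : Tendsto (fun t : ℝ => b * √t) atTop atTop :=
    Real.tendsto_sqrt_atTop.const_mul_atTop hb
  refine ((tendsto_gaussPrim_atTop.comp ?_).const_mul _).sub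
    ((tendsto_gaussPrim_atTop.comp ?_).const_mul _)
  · simpa [sub_eq_add_neg] using h1.atTop_add h0.neg
  · exact h1.atTop_add h0

/-- `∫ a t^(-3/2) exp (-a²/t - b² t) dt = √π exp (-2ab)`. -/
lemma integral_invGauss {a b : ℝ} (ha : 0 < a) (hb : 0 < b) :
    IntegrableOn (fun t : ℝ => a / (t * √t) * Real.exp (-(a ^ 2 / t) - b ^ 2 * t)) (Ioi 0) ∧
    ∫ t in Ioi (0 : ℝ), a / (t * √t) * Real.exp (-(a ^ 2 / t) - b ^ 2 * t)
      = √Real.pi * Real.exp (-2 * a * b) := by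
  set l := Real.exp (-2 * a * b) * (-(√Real.pi / 2)) - Real.exp (2 * a * b) * (√Real.pi / 2)
    with hl
  set g := Function.update (invGaussPrim a b) 0 l with hg
  have hcont : ContinuousWithinAt g (Ici 0) 0 := by
    rw [hg, continuousWithinAt_update_same]
    have e : Ici (0 : ℝ) \ {0} = Ioi 0 := Ici_sdiff_left
    rw [e]
    exact tendsto_invGaussPrim_zero ha
  have hev : ∀ t : ℝ, 0 < t → g =ᶠ[𝓝 t] invGaussPrim a b := fun t ht => by
    filter_upwards [lt_mem_nhds ht] with x hx
    rw [hg, Function.update_of_ne hx.ne']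
  have hd : ∀ t ∈ Ioi (0 : ℝ), HasDerivAt g
      (a / (t * √t) * Real.exp (-(a ^ 2 / t) - b ^ 2 * t)) t := fun t ht =>
    (hasDerivAt_invGaussPrim a b ht).congr_of_eventuallyEq (hev t ht)
  have hpos : ∀ t ∈ Ioi (0 : ℝ), 0 ≤ a / (t * √t) * Real.exp (-(a ^ 2 / t) - b ^ 2 * t) :=
    fun t ht => by have : (0 : ℝ) < t := ht; positivity
  have htop : Tendsto g atTop (𝓝 (Real.exp (-2 * a * b) * (√Real.pi / 2)
      - Real.exp (2 * a * b) * (√Real.pi / 2))) := by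
    refine (tendsto_invGaussPrim_atTop hb).congr' ?_
    filter_upwards [eventually_gt_atTop 0] with t ht
    rw [hg, Function.update_of_ne ht.ne']
  refine ⟨integrableOn_Ioi_deriv_of_nonneg hcont hd hpos htop, ?_⟩
  rw [integral_Ioi_of_hasDerivAt_of_nonneg hcont hd hpos htop, hg, Function.update_self, hl]
  ring

end

/-! ### The rapidly decaying part of the theta function and its Mellin transform -/

section

/-- The terms of `thetaTail`, indexed by the lattice index `m` and the dual index `k`. -/
def thetaTerm (i : ℕ+ × ℕ+) (t : ℝ) : ℝ :=
  2 * (-1) ^ ((i.1 : ℕ) * i.2) *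
    Real.exp (-(Real.pi * (i.2 : ℝ) ^ 2 / t) - 3 / 4 * Real.pi * (i.1 : ℝ) ^ 2 * t)

/-- The part of the hexagonal theta function that decays rapidly at both ends, without the
factor `t ^ (-1/2)`. -/
def thetaTail (t : ℝ) : ℝ := ∑' i, thetaTerm i t

lemma exp_neg_le_factorial_div {x : ℝ} (hx : 0 < x) (N : ℕ) :
    Real.exp (-x) ≤ (N.factorial : ℝ) / x ^ N := by
  rw [Real.exp_neg, inv_le_comm₀ (Real.exp_pos x) (by positivity), inv_div]
  exact Real.pow_div_factorial_le_exp x hx.le N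

lemma summable_pnat_inv_pow {N : ℕ} (hN : 1 < N) : Summable fun k : ℕ+ => ((k : ℝ) ^ N)⁻¹ :=
  (Real.summable_nat_pow_inv.2 hN).comp_injective PNat.coe_injective

/-- The constant in the rapid decay bound for `thetaTerm`. -/
def thetaBound (M N : ℕ) (i : ℕ+ × ℕ+) : ℝ :=
  2 * (M.factorial / Real.pi ^ M) * (N.factorial / (3 / 4 * Real.pi) ^ N) *
    (((i.1 : ℝ) ^ (2 * N))⁻¹ * ((i.2 : ℝ) ^ (2 * M))⁻¹)

lemma summable_thetaBound {M N : ℕ} (hM : 1 ≤ M) (hN : 1 ≤ N) : Summable (thetaBound M N) := by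
  refine Summable.mul_left _ ?_
  exact (summable_pnat_inv_pow (by lia)).mul_of_nonneg (summable_pnat_inv_pow (by lia))
    (fun _ => by positivity) (fun _ => by positivity)

/-- The two exponentials are bounded separately with independent exponents: large `N` gives decay at
infinity, large `M` gives decay at 0, and the constants stay summable over the lattice. -/
lemma norm_thetaTerm_le (M N : ℕ) (i : ℕ+ × ℕ+) {t : ℝ} (ht : 0 < t) :
    ‖thetaTerm i t‖ ≤ thetaBound M N i * (t ^ M / t ^ N) := by
  have h1 : (0 : ℝ) < i.1 := by exact_mod_cast i.1.pos
  have h2 : (0 : ℝ) < i.2 := by exact_mod_cast i.2.pos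
  have hpi := Real.pi_pos
  have e1 := exp_neg_le_factorial_div (x := Real.pi * (i.2 : ℝ) ^ 2 / t) (by positivity) M
  have e2 := exp_neg_le_factorial_div (x := 3 / 4 * Real.pi * (i.1 : ℝ) ^ 2 * t) (by positivity) N
  have e3 : ‖thetaTerm i t‖ = 2 * (Real.exp (-(Real.pi * (i.2 : ℝ) ^ 2 / t)) *
      Real.exp (-(3 / 4 * Real.pi * (i.1 : ℝ) ^ 2 * t))) := by
    rw [thetaTerm, ← Real.exp_add]
    simp [sub_eq_add_neg]
  rw [e3]
  calc _ ≤ 2 * ((M.factorial / (Real.pi * (i.2 : ℝ) ^ 2 / t) ^ M) *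
        (N.factorial / (3 / 4 * Real.pi * (i.1 : ℝ) ^ 2 * t) ^ N)) := by gcongr
    _ = _ := by
      rw [thetaBound]
      simp only [mul_pow, div_pow, pow_mul]
      field_simp

lemma summable_thetaTerm {t : ℝ} (ht : 0 < t) : Summable fun i => thetaTerm i t :=
  ((summable_thetaBound le_rfl le_rfl).mul_right _).of_norm_bounded
    fun i => norm_thetaTerm_le 1 1 i ht

lemma norm_thetaTail_le {M N : ℕ} (hM : 1 ≤ M) (hN : 1 ≤ N) {t : ℝ} (ht : 0 < t) :
    ‖thetaTail t‖ ≤ (∑' i, thetaBound M N i) * (t ^ M / t ^ N) := by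
  rw [← tsum_mul_right]
  exact tsum_of_norm_bounded ((summable_thetaBound hM hN).mul_right _).hasSum
    fun i => norm_thetaTerm_le M N i ht

lemma continuousOn_thetaTail : ContinuousOn thetaTail (Ioi 0) := by
  refine continuousOn_tsum (u := thetaBound 1 1) (fun i => ?_)
    (summable_thetaBound le_rfl le_rfl) fun i t (ht : 0 < t) => ?_
  · unfold thetaTerm
    refine continuousOn_const.mul (Real.continuous_exp.comp_continuousOn ?_)
    refine ((continuousOn_const.div continuousOn_id fun t ht => (ne_of_gt ht)).neg).sub ?_
    fun_prop
  · simpa [ht.ne'] using norm_thetaTerm_le 1 1 i ht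

/-- The rapidly decaying part of the hexagonal theta function. -/
def thetaRest (t : ℝ) : ℂ := (t : ℂ) ^ (-(1 / 2) : ℂ) • (thetaTail t : ℂ)

lemma norm_thetaRest {t : ℝ} (ht : 0 < t) :
    ‖thetaRest t‖ = t ^ (-(1 / 2) : ℝ) * ‖thetaTail t‖ := by
  rw [thetaRest, norm_smul, Complex.norm_cpow_eq_rpow_re_of_pos ht]
  simp

lemma norm_thetaRest_le {M N : ℕ} (hM : 1 ≤ M) (hN : 1 ≤ N) {t : ℝ} (ht : 0 < t) :
    ‖thetaRest t‖ ≤ (∑' i, thetaBound M N i) * t ^ (-(1 / 2) + M - N : ℝ) := by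
  rw [norm_thetaRest ht]
  calc _ ≤ t ^ (-(1 / 2) : ℝ) * ((∑' i, thetaBound M N i) * (t ^ M / t ^ N)) := by
        gcongr; exact norm_thetaTail_le hM hN ht
    _ = _ := by
        rw [Real.rpow_sub ht, Real.rpow_add ht, Real.rpow_natCast, Real.rpow_natCast]
        ring

lemma thetaRest_isBigO_top (a : ℝ) : thetaRest =O[atTop] (· ^ (-a) : ℝ → ℝ) := by
  obtain ⟨N, hN⟩ := exists_nat_gt (a + 1)
  refine Asymptotics.IsBigO.of_bound (∑' i, thetaBound 1 (N + 1) i) ?_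
  filter_upwards [eventually_ge_atTop 1] with t ht
  have ht0 : (0 : ℝ) < t := by linarith
  refine (norm_thetaRest_le (M := 1) (N := N + 1) le_rfl (by lia) ht0).trans ?_
  have h0 : 0 ≤ ∑' i, thetaBound 1 (N + 1) i := tsum_nonneg fun i => by
    unfold thetaBound; positivity
  rw [Real.norm_of_nonneg (by positivity)]
  gcongr
  push_cast; linarith

lemma thetaRest_isBigO_zero (b : ℝ) : thetaRest =O[𝓝[>] 0] (· ^ (-b) : ℝ → ℝ) := by
  obtain ⟨M, hM⟩ := exists_nat_gt (1 - b)
  refine Asymptotics.IsBigO.of_bound (∑' i, thetaBound (M + 1) 1 i) ?_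
  filter_upwards [Ioo_mem_nhdsGT (zero_lt_one' ℝ)] with t ht
  refine (norm_thetaRest_le (M := M + 1) (N := 1) (by lia) le_rfl ht.1).trans ?_
  have h0 : 0 ≤ ∑' i, thetaBound (M + 1) 1 i := tsum_nonneg fun i => by
    unfold thetaBound; positivity
  have := ht.1
  rw [Real.norm_of_nonneg (by positivity)]
  refine mul_le_mul_of_nonneg_left ?_ h0
  refine Real.rpow_le_rpow_of_exponent_ge ht.1 ht.2.le ?_
  push_cast; linarith

lemma continuousOn_thetaRest : ContinuousOn thetaRest (Ioi 0) := by
  refine ContinuousOn.mul (f := fun t : ℝ => (t : ℂ) ^ (-(1 / 2) : ℂ)) (fun t ht => ?_)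
    (Complex.continuous_ofReal.comp_continuousOn continuousOn_thetaTail)
  exact (Complex.continuousAt_ofReal_cpow_const t _ (Or.inr (ne_of_gt ht))).continuousWithinAt

lemma locallyIntegrableOn_thetaRest : LocallyIntegrableOn thetaRest (Ioi 0) :=
  continuousOn_thetaRest.locallyIntegrableOn measurableSet_Ioi

/-- Decay faster than any power at both ends leaves no strip boundary for the Mellin transform. -/
lemma differentiable_mellin_thetaRest : Differentiable ℂ (mellin thetaRest) := fun s =>
  mellin_differentiableAt_of_isBigO_rpow locallyIntegrableOn_thetaRest
    (thetaRest_isBigO_top (s.re + 1)) (by linarith) (thetaRest_isBigO_zero (s.re - 1))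
    (by linarith)

lemma mellinConvergent_thetaRest (s : ℂ) : MellinConvergent thetaRest s :=
  mellinConvergent_of_isBigO_rpow locallyIntegrableOn_thetaRest
    (thetaRest_isBigO_top (s.re + 1)) (by linarith) (thetaRest_isBigO_zero (s.re - 1))
    (by linarith)

/-- The integral of one term against `t ^ (-3/2)`. -/
lemma integral_thetaTerm (i : ℕ+ × ℕ+) :
    IntegrableOn (fun t => 1 / (t * √t) * thetaTerm i t) (Ioi 0) ∧
    ∫ t in Ioi (0 : ℝ), 1 / (t * √t) * thetaTerm i t =
      2 * (-1) ^ ((i.1 : ℕ) * i.2) / i.2 * Real.exp (-(Real.pi * √3 * i.1 * i.2)) := by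
  have h1 : (0 : ℝ) < i.1 := by exact_mod_cast i.1.pos
  have h2 : (0 : ℝ) < i.2 := by exact_mod_cast i.2.pos
  have hpi := Real.sqrt_pos.2 Real.pi_pos
  have hsq : √Real.pi ^ 2 = Real.pi := Real.sq_sqrt Real.pi_pos.le
  have h3 : √3 ^ 2 = (3 : ℝ) := Real.sq_sqrt (by norm_num)
  obtain ⟨hi, he⟩ := integral_invGauss (a := √Real.pi * i.2) (b := √Real.pi * (√3 / 2) * i.1)
    (by positivity) (by positivity)
  have e : (fun t => 1 / (t * √t) * thetaTerm i t) = fun t =>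
      (2 * (-1) ^ ((i.1 : ℕ) * i.2) / (√Real.pi * i.2)) *
      ((√Real.pi * i.2) / (t * √t) * Real.exp (-((√Real.pi * i.2) ^ 2 / t)
        - (√Real.pi * (√3 / 2) * i.1) ^ 2 * t)) := by
    funext t
    have : -((√Real.pi * i.2) ^ 2 / t) - (√Real.pi * (√3 / 2) * i.1) ^ 2 * t =
        -(Real.pi * (i.2 : ℝ) ^ 2 / t) - 3 / 4 * Real.pi * (i.1 : ℝ) ^ 2 * t := by
      simp only [mul_pow, div_pow, hsq, h3]; ring
    rw [thetaTerm, this]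
    field_simp
  rw [e]
  refine ⟨hi.const_mul _, ?_⟩
  rw [integral_const_mul, he]
  have : -2 * (√Real.pi * ↑↑i.2) * (√Real.pi * (√3 / 2) * ↑↑i.1)
      = -(Real.pi * √3 * i.1 * i.2) := by
    have : -2 * (√Real.pi * ↑↑i.2) * (√Real.pi * (√3 / 2) * ↑↑i.1)
      = -(√Real.pi ^ 2 * √3 * i.1 * i.2) := by ring
    rw [this, hsq]
  rw [this]
  field_simp

lemma summable_exp_mul_div :
    Summable fun i : ℕ+ × ℕ+ => 2 / (i.2 : ℝ) * Real.exp (-(Real.pi * √3 * i.1 * i.2)) := by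
  have hs : (0:ℝ) < Real.pi * √3 := by positivity
  have h := ((summable_pnat_inv_pow (N := 2) (by norm_num)).mul_of_nonneg
    (summable_pnat_inv_pow (N := 2) (by norm_num))
    (fun _ => by positivity) (fun _ => by positivity)).mul_left (4 / (Real.pi * √3) ^ 2)
  refine h.of_nonneg_of_le (fun i => by positivity) fun i => ?_
  have h1 : (0 : ℝ) < i.1 := by exact_mod_cast i.1.pos
  have h2 : (1 : ℝ) ≤ i.2 := by exact_mod_cast i.2.pos
  have h3 := exp_neg_le_factorial_div (x := Real.pi * √3 * i.1 * i.2) (by positivity) 2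
  have h4 : 2 / (i.2 : ℝ) ≤ 2 := div_le_self (by norm_num) h2
  calc _ ≤ 2 * ((2).factorial / (Real.pi * √3 * i.1 * i.2) ^ 2) := by gcongr
    _ = _ := by
      simp only [Nat.factorial]
      field_simp
      norm_num

/-- The value at `0` of the Mellin transform of the rapidly decaying part. -/
lemma hasSum_mellin_thetaRest_zero :
    HasSum (fun i : ℕ+ × ℕ+ =>
      (2 * (-1) ^ ((i.1 : ℕ) * i.2) / i.2 * Real.exp (-(Real.pi * √3 * i.1 * i.2)) : ℝ))
      (∫ t in Ioi (0 : ℝ), 1 / (t * √t) * thetaTail t) := by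
  have h := hasSum_integral_of_summable_integral_norm (μ := volume.restrict (Ioi 0))
    (F := fun i t => 1 / (t * √t) * thetaTerm i t) (fun i => (integral_thetaTerm i).1) ?_
  · simp only [(integral_thetaTerm _).2, tsum_mul_left] at h
    exact h
  · refine summable_exp_mul_div.congr fun i => ?_
    -- Each term has the constant sign (-1)^(mk), so the integral of its norm is that sign times the
    -- integral already computed.
    have e : ∀ t ∈ Ioi (0 : ℝ), ‖1 / (t * √t) * thetaTerm i t‖ =
        (-1) ^ ((i.1 : ℕ) * i.2) * (1 / (t * √t) * thetaTerm i t) := fun t ht => by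
      have ht : (0 : ℝ) < t := ht
      have hm : ((-1 : ℝ) ^ ((i.1 : ℕ) * i.2)) * (-1) ^ ((i.1 : ℕ) * i.2) = 1 := by
        rw [← mul_pow]; simp
      rw [norm_mul, Real.norm_of_nonneg (by positivity)]
      simp only [thetaTerm, norm_mul, norm_pow, norm_neg, norm_one, one_pow, mul_one,
        Real.norm_eq_abs, Real.abs_exp]
      rw [show ∀ a b c e : ℝ, a * (b * (c * a * e)) = (a * a) * (b * (c * e)) from
        fun _ _ _ _ => by ring, hm, one_mul]
      norm_num
    rw [setIntegral_congr_fun measurableSet_Ioi e, integral_const_mul, (integral_thetaTerm i).2]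
    have hm : ((-1 : ℝ) ^ ((i.1 : ℕ) * i.2)) * (-1) ^ ((i.1 : ℕ) * i.2) = 1 := by
      rw [← mul_pow]; simp
    linear_combination (-2 / (i.2 : ℝ) * Real.exp (-(Real.pi * √3 * i.1 * i.2))) * hm

lemma mellin_thetaRest_zero :
    mellin thetaRest 0 = ((∫ t in Ioi (0 : ℝ), 1 / (t * √t) * thetaTail t : ℝ) : ℂ) := by
  rw [mellin, ← integral_complex_ofReal]
  refine setIntegral_congr_fun measurableSet_Ioi fun t (ht : 0 < t) => ?_
  simp only [thetaRest, smul_eq_mul]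
  rw [← mul_assoc, ← Complex.cpow_add _ _ (by exact_mod_cast ht.ne')]
  have e : (t : ℂ) ^ ((0 : ℂ) - 1 + -(1 / 2)) = ((1 / (t * √t) : ℝ) : ℂ) := by
    have : ((0 : ℂ) - 1 + -(1 / 2)) = ((-(1 + 1 / 2) : ℝ) : ℂ) := by push_cast; ring
    rw [this, ← Complex.ofReal_cpow ht.le, Real.rpow_neg ht.le, Real.rpow_add ht, Real.rpow_one,
      ← Real.sqrt_eq_rpow, one_div]
  rw [e]
  push_cast
  ring

end

/-! ### Poisson summation and the zeta function of the half lattice -/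

section

/-- The quadratic form of the hexagonal lattice. -/
def hexForm (m n : ℝ) : ℝ := m ^ 2 + m * n + n ^ 2

lemma hexForm_eq (m n : ℝ) : hexForm m n = (n + m / 2) ^ 2 + 3 / 4 * m ^ 2 := by
  unfold hexForm; ring

/-- A lower bound of product form, so that the double series is dominated by a product of two
one-dimensional series. -/
lemma one_third_mul_le_hexForm {m n : ℝ} (hm : 1 ≤ m) :
    1 / 3 * (m * (|n| + 1)) ≤ hexForm m n := by
  have h1 : |n| ^ 2 = n ^ 2 := sq_abs n
  have h2 : -(m * |n|) ≤ m * n := by nlinarith [neg_abs_le n]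
  unfold hexForm
  nlinarith [sq_nonneg (m - |n|), abs_nonneg n, sq_nonneg (|n| - 1)]

lemma hexForm_pos {m n : ℝ} (hm : 1 ≤ m) : 0 < hexForm m n :=
  lt_of_lt_of_le (by positivity) (one_third_mul_le_hexForm hm)

lemma PNat.one_le_cast_real (m : ℕ+) : (1 : ℝ) ≤ m := by exact_mod_cast m.pos

lemma summable_int_abs_add_one_rpow {σ : ℝ} (hσ : 1 < σ) :
    Summable fun n : ℤ => 1 / (|(n : ℝ)| + 1) ^ σ := by
  have h := (summable_nat_add_iff 1).2 (Real.summable_one_div_nat_rpow.2 hσ)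
  refine Summable.of_nat_of_neg ?_ ?_ <;> simpa using h

lemma summable_hexForm {σ : ℝ} (hσ : 1 < σ) :
    Summable fun i : ℕ+ × ℤ => 1 / (hexForm i.1 i.2) ^ σ := by
  have h1 : Summable fun m : ℕ+ => 1 / (m : ℝ) ^ σ :=
    (Real.summable_one_div_nat_rpow.2 hσ).comp_injective PNat.coe_injective
  have h := (h1.mul_of_nonneg (summable_int_abs_add_one_rpow hσ) (fun _ => by positivity)
    (fun _ => by positivity)).mul_left (3 ^ σ)
  refine h.of_nonneg_of_le (fun i => ?_) fun i => ?_
  · have := hexForm_pos (n := i.2) (PNat.one_le_cast_real i.1)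
    positivity
  · have hm := PNat.one_le_cast_real i.1
    have hb := one_third_mul_le_hexForm (n := i.2) hm
    calc 1 / (hexForm i.1 i.2) ^ σ ≤ 1 / (1 / 3 * ((i.1 : ℝ) * (|(i.2 : ℝ)| + 1))) ^ σ := by
          gcongr
      _ = _ := by
          rw [Real.mul_rpow (by norm_num) (by positivity), Real.mul_rpow (by positivity)
            (by positivity), Real.div_rpow (by norm_num) (by norm_num), Real.one_rpow]
          field_simp

/-- The theta series of the hexagonal lattice, over a half plane. -/
def hexTheta (t : ℝ) : ℂ := ∑' i : ℕ+ × ℤ, ((Real.exp (-Real.pi * hexForm i.1 i.2 * t) : ℝ) : ℂ)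

lemma summable_hexTheta {t : ℝ} (ht : 0 < t) :
    Summable fun i : ℕ+ × ℤ => Real.exp (-Real.pi * hexForm i.1 i.2 * t) := by
  have h := (summable_hexForm (σ := 2) (by norm_num)).mul_left (2 / (Real.pi * t) ^ 2)
  refine h.of_nonneg_of_le (fun i => by positivity) fun i => ?_
  have h1 := hexForm_pos (n := i.2) (PNat.one_le_cast_real i.1)
  have hpi := Real.pi_pos
  have h2 := exp_neg_le_factorial_div (x := Real.pi * hexForm i.1 i.2 * t) (by positivity) 2
  refine le_trans (le_of_eq (by congr 1; ring)) (h2.trans (le_of_eq ?_))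
  norm_cast
  simp only [Nat.factorial]
  field_simp
  norm_num

lemma hasSum_mellin_hexTheta {s : ℂ} (hs : 1 < s.re) :
    HasSum (fun i : ℕ+ × ℤ => (Real.pi : ℂ) ^ (-s) * Complex.Gamma s * 1
      / (hexForm i.1 i.2 : ℂ) ^ s) (mellin hexTheta s) := by
  refine hasSum_mellin_pi_mul (a := fun _ => 1) (fun i => Or.inr ?_) (by linarith) ?_ ?_
  · exact hexForm_pos (PNat.one_le_cast_real i.1)
  · intro t ht
    simp only [one_mul]
    rw [hexTheta, ← Complex.ofReal_tsum]
    exact Complex.hasSum_ofReal.2 (summable_hexTheta ht).hasSum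
  · simpa using summable_hexForm hs

/-- The part of `hexTheta` given by the zero frequencies, without the factor `t ^ (-1/2)`. -/
def sqTheta (t : ℝ) : ℂ :=
  ∑' m : ℕ+, ((Real.exp (-Real.pi * (3 / 4 * (m : ℝ) ^ 2) * t) : ℝ) : ℂ)

lemma summable_sqTheta {t : ℝ} (ht : 0 < t) :
    Summable fun m : ℕ+ => Real.exp (-Real.pi * (3 / 4 * (m : ℝ) ^ 2) * t) := by
  have h := (summable_pnat_inv_pow (N := 2) (by norm_num)).mul_left (1 / (3 / 4 * Real.pi * t))
  refine h.of_nonneg_of_le (fun i => by positivity) fun m => ?_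
  have h1 := PNat.one_le_cast_real m
  have hpi := Real.pi_pos
  have h2 := exp_neg_le_factorial_div (x := Real.pi * (3 / 4 * (m : ℝ) ^ 2) * t)
    (by positivity) 1
  refine le_trans (le_of_eq (by congr 1; ring)) (h2.trans (le_of_eq ?_))
  simp only [Nat.factorial]
  field_simp
  norm_num

lemma hasSum_mellin_sqTheta {s : ℂ} (hs : 1 / 2 < s.re) :
    HasSum (fun m : ℕ+ => (Real.pi : ℂ) ^ (-s) * Complex.Gamma s * 1
      / (((3 / 4 * (m : ℝ) ^ 2 : ℝ) : ℂ)) ^ s) (mellin sqTheta s) := by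
  refine hasSum_mellin_pi_mul (a := fun _ => 1) (fun i => Or.inr ?_) (by linarith) ?_ ?_
  · positivity
  · intro t ht
    simp only [one_mul]
    rw [sqTheta, ← Complex.ofReal_tsum]
    exact Complex.hasSum_ofReal.2 (summable_sqTheta ht).hasSum
  · have h1 : Summable fun m : ℕ+ => 1 / (m : ℝ) ^ (2 * s.re) :=
      (Real.summable_one_div_nat_rpow.2 (by linarith)).comp_injective PNat.coe_injective
    refine (h1.mul_left (1 / (3 / 4) ^ s.re)).congr fun m => ?_
    rw [Real.mul_rpow (by norm_num) (by positivity), Real.rpow_mul (by positivity),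
      Real.rpow_two]
    simp
    ring

lemma hasSum_pnat_riemannZeta {s : ℂ} (hs : 1 < s.re) :
    HasSum (fun m : ℕ+ => 1 / (m : ℂ) ^ s) (riemannZeta s) := by
  have h1 : Summable fun m : ℕ+ => 1 / (m : ℂ) ^ s :=
    (Complex.summable_one_div_nat_cpow.2 hs).comp_injective PNat.coe_injective
  rw [zeta_eq_tsum_one_div_nat_add_one_cpow hs]
  convert h1.hasSum using 1
  rw [← Equiv.pnatEquivNat.symm.tsum_eq]
  exact tsum_congr fun n => by simp

lemma mellin_sqTheta {s : ℂ} (hs : 1 / 2 < s.re) :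
    mellin sqTheta s = (Real.pi : ℂ) ^ (-s) * Complex.Gamma s * ((3 / 4 : ℝ) : ℂ) ^ (-s)
      * riemannZeta (2 * s) := by
  refine (hasSum_mellin_sqTheta hs).unique ?_
  have h := (hasSum_pnat_riemannZeta (s := 2 * s) (by simp; linarith)).mul_left
    ((Real.pi : ℂ) ^ (-s) * Complex.Gamma s * ((3 / 4 : ℝ) : ℂ) ^ (-s))
  refine h.congr_fun fun m => ?_
  have hm : (0 : ℝ) ≤ (m : ℝ) ^ 2 := by positivity
  have h1 := PNat.one_le_cast_real m
  have e : (((m : ℝ) ^ 2 : ℝ) : ℂ) ^ s = (m : ℂ) ^ (2 * s) := by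
    rw [two_mul, Complex.cpow_add _ _ (by exact_mod_cast m.ne_zero), pow_two,
      Complex.ofReal_mul, Complex.mul_cpow_ofReal_nonneg (by positivity) (by positivity)]
    simp
  rw [Complex.ofReal_mul, Complex.mul_cpow_ofReal_nonneg (by norm_num) hm, e,
    Complex.cpow_neg _ s, Complex.cpow_neg _ s]
  ring

lemma summable_gaussian_int {t : ℝ} (ht : 0 < t) :
    Summable fun k : ℤ => Real.exp (-(Real.pi * (k : ℝ) ^ 2 / t)) := by
  have h := (summable_int_abs_add_one_rpow (σ := 2) (by norm_num)).mul_left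
    (Real.exp (Real.pi / t) * (2 * t / Real.pi))
  refine h.of_nonneg_of_le (fun i => by positivity) fun k => ?_
  have hpi := Real.pi_pos
  have h2 := exp_neg_le_factorial_div (x := Real.pi * ((k : ℝ) ^ 2 + 1) / t) (by positivity) 1
  have e : Real.exp (-(Real.pi * (k : ℝ) ^ 2 / t)) =
      Real.exp (Real.pi / t) * Real.exp (-(Real.pi * ((k : ℝ) ^ 2 + 1) / t)) := by
    rw [← Real.exp_add]; congr 1; field_simp; ring
  rw [e, mul_assoc]
  refine mul_le_mul_of_nonneg_left (h2.trans ?_) (by positivity)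
  rw [Real.rpow_two]
  have h3 : (|(k : ℝ)| + 1) ^ 2 ≤ 2 * ((k : ℝ) ^ 2 + 1) := by
    rw [← sq_abs (k : ℝ)]; nlinarith [sq_nonneg (|(k : ℝ)| - 1)]
  calc _ = 2 * t / Real.pi * (1 / (2 * ((k : ℝ) ^ 2 + 1))) := by
        simp only [Nat.factorial]; field_simp; norm_num
    _ ≤ _ := by gcongr

/-- Poisson summation for a shifted Gaussian. -/
lemma tsum_gaussian_half_shift {t : ℝ} (ht : 0 < t) (m : ℕ) :
    (∑' n : ℤ, ((Real.exp (-Real.pi * ((n : ℝ) + m / 2) ^ 2 * t) : ℝ) : ℂ)) =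
      (t : ℂ) ^ (-(1 / 2) : ℂ) *
        ∑' k : ℤ, (((-1) ^ (m * k.natAbs) * Real.exp (-(Real.pi * (k : ℝ) ^ 2 / t)) : ℝ) : ℂ) := by
  -- The imaginary linear coefficient becomes the real shift m/2 on one side of the Poisson formula
  -- and the character exp(-πimk) = (-1)^(mk) on the other.
  have h := Complex.tsum_exp_neg_quadratic (a := ((1 / t : ℝ) : ℂ))
    (by rw [Complex.ofReal_re]; positivity) (-(Complex.I * m / 2))
  have htc : (t : ℂ) ≠ 0 := by exact_mod_cast ht.ne'
  have e1 : ∀ n : ℤ, Complex.exp (-Real.pi / ((1 / t : ℝ) : ℂ) *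
      (n + Complex.I * -(Complex.I * m / 2)) ^ 2) =
      ((Real.exp (-Real.pi * ((n : ℝ) + m / 2) ^ 2 * t) : ℝ) : ℂ) := fun n => by
    rw [show Complex.I * -(Complex.I * m / 2) = -(Complex.I * Complex.I) * m / 2 by ring,
      Complex.I_mul_I]
    push_cast
    congr 1
    field_simp
  have e2 : ∀ k : ℤ, Complex.exp (-Real.pi * ((1 / t : ℝ) : ℂ) * k ^ 2 +
      2 * Real.pi * -(Complex.I * m / 2) * k) =
      (((-1) ^ (m * k.natAbs) * Real.exp (-(Real.pi * (k : ℝ) ^ 2 / t)) : ℝ) : ℂ) := fun k => by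
    have : ((-1 : ℂ)) ^ (m * k.natAbs) = Complex.exp (-(Real.pi * Complex.I * (m * k))) := by
      rcases Int.natAbs_eq k with hk | hk
      · conv_rhs => rw [hk]
        rw [Int.cast_natCast, ← Nat.cast_mul, mul_comm (Real.pi * Complex.I : ℂ), ← mul_neg,
          Complex.exp_nat_mul, Complex.exp_neg, Complex.exp_pi_mul_I]
        norm_num
      · conv_rhs => rw [hk]
        rw [Int.cast_neg, mul_neg, mul_neg, neg_neg, Int.cast_natCast, ← Nat.cast_mul,
          mul_comm (Real.pi * Complex.I : ℂ), Complex.exp_nat_mul, Complex.exp_pi_mul_I]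
    push_cast
    rw [this, ← Complex.exp_add]
    congr 1
    field_simp
    ring
  simp only [e1, e2] at h
  rw [h, ← mul_assoc]
  have : (t : ℂ) ^ (-(1 / 2) : ℂ) * (1 / ((1 / t : ℝ) : ℂ) ^ (1 / 2 : ℂ)) = 1 := by
    have h2 : ((1 / t : ℝ) : ℂ) ^ (1 / 2 : ℂ) = (t : ℂ) ^ (-(1 / 2) : ℂ) := by
      rw [Complex.cpow_neg, one_div, Complex.ofReal_inv, Complex.inv_cpow]
      rw [Complex.arg_ofReal_of_nonneg ht.le]
      exact Real.pi_ne_zero.symm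
    rw [h2]
    field_simp
    exact div_self (by simp [Complex.cpow_eq_zero_iff, htc])
  rw [this, one_mul]

lemma tsum_int_gaussian_sign {t : ℝ} (ht : 0 < t) (m : ℕ) :
    ∑' k : ℤ, ((-1) ^ (m * k.natAbs) * Real.exp (-(Real.pi * (k : ℝ) ^ 2 / t))) =
      1 + ∑' k : ℕ+, 2 * ((-1) ^ (m * k) * Real.exp (-(Real.pi * (k : ℝ) ^ 2 / t))) := by
  rw [tsum_int_eq_zero_add_two_mul_tsum_pnat, tsum_mul_left]
  · simp
  · intro k; simp
  · refine (summable_gaussian_int ht).of_norm_bounded fun k => ?_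
    simp

/-- The decomposition of the theta series obtained by Poisson summation. -/
lemma hexTheta_eq {t : ℝ} (ht : 0 < t) :
    hexTheta t = (t : ℂ) ^ (-(1 / 2) : ℂ) • sqTheta t + thetaRest t := by
  have hs := Complex.summable_ofReal.2 (summable_hexTheta ht)
  have h1 : ∀ m : ℕ+, ∑' n : ℤ, ((Real.exp (-Real.pi * hexForm m n * t) : ℝ) : ℂ) =
      (t : ℂ) ^ (-(1 / 2) : ℂ) * (((Real.exp (-Real.pi * (3 / 4 * (m : ℝ) ^ 2) * t)
        + ∑' k : ℕ+, thetaTerm (m, k) t : ℝ)) : ℂ) := fun m => by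
    have e : ∀ n : ℤ, ((Real.exp (-Real.pi * hexForm m n * t) : ℝ) : ℂ) =
        ((Real.exp (-Real.pi * (3 / 4 * (m : ℝ) ^ 2) * t) : ℝ) : ℂ) *
        ((Real.exp (-Real.pi * ((n : ℝ) + (m : ℕ) / 2) ^ 2 * t) : ℝ) : ℂ) := fun n => by
      rw [← Complex.ofReal_mul, ← Real.exp_add, hexForm_eq]
      congr 2; ring
    simp only [e]
    rw [tsum_mul_left, tsum_gaussian_half_shift ht, ← Complex.ofReal_tsum,
      tsum_int_gaussian_sign ht, mul_left_comm, ← Complex.ofReal_mul, mul_add, mul_one,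
      ← tsum_mul_left]
    congr 4
    funext k
    simp only [thetaTerm]
    rw [sub_eq_add_neg, Real.exp_add]
    have : -Real.pi * (3 / 4 * (m : ℝ) ^ 2) * t = -(3 / 4 * Real.pi * (m : ℝ) ^ 2 * t) := by ring
    rw [this]
    ring
  rw [hexTheta, hs.tsum_prod]
  simp only [h1]
  rw [tsum_mul_left, ← Complex.ofReal_tsum, Summable.tsum_add (summable_sqTheta ht)
    (summable_thetaTerm ht).prod, thetaRest, sqTheta, thetaTail, (summable_thetaTerm ht).tsum_prod,
    smul_eq_mul, smul_eq_mul]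
  push_cast
  ring

/-- The Dirichlet series of the hexagonal form over a half plane. -/
def hexSeries (s : ℂ) : ℂ := ∑' i : ℕ+ × ℤ, 1 / (hexForm i.1 i.2 : ℂ) ^ s

lemma norm_hexTerm (i : ℕ+ × ℤ) (s : ℂ) :
    ‖1 / (hexForm i.1 i.2 : ℂ) ^ s‖ = 1 / (hexForm i.1 i.2) ^ s.re := by
  rw [norm_div, norm_one, Complex.norm_cpow_eq_rpow_re_of_pos
    (hexForm_pos (PNat.one_le_cast_real i.1))]

lemma summable_hexSeries {s : ℂ} (hs : 1 < s.re) :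
    Summable fun i : ℕ+ × ℤ => 1 / (hexForm i.1 i.2 : ℂ) ^ s :=
  (summable_hexForm hs).of_norm_bounded fun i => (norm_hexTerm i s).le

/-- The meromorphic continuation of `hexSeries`. -/
def hexZeta (s : ℂ) : ℂ :=
  (Complex.Gamma s)⁻¹ * ((√Real.pi : ℂ) * ((3 / 4 : ℝ) : ℂ) ^ (1 / 2 - s) *
    Complex.Gamma (s - 1 / 2) * riemannZeta (2 * s - 1) + (Real.pi : ℂ) ^ s * mellin thetaRest s)

/-- Mellin transform of the Poisson decomposition: the factor t^(-1/2) moves the argument of the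
zero-frequency part to s - 1/2, which produces Γ(s - 1/2) ζ(2s - 1). -/
lemma hexSeries_eq_hexZeta {s : ℂ} (hs : 1 < s.re) : hexSeries s = hexZeta s := by
  have hpi : (Real.pi : ℂ) ≠ 0 := by exact_mod_cast Real.pi_ne_zero
  have hG : Complex.Gamma s ≠ 0 := Complex.Gamma_ne_zero_of_re_pos (by linarith)
  have h1 := (hasSum_mellin_hexTheta hs).unique
    (((summable_hexSeries hs).hasSum.mul_left ((Real.pi : ℂ) ^ (-s) * Complex.Gamma s)).congr_fun
      fun i => by ring)
  have h2 : mellin hexTheta s = mellin sqTheta (s - 1 / 2) + mellin thetaRest s := by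
    have h0 : 1 / 2 < (s - 1 / 2).re := by norm_num; linarith
    have h3 : MellinConvergent sqTheta (s - 1 / 2) := by
      -- A divergent integral has the default value 0, whereas the closed form is a product of
      -- nonvanishing factors.
      by_contra h
      have h4 := mellin_sqTheta h0
      rw [mellin, integral_undef h] at h4
      refine (mul_ne_zero (mul_ne_zero (mul_ne_zero ?_ ?_) ?_) ?_) h4.symm
      · simp [Complex.cpow_eq_zero_iff, hpi]
      · exact Complex.Gamma_ne_zero_of_re_pos (by linarith)
      · simp [Complex.cpow_eq_zero_iff]
      · exact riemannZeta_ne_zero_of_one_lt_re (by norm_num at h0 ⊢; linarith)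
    have h5 : MellinConvergent (fun t => (t : ℂ) ^ (-(1 / 2) : ℂ) • sqTheta t) s := by
      rw [MellinConvergent.cpow_smul, ← sub_eq_add_neg]; exact h3
    rw [show s - 1 / 2 = s + -(1 / 2) by ring, ← mellin_cpow_smul,
      ← (hasMellin_add h5 (mellinConvergent_thetaRest s)).2]
    exact setIntegral_congr_fun measurableSet_Ioi fun t ht => by
      simp only [hexTheta_eq ht]
  have hpis : (Real.pi : ℂ) ^ s ≠ 0 := by simp [Complex.cpow_eq_zero_iff, hpi]
  have h6 := mellin_sqTheta (s := s - 1 / 2) (by norm_num; linarith)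
  have h7 : (Real.pi : ℂ) ^ s * (Real.pi : ℂ) ^ (-(s - 1 / 2)) = √Real.pi := by
    rw [← Complex.cpow_add _ _ hpi, Real.sqrt_eq_rpow, Complex.ofReal_cpow Real.pi_pos.le]
    congr 1; push_cast; ring
  have h8 : hexSeries s = (Complex.Gamma s)⁻¹ * ((Real.pi : ℂ) ^ s * mellin hexTheta s) := by
    rw [h1, hexSeries, Complex.cpow_neg]
    field_simp
  rw [h8, h2, h6, hexZeta, mul_add, ← h7]
  congr 2
  rw [show 2 * (s - 1 / 2) = 2 * s - 1 by ring, show -(s - 1 / 2) = 1 / 2 - s by ring]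
  ring

end

/-! ### Folding the lattice onto the eigenvalues; continuation and derivative at 0 -/

section

/-- Splitting of the quarter lattice into two sectors and the diagonal. -/
def sectorMap : (ℕ+ × ℕ+) ⊕ ((ℕ+ × ℕ+) ⊕ ℕ+) → ℕ+ × ℕ+
  | .inl i => (i.2 + i.1, i.2)
  | .inr (.inl i) => (i.2, i.2 + i.1)
  | .inr (.inr k) => (k, k)

lemma sectorMap_bijective : Function.Bijective sectorMap := by
  constructor
  · rintro (⟨a, b⟩ | ⟨a, b⟩ | a) (⟨c, d⟩ | ⟨c, d⟩ | c) h <;>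
      simp only [sectorMap, Prod.mk.injEq, ← PNat.coe_inj, PNat.add_coe] at h <;>
      have := PNat.pos a <;> have := PNat.pos c <;>
      simp only [Sum.inl.injEq, Sum.inr.injEq, Prod.mk.injEq, ← PNat.coe_inj, reduceCtorEq] <;>
      lia
  · rintro ⟨a, b⟩
    rcases lt_trichotomy a b with h | h | h
    · exact ⟨.inr (.inl (b - a, a)), by simp [sectorMap, PNat.add_sub_of_lt h]⟩
    · exact ⟨.inr (.inr a), by simp [sectorMap, h]⟩
    · exact ⟨.inl (a - b, b), by simp [sectorMap, PNat.add_sub_of_lt h]⟩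

/-- Splitting of the half lattice into three quarter lattices and two lines. -/
def halfMap : ((ℕ+ × ℕ+) ⊕ ((ℕ+ × ℕ+) ⊕ (ℕ+ × ℕ+))) ⊕ (ℕ+ ⊕ ℕ+) → ℕ+ × ℤ
  | .inl (.inl i) => (i.1, i.2)
  | .inl (.inr (.inl i)) => (i.1 + i.2, -(i.2 : ℤ))
  | .inl (.inr (.inr i)) => (i.1, -(i.1 : ℤ) - i.2)
  | .inr (.inl k) => (k, 0)
  | .inr (.inr k) => (k, -(k : ℤ))

lemma halfMap_bijective : Function.Bijective halfMap := by
  constructor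
  · rintro ((⟨a, b⟩ | ⟨a, b⟩ | ⟨a, b⟩) | a | a) ((⟨c, d⟩ | ⟨c, d⟩ | ⟨c, d⟩) | c | c) h <;>
      simp only [halfMap, Prod.mk.injEq, ← PNat.coe_inj, PNat.add_coe] at h <;>
      have := PNat.pos a <;> have := PNat.pos c <;>
      simp only [Sum.inl.injEq, Sum.inr.injEq, Prod.mk.injEq, ← PNat.coe_inj, reduceCtorEq] <;>
      (try have := PNat.pos b) <;> (try have := PNat.pos d) <;> lia
  · rintro ⟨a, n⟩
    have ha := a.pos
    rcases lt_trichotomy n 0 with h | h | h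
    · rcases lt_trichotomy (-n) a with h' | h' | h'
      · refine ⟨.inl (.inr (.inl (⟨(a + n).toNat, by lia⟩, ⟨(-n).toNat, by lia⟩))), ?_⟩
        refine Prod.ext (PNat.eq ?_) ?_
        · change (a + n).toNat + (-n).toNat = (a : ℕ)
          lia
        · change -(((-n).toNat : ℕ) : ℤ) = n
          lia
      · refine ⟨.inr (.inr a), ?_⟩
        simp only [halfMap, Prod.mk.injEq, true_and]
        lia
      · refine ⟨.inl (.inr (.inr (a, ⟨(-n - a).toNat, by lia⟩))), ?_⟩
        simp only [halfMap, Prod.mk.injEq, PNat.mk_coe, true_and]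
        lia
    · exact ⟨.inr (.inl a), by simp [halfMap, h]⟩
    · refine ⟨.inl (.inl (a, ⟨n.toNat, by lia⟩)), ?_⟩
      simp only [halfMap, Prod.mk.injEq, PNat.mk_coe, true_and]
      lia

lemma hasSum_of_bijective_sum {α β γ : Type*} {g : α ⊕ β → γ} (hg : Function.Bijective g)
    {f : γ → ℂ} (hf : Summable f) :
    Summable (f ∘ g ∘ Sum.inl) ∧ Summable (f ∘ g ∘ Sum.inr) ∧
      ∑' c, f c = ∑' a, f (g (.inl a)) + ∑' b, f (g (.inr b)) := by
  have h := (Equiv.ofBijective g hg).summable_iff.2 hf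
  have h1 : Summable (f ∘ g ∘ Sum.inl) := h.comp_injective Sum.inl_injective
  have h2 : Summable (f ∘ g ∘ Sum.inr) := h.comp_injective Sum.inr_injective
  refine ⟨h1, h2, ?_⟩
  rw [← (Equiv.ofBijective g hg).tsum_eq]
  exact Summable.tsum_sum (f := fun x => f (Equiv.ofBijective g hg x)) h1 h2

/-- The quadratic form that gives the Dirichlet eigenvalues. -/
def modeForm (i : ℕ+ × ℕ+) : ℝ := hexForm (i.2 + i.1) i.2

lemma modeForm_pos (i : ℕ+ × ℕ+) : 0 < modeForm i :=
  hexForm_pos (by have := PNat.one_le_cast_real i.1; have := PNat.one_le_cast_real i.2; linarith)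

lemma hasSum_pnat_diag {s : ℂ} (hs : 1 < s.re) (c : ℝ) (hc : 0 ≤ c) :
    HasSum (fun k : ℕ+ => 1 / ((c * (k : ℝ) ^ 2 : ℝ) : ℂ) ^ s)
      ((c : ℂ) ^ (-s) * riemannZeta (2 * s)) := by
  refine ((hasSum_pnat_riemannZeta (s := 2 * s) (by simp; linarith)).mul_left
    ((c : ℂ) ^ (-s))).congr_fun fun m => ?_
  have h1 := PNat.one_le_cast_real m
  have e : (((m : ℝ) ^ 2 : ℝ) : ℂ) ^ s = (m : ℂ) ^ (2 * s) := by
    rw [two_mul, Complex.cpow_add _ _ (by exact_mod_cast m.ne_zero), pow_two,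
      Complex.ofReal_mul, Complex.mul_cpow_ofReal_nonneg (by positivity) (by positivity)]
    simp
  rw [Complex.ofReal_mul, Complex.mul_cpow_ofReal_nonneg hc (by positivity), e, Complex.cpow_neg]
  ring

/-- The meromorphic continuation of the Dirichlet series of `modeForm`. -/
def modeZeta (s : ℂ) : ℂ :=
  hexZeta s / 6 - riemannZeta (2 * s) / 3 - (3 : ℂ) ^ (-s) * riemannZeta (2 * s) / 2

/-- The half lattice consists of three images of the positive quarter under maps preserving the
form, together with two rays contributing ζ(2s) each. The quarter consists of two copies of the cone
of modes, exchanged by symmetry of the form, and the diagonal, where the form is 3k². Solving these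
two linear relations for the sum over the cone gives `modeZeta`. -/
lemma hasSum_modeForm {s : ℂ} (hs : 1 < s.re) :
    HasSum (fun i => 1 / (modeForm i : ℂ) ^ s) (modeZeta s) := by
  set f : ℕ+ × ℤ → ℂ := fun i => 1 / (hexForm i.1 i.2 : ℂ) ^ s with hf
  set q : ℕ+ × ℕ+ → ℂ := fun i => 1 / (hexForm i.1 i.2 : ℂ) ^ s with hq
  obtain ⟨h1, h2, h3⟩ := hasSum_of_bijective_sum halfMap_bijective (f := f) (summable_hexSeries hs)
  have e1 : ∀ i, f (halfMap (.inl (.inl i))) = q i := fun i => by simp [hf, hq, halfMap]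
  have e2 : ∀ i, f (halfMap (.inl (.inr (.inl i)))) = q i := fun i => by
    simp only [hf, hq, halfMap]
    congr 3
    simp only [hexForm]; push_cast; ring
  have e3 : ∀ i, f (halfMap (.inl (.inr (.inr i)))) = q i := fun i => by
    simp only [hf, hq, halfMap]
    congr 3
    simp only [hexForm]; push_cast; ring
  have d1 : ∀ k, f (halfMap (.inr (.inl k))) = 1 / ((1 * (k : ℝ) ^ 2 : ℝ) : ℂ) ^ s := fun k => by
    simp only [hf, halfMap]
    congr 3
    simp only [hexForm]; push_cast; ring
  have d2 : ∀ k, f (halfMap (.inr (.inr k))) = 1 / ((1 * (k : ℝ) ^ 2 : ℝ) : ℂ) ^ s := fun k => by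
    simp only [hf, halfMap]
    congr 3
    simp only [hexForm]; push_cast; ring
  have z1 := hasSum_pnat_diag hs 1 zero_le_one
  have z3 := hasSum_pnat_diag hs 3 zero_le_three
  have hqs : Summable q :=
    (h1.comp_injective Sum.inl_injective).congr fun i => (e1 i)
  have t1 : ∑' b, f (halfMap (.inr b)) = riemannZeta (2 * s) + riemannZeta (2 * s) := by
    rw [Summable.tsum_sum (f := fun b => f (halfMap (.inr b)))
      (h2.comp_injective Sum.inl_injective) (h2.comp_injective Sum.inr_injective)]
    simp only [d1, d2, z1.tsum_eq]
    simp
  have h1r : Summable fun b => f (halfMap (.inl (.inr b))) := h1.comp_injective Sum.inr_injective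
  have t2 : ∑' a, f (halfMap (.inl a)) = ∑' i, q i + (∑' i, q i + ∑' i, q i) := by
    rw [Summable.tsum_sum (f := fun a => f (halfMap (.inl a)))
      (h1.comp_injective Sum.inl_injective) h1r,
      Summable.tsum_sum (f := fun b => f (halfMap (.inl (.inr b))))
      (h1r.comp_injective Sum.inl_injective) (h1r.comp_injective Sum.inr_injective)]
    simp only [e1, e2, e3]
  obtain ⟨g1, g2, g3⟩ := hasSum_of_bijective_sum sectorMap_bijective hqs
  set r : ℕ+ × ℕ+ → ℂ := fun i => 1 / (modeForm i : ℂ) ^ s with hr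
  have k1 : ∀ i, q (sectorMap (.inl i)) = r i := fun i => by
    simp [hq, hr, sectorMap, modeForm]
  have k2 : ∀ i, q (sectorMap (.inr (.inl i))) = r i := fun i => by
    simp only [hq, hr, sectorMap, modeForm]
    congr 3
    simp only [hexForm]; push_cast; ring
  have k3 : ∀ k, q (sectorMap (.inr (.inr k))) = 1 / ((3 * (k : ℝ) ^ 2 : ℝ) : ℂ) ^ s := fun k => by
    simp only [hq, sectorMap]
    congr 3
    simp only [hexForm]; ring
  have hrs : Summable r := g1.congr fun i => k1 i
  have t3 : ∑' b, q (sectorMap (.inr b)) = ∑' i, r i + 3 ^ (-s) * riemannZeta (2 * s) := by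
    rw [Summable.tsum_sum (f := fun b => q (sectorMap (.inr b)))
      (g2.comp_injective Sum.inl_injective) (g2.comp_injective Sum.inr_injective)]
    simp only [k2, k3, z3.tsum_eq]
    simp
  simp only [k1] at g3
  have hW : ∑' c, f c = hexZeta s := hexSeries_eq_hexZeta hs
  rw [hW, t2, t1] at h3
  rw [t3] at g3
  convert hrs.hasSum using 1
  rw [modeZeta, h3, g3]
  ring

/-- The cofactor of 1/Γ in `hexZeta` is treated alone because its value at 0 is the derivative of
`hexZeta` there. -/
lemma differentiableAt_hexZeta {s : ℂ} (h1 : ∀ m : ℕ, s - 1 / 2 ≠ -m) (h2 : 2 * s - 1 ≠ 1) :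
    DifferentiableAt ℂ (fun s : ℂ => (√Real.pi : ℂ) * ((3 / 4 : ℝ) : ℂ) ^ (1 / 2 - s) *
      Complex.Gamma (s - 1 / 2) * riemannZeta (2 * s - 1)
        + (Real.pi : ℂ) ^ s * mellin thetaRest s) s := by
  have e1 : DifferentiableAt ℂ (fun s : ℂ => ((3 / 4 : ℝ) : ℂ) ^ (1 / 2 - s)) s :=
    (DifferentiableAt.const_cpow (by fun_prop) (Or.inl (by norm_num)))
  have e2 : DifferentiableAt ℂ (fun s : ℂ => (Real.pi : ℂ) ^ s) s :=
    (DifferentiableAt.const_cpow (by fun_prop) (Or.inl (by exact_mod_cast Real.pi_ne_zero)))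
  have e3 : DifferentiableAt ℂ (fun s : ℂ => Complex.Gamma (s - 1 / 2)) s :=
    (Complex.differentiableAt_Gamma _ h1).comp s (f := fun s : ℂ => s - 1 / 2) (by fun_prop)
  have e4 : DifferentiableAt ℂ (fun s : ℂ => riemannZeta (2 * s - 1)) s :=
    (differentiableAt_riemannZeta h2).comp s (f := fun s : ℂ => 2 * s - 1) (by fun_prop)
  exact ((((differentiableAt_const _).mul e1).mul e3).mul e4).add
    (e2.mul (differentiable_mellin_thetaRest s))

lemma differentiableAt_modeZeta {s : ℂ} (h1 : ∀ m : ℕ, s - 1 / 2 ≠ -m) (h2 : 2 * s - 1 ≠ 1)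
    (h3 : 2 * s ≠ 1) : DifferentiableAt ℂ modeZeta s := by
  have e1 : DifferentiableAt ℂ hexZeta s :=
    (Complex.differentiable_one_div_Gamma s).mul (differentiableAt_hexZeta h1 h2)
  have e2 : DifferentiableAt ℂ (fun s : ℂ => (3 : ℂ) ^ (-s)) s :=
    (DifferentiableAt.const_cpow (by fun_prop) (Or.inl (by norm_num)))
  have e3 : DifferentiableAt ℂ (fun s : ℂ => riemannZeta (2 * s)) s :=
    (differentiableAt_riemannZeta h3).comp s (f := fun s : ℂ => 2 * s) (by fun_prop)
  exact ((e1.div_const 6).sub (e3.div_const 3)).sub ((e2.mul e3).div_const 2)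

/-- Away from 1, zeta is (s - 1)⁻¹ times the entire function `riemannZeta₁`; the value assigned at
the pole does not matter. -/
lemma meromorphicAt_riemannZeta (s : ℂ) : MeromorphicAt riemannZeta s := by
  have h : MeromorphicAt (fun s => (s - 1)⁻¹ * riemannZeta₁ s) s :=
    ((MeromorphicAt.id s).sub (MeromorphicAt.const 1 s)).inv.mul
      (differentiable_riemannZeta₁.analyticAt s).meromorphicAt
  refine h.congr ?_
  have : ∀ᶠ z in 𝓝[≠] s, z ≠ 1 := by
    rcases eq_or_ne s 1 with rfl | hs
    · exact self_mem_nhdsWithin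
    · exact nhdsWithin_le_nhds (compl_singleton_mem_nhds hs)
  filter_upwards [this] with z hz
  exact (riemannZeta_eq_inv_sub_mul hz).symm

lemma meromorphicAt_modeZeta (s : ℂ) : MeromorphicAt modeZeta s := by
  have a : ∀ f : ℂ → ℂ, Differentiable ℂ f → AnalyticAt ℂ f s := fun f hf => hf.analyticAt s
  have e1 : MeromorphicAt (fun s : ℂ => ((3 / 4 : ℝ) : ℂ) ^ (1 / 2 - s)) s :=
    (a _ fun s => (DifferentiableAt.const_cpow (by fun_prop) (Or.inl (by norm_num)))).meromorphicAt
  have e2 : MeromorphicAt (fun s : ℂ => (Real.pi : ℂ) ^ s) s :=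
    (a _ fun s => (DifferentiableAt.const_cpow (by fun_prop)
      (Or.inl (by exact_mod_cast Real.pi_ne_zero)))).meromorphicAt
  have e3 : MeromorphicAt (fun s : ℂ => Complex.Gamma (s - 1 / 2)) s :=
    (MeromorphicNFOn.Gamma.meromorphicOn (s - 1 / 2) trivial).comp_analyticAt
      (g := fun s : ℂ => s - 1 / 2) (a _ (by fun_prop))
  have e4 : MeromorphicAt (fun s : ℂ => riemannZeta (2 * s - 1)) s :=
    (meromorphicAt_riemannZeta _).comp_analyticAt (g := fun s : ℂ => 2 * s - 1) (a _ (by fun_prop))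
  have e5 : MeromorphicAt (fun s : ℂ => riemannZeta (2 * s)) s :=
    (meromorphicAt_riemannZeta _).comp_analyticAt (g := fun s : ℂ => 2 * s) (a _ (by fun_prop))
  have e6 : MeromorphicAt (fun s : ℂ => (3 : ℂ) ^ (-s)) s :=
    (a _ fun s => (DifferentiableAt.const_cpow (by fun_prop) (Or.inl (by norm_num)))).meromorphicAt
  have e7 : MeromorphicAt (fun s : ℂ => (Complex.Gamma s)⁻¹) s :=
    (a _ Complex.differentiable_one_div_Gamma).meromorphicAt
  have c : ∀ x : ℂ, MeromorphicAt (fun _ : ℂ => x) s := fun x => MeromorphicAt.const x s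
  have h : MeromorphicAt hexZeta s :=
    e7.mul (((((c _).mul e1).mul e3).mul e4).add
      (e2.mul (a _ differentiable_mellin_thetaRest).meromorphicAt))
  exact ((h.div (c 6)).sub (e5.div (c 3))).sub ((e6.mul e5).div (c 2))

/-- Follows from 1/Γ(s) = s/Γ(s + 1), which also holds at 0 because of the convention Γ(0) = 0. -/
lemma hasDerivAt_inv_Gamma_zero : HasDerivAt (fun s : ℂ => (Complex.Gamma s)⁻¹) 1 0 := by
  rw [funext Complex.one_div_Gamma_eq_self_mul_one_div_Gamma_add_one]
  have h : DifferentiableAt ℂ (fun s : ℂ => (Complex.Gamma (s + 1))⁻¹) 0 :=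
    (Complex.differentiable_one_div_Gamma (0 + 1)).comp (0 : ℂ) (f := fun s : ℂ => s + 1)
      (by fun_prop)
  exact ((hasDerivAt_id (0 : ℂ)).mul h.hasDerivAt).congr_deriv (by simp)

lemma Gamma_neg_half : Complex.Gamma (-(1 / 2)) = -2 * (√Real.pi : ℂ) := by
  have h := Complex.Gamma_add_one (-(1 / 2)) (by norm_num)
  rw [show (-(1 / 2) + 1 : ℂ) = 1 / 2 by norm_num, Complex.Gamma_one_half_eq] at h
  have : (Real.pi : ℂ) ^ (1 / 2 : ℂ) = (√Real.pi : ℂ) := by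
    rw [Real.sqrt_eq_rpow, Complex.ofReal_cpow Real.pi_pos.le]; norm_num
  rw [this] at h
  linear_combination 2 * h

lemma riemannZeta_neg_one : riemannZeta (-1) = -1 / 12 := by
  have h := riemannZeta_neg_nat_eq_bernoulli 1
  norm_num [bernoulli_two] at h ⊢
  rw [h]

/-- The factor 1/Γ kills the lattice part, and ζ(0) = -1/2 leaves 1/6 + 1/4. -/
lemma modeZeta_zero : modeZeta 0 = 5 / 12 := by
  simp [modeZeta, hexZeta, riemannZeta_zero]
  norm_num

/-- As 1/Γ has value 0 and derivative 1 at 0, `hexZeta` contributes a sixth of its cofactor at 0.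
There Γ(-1/2) = -2√π and ζ(-1) = -1/12 give π√3/12, and the Mellin transform gives the integral. The
logarithms come from ζ'(0) = -log(2π)/2 and from differentiating 3^(-s). -/
lemma hasDerivAt_modeZeta_zero :
    HasDerivAt modeZeta (((Real.pi * √3 / 72 +
      (∫ t in Ioi (0 : ℝ), 1 / (t * √t) * thetaTail t) / 6 +
      5 / 6 * Real.log (2 * Real.pi) - 1 / 4 * Real.log 3 : ℝ)) : ℂ) 0 := by
  have hd := (differentiableAt_hexZeta (s := 0) (fun m => by
    intro h
    have := congrArg Complex.re h
    norm_num at this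
    have h2 : ((2 * m : ℕ) : ℝ) = ((1 : ℕ) : ℝ) := by push_cast; linarith
    have := Nat.cast_injective h2
    lia) (by norm_num)).hasDerivAt
  have h1 := hasDerivAt_inv_Gamma_zero.mul hd
  have h2 : HasDerivAt (fun s : ℂ => riemannZeta (2 * s)) (2 * deriv riemannZeta 0) 0 := by
    have h3 : HasDerivAt riemannZeta (deriv riemannZeta 0) (2 * 0) := by
      rw [mul_zero]; exact (differentiableAt_riemannZeta (by norm_num)).hasDerivAt
    exact (h3.comp (0 : ℂ) ((hasDerivAt_id (0 : ℂ)).const_mul 2)).congr_deriv (by ring)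
  have h4 : HasDerivAt (fun s : ℂ => (3 : ℂ) ^ (-s)) (-Complex.log 3) 0 := by
    have := (hasDerivAt_neg (0 : ℂ)).const_cpow (c := 3) (Or.inl (by norm_num))
    exact this.congr_deriv (by simp)
  have h5 := ((h1.div_const 6).sub (h2.div_const 3)).sub ((h4.mul h2).div_const 2)
  refine h5.congr_deriv ?_
  have hlog3 : Complex.log 3 = (Real.log 3 : ℝ) := by
    rw [Complex.ofReal_log (by norm_num)]; norm_num
  have hlog : Complex.log (2 * Real.pi) = (Real.log (2 * Real.pi) : ℝ) := by
    rw [Complex.ofReal_log (by positivity)]; push_cast; rfl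
  have h34 : ((3 / 4 : ℝ) : ℂ) ^ (1 / 2 - 0 : ℂ) = ((√3 / 2 : ℝ) : ℂ) := by
    have : √3 / 2 = √(3 / 4) := by
      rw [Real.sqrt_div (by norm_num), show (4 : ℝ) = 2 ^ 2 by norm_num,
        Real.sqrt_sq (by norm_num)]
    rw [this, Real.sqrt_eq_rpow, Complex.ofReal_cpow (by norm_num)]
    norm_num
  have hsq : (√Real.pi : ℂ) * √Real.pi = Real.pi := by
    rw [← Complex.ofReal_mul, Real.mul_self_sqrt Real.pi_pos.le]
  rw [deriv_riemannZeta_zero, hlog3, hlog, h34, mellin_thetaRest_zero]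
  simp only [mul_zero, zero_sub, riemannZeta_neg_one, Gamma_neg_half, neg_zero, Complex.cpow_zero,
    Complex.Gamma_zero, inv_zero, zero_mul, riemannZeta_zero]
  push_cast
  linear_combination (√3 / 72 : ℂ) * hsq

end

/-! ### The nome, the divisor series and the eta function -/

section

/-- The nome of the hexagonal lattice. -/
def hexNome : ℝ := -Real.exp (-(Real.pi * √3))

lemma abs_hexNome_lt_one : |hexNome| < 1 := by
  rw [hexNome, abs_neg, Real.abs_exp, Real.exp_lt_one_iff]
  have := Real.pi_pos
  simpa using by positivity

lemma hexNome_pow (n : ℕ) : hexNome ^ n = (-1) ^ n * Real.exp (-(Real.pi * √3 * n)) := by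
  rw [hexNome, neg_pow, ← Real.exp_nat_mul]
  congr 2; ring

/-- The value at `0` of the Mellin transform of `thetaRest`. -/
def thetaConst : ℝ := ∫ t in Ioi (0 : ℝ), 1 / (t * √t) * thetaTail t

lemma hasSum_thetaConst :
    HasSum (fun i : ℕ+ × ℕ+ => 2 * hexNome ^ ((i.1 : ℕ) * i.2) / (i.2 : ℝ)) thetaConst := by
  refine hasSum_mellin_thetaRest_zero.congr_fun fun i => ?_
  rw [hexNome_pow]
  push_cast
  rw [mul_assoc (Real.pi * √3)]
  ring

/-- Collect the double series by n = mk: since 1/k = m/n, the terms over a fixed n add up to qⁿ/n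
times the sum of the divisors m. -/
lemma hasSum_divisor_series :
    HasSum (fun n : ℕ+ => (-1 : ℝ) ^ (n : ℕ) / ((n : ℝ) * Real.exp (Real.pi * n * √3))
      * ∑ d ∈ (n : ℕ).divisors, (d : ℝ)) (thetaConst / 2) := by
  have h := (sigmaAntidiagonalEquivProd.hasSum_iff.2 (hasSum_thetaConst.div_const 2)).sigma
    (fun n => hasSum_fintype _)
  refine h.congr_fun fun n => ?_
  have hn : (n : ℝ) ≠ 0 := by exact_mod_cast n.ne_zero
  have e : ∀ x : Nat.divisorsAntidiagonal n,
      ((fun i : ℕ+ × ℕ+ => 2 * hexNome ^ ((i.1 : ℕ) * i.2) / (i.2 : ℝ) / 2) ∘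
        sigmaAntidiagonalEquivProd) ⟨n, x⟩ = hexNome ^ (n : ℕ) / n * (x.1.1 : ℝ) := by
    rintro ⟨⟨a, b⟩, hx⟩
    have hab := (Nat.mem_divisorsAntidiagonal.1 hx).1
    have hb : b ≠ 0 := by rintro rfl; exact n.ne_zero (by simpa using hab.symm)
    have ha : a ≠ 0 := by rintro rfl; exact n.ne_zero (by simpa using hab.symm)
    simp only [Function.comp_apply, sigmaAntidiagonalEquivProd, divisorsAntidiagonalFactors,
      Equiv.coe_fn_mk, PNat.mk_coe]
    simp only at hab
    rw [hab]
    have : (n : ℝ) = a * b := by exact_mod_cast hab.symm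
    rw [this]
    have hb' : (b : ℝ) ≠ 0 := by exact_mod_cast hb
    have ha' : (a : ℝ) ≠ 0 := by exact_mod_cast ha
    field_simp
  simp only [e]
  rw [← Finset.mul_sum, Finset.sum_coe_sort (n : ℕ).divisorsAntidiagonal (fun x => (x.1 : ℝ)),
    Nat.sum_divisorsAntidiagonal (fun x _ => (x : ℝ)), hexNome_pow]
  congr 1
  rw [show Real.pi * √3 * n = Real.pi * n * √3 by ring, Real.exp_neg]
  field_simp

/-- The same double series summed over the dual index first: ∑ q^(mk)/k is the logarithm series for
1 - q^m. -/
lemma hasSum_log_one_sub_hexNome_pow :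
    HasSum (fun n : ℕ => Real.log (1 - hexNome ^ (n + 1))) (-(thetaConst / 2)) := by
  have h := (hasSum_thetaConst.div_const 2).prod_fiberwise
    (g := fun m : ℕ+ => -Real.log (1 - hexNome ^ (m : ℕ))) fun m => ?_
  · have h2 := (Equiv.pnatEquivNat.symm.hasSum_iff.2 h.neg)
    refine h2.congr_fun fun n => ?_
    simp
  · have hr : |hexNome ^ (m : ℕ)| < 1 := by
      rw [abs_pow]; exact pow_lt_one₀ (abs_nonneg _) abs_hexNome_lt_one m.ne_zero
    have h3 := Equiv.pnatEquivNat.hasSum_iff.2 (Real.hasSum_pow_div_log_of_abs_lt_one hr)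
    refine h3.congr_fun fun k => ?_
    have hk : ((k : ℕ) : ℝ) = k.natPred + 1 := by exact_mod_cast k.natPred_add_one.symm
    simp only [Function.comp_apply, Equiv.pnatEquivNat_apply]
    rw [← pow_mul, k.natPred_add_one, ← hk]
    ring

/-- The real part -3/2 of the argument makes exp(2πiz) equal to the negative nome, so the product is
real and positive; the prefactor has modulus exp(-π√3/24). -/
lemma log_norm_eta :
    Real.log ‖ModularForm.eta ((-3 + Complex.I * (√3 : ℝ)) / 2)‖
      = -(Real.pi * √3 / 24) - thetaConst / 2 := by
  set z : ℂ := (-3 + Complex.I * (√3 : ℝ)) / 2 with hz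
  have him : z.im = √3 / 2 := by simp [hz]
  have hq : ∀ n : ℕ, 1 - ModularForm.eta_q n z = ((1 - hexNome ^ (n + 1) : ℝ) : ℂ) := fun n => by
    have : Complex.exp (2 * Real.pi * Complex.I * z) = (hexNome : ℂ) := by
      have e : 2 * Real.pi * Complex.I * z =
          ((-(Real.pi * √3) : ℝ) : ℂ) + (Real.pi * Complex.I + (-2 : ℤ) * (2 * Real.pi * Complex.I)) := by
        rw [hz]; push_cast; linear_combination (Real.pi * √3 : ℂ) * Complex.I_mul_I
      rw [e, Complex.exp_add, Complex.exp_add, Complex.exp_int_mul_two_pi_mul_I,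
        Complex.exp_pi_mul_I, hexNome]
      push_cast; ring
    rw [ModularForm.eta_q_eq_pow, this]
    push_cast; rfl
  have hpos : ∀ n : ℕ, 0 < 1 - hexNome ^ (n + 1) := fun n => by
    have hr : |hexNome ^ (n + 1)| < 1 := by
      rw [abs_pow]; exact pow_lt_one₀ (abs_nonneg _) abs_hexNome_lt_one (by lia)
    linarith [le_abs_self (hexNome ^ (n + 1))]
  have hp := Real.hasProd_of_hasSum_log hpos hasSum_log_one_sub_hexNome_pow
  have hpc := hp.map Complex.ofRealHom Complex.continuous_ofReal
  have ht : ∏' n, (1 - ModularForm.eta_q n z) = ((Real.exp (-(thetaConst / 2)) : ℝ) : ℂ) := by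
    simp only [hq]
    exact hpc.tprod_eq
  rw [ModularForm.eta, ht, norm_mul, Function.Periodic.norm_qParam, him, Complex.norm_real,
    Real.norm_of_nonneg (Real.exp_pos _).le, ← Real.exp_add, Real.log_exp]
  ring

end

section

variable {Ω : Set Plane}

/-! ### Weak derivatives of smooth functions -/

lemma fderiv_contDiff_infty {f : Plane → ℝ} (hf : ContDiff ℝ ∞ f) (v : Plane) :
    ContDiff ℝ ∞ fun x => fderiv ℝ f x v :=
  (hf.fderiv_right (m := ∞) (by simp)).clm_apply contDiff_const

lemma testFunction_fderiv {φ : Plane → ℝ} (hφ : IsTestFunction Ω φ) (v : Plane) :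
    IsTestFunction Ω fun x => fderiv ℝ φ x v :=
  ⟨fderiv_contDiff_infty hφ.smooth v, hφ.compact.fderiv_apply ℝ v,
    (tsupport_fderiv_apply_subset ℝ v).trans hφ.supp⟩

lemma setIntegral_mul_testFunction {φ : Plane → ℝ} (hφ : IsTestFunction Ω φ) (f : Plane → ℝ) :
    ∫ x in Ω, f x * φ x = ∫ x, f x * φ x := by
  refine setIntegral_eq_integral_of_forall_compl_eq_zero fun x hx => ?_
  rw [image_eq_zero_of_notMem_tsupport fun h => hx (hφ.supp h), mul_zero]

lemma integrable_mul_testFunction {φ f : Plane → ℝ} (hφ : IsTestFunction Ω φ)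
    (hf : Continuous f) : Integrable fun x => f x * φ x :=
  (hf.mul hφ.smooth.continuous).integrable_of_hasCompactSupport hφ.compact.mul_left

lemma integral_mul_fderiv_testFunction {f φ : Plane → ℝ} (hf : ContDiff ℝ ∞ f)
    (hφ : IsTestFunction Ω φ) (v : Plane) :
    ∫ x in Ω, f x * fderiv ℝ φ x v = -∫ x in Ω, fderiv ℝ f x v * φ x := by
  rw [setIntegral_mul_testFunction (testFunction_fderiv hφ v), setIntegral_mul_testFunction hφ]
  exact integral_mul_fderiv_eq_neg_fderiv_mul_of_integrable
    (integrable_mul_testFunction hφ (fderiv_contDiff_infty hf v).continuous)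
    (integrable_mul_testFunction (testFunction_fderiv hφ v) hf.continuous)
    (integrable_mul_testFunction hφ hf.continuous)
    (fun x _ => hf.differentiable (by simp) x) (fun x _ => hφ.smooth.differentiable (by simp) x)

lemma inner_gradient (f : Plane → ℝ) (x v : Plane) : inner ℝ (∇ f x) v = fderiv ℝ f x v := by
  simp [gradient]

lemma hasWeakGradient_of_contDiff {f : Plane → ℝ} (hf : ContDiff ℝ ∞ f) :
    HasWeakGradient Ω f (∇ f) := fun φ hφ v => by
  simp only [inner_gradient]
  exact integral_mul_fderiv_testFunction hf hφ v

lemma continuous_gradient {f : Plane → ℝ} (hf : ContDiff ℝ ∞ f) : Continuous (∇ f) :=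
  (InnerProductSpace.toDual ℝ Plane).symm.continuous.comp (hf.continuous_fderiv (by simp))

lemma memL2_of_continuous {F : Type} [NormedAddCommGroup F] [SecondCountableTopology F]
    (hΩ : Bornology.IsBounded Ω) {f : Plane → F} (hf : Continuous f) : MemL2 Ω f := by
  obtain ⟨C, hC⟩ := hΩ.isCompact_closure.exists_bound_of_continuousOn hf.continuousOn
  have : IsFiniteMeasure (volume.restrict (closure Ω)) :=
    ⟨by simpa using hΩ.isCompact_closure.measure_lt_top⟩
  have h : MemLp f 2 (volume.restrict (closure Ω)) :=
    MemLp.of_bound hf.aestronglyMeasurable C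
      ((ae_restrict_iff' isClosed_closure.measurableSet).2 (Eventually.of_forall hC))
  exact h.mono_measure (Measure.restrict_mono subset_closure le_rfl)

lemma memH2_of_contDiff (hΩ : Bornology.IsBounded Ω) {f : Plane → ℝ} (hf : ContDiff ℝ ∞ f) :
    MemH2 Ω f := by
  refine ⟨memL2_of_continuous hΩ hf.continuous, ∇ f, memL2_of_continuous hΩ
    (continuous_gradient hf), hasWeakGradient_of_contDiff hf, fun v => ?_⟩
  simp only [inner_gradient]
  exact ⟨_, memL2_of_continuous hΩ (continuous_gradient (fderiv_contDiff_infty hf v)),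
    hasWeakGradient_of_contDiff (fderiv_contDiff_infty hf v)⟩

/-! ### The Laplacian of a test function -/

lemma laplacian_eq_sum_fderiv {f : Plane → ℝ} (hf : ContDiff ℝ ∞ f) (x : Plane) :
    (Δ f) x = ∑ i, fderiv ℝ (fun y => fderiv ℝ f y (EuclideanSpace.basisFun (Fin 2) ℝ i)) x
      (EuclideanSpace.basisFun (Fin 2) ℝ i) := by
  rw [InnerProductSpace.laplacian_eq_iteratedFDeriv_orthonormalBasis f
    (EuclideanSpace.basisFun (Fin 2) ℝ)]
  refine Finset.sum_congr rfl fun i _ => ?_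
  have hd : DifferentiableAt ℝ (fderiv ℝ f) x :=
    (hf.fderiv_right (m := ∞) (by simp)).differentiable (by simp) x
  rw [iteratedFDeriv_two_apply, fderiv_clm_apply hd (differentiableAt_const _)]
  simp

/-- Green's formula with one derivative on `u`: the weak gradient is tested against the partial
derivatives of φ, which are again test functions. -/
lemma integral_mul_laplacian {u : Plane → ℝ} {G : Plane → Plane} (hu : MemL2 Ω u)
    (hG : MemL2 Ω G) (h : HasWeakGradient Ω u G) {φ : Plane → ℝ} (hφ : IsTestFunction Ω φ) :
    ∫ x in Ω, u x * (Δ φ) x = -∫ x in Ω, inner ℝ (G x) (∇ φ x) := by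
  have h1 : ∀ x, u x * (Δ φ) x = ∑ i, u x *
      fderiv ℝ (fun y => fderiv ℝ φ y (EuclideanSpace.basisFun (Fin 2) ℝ i)) x
      (EuclideanSpace.basisFun (Fin 2) ℝ i) := fun x => by
    rw [laplacian_eq_sum_fderiv hφ.smooth, Finset.mul_sum]
  have h2 : ∀ x, inner ℝ (G x) (∇ φ x) = ∑ i,
      inner ℝ (G x) (EuclideanSpace.basisFun (Fin 2) ℝ i) *
        fderiv ℝ φ x (EuclideanSpace.basisFun (Fin 2) ℝ i) := fun x => by
    rw [← (EuclideanSpace.basisFun (Fin 2) ℝ).sum_inner_mul_inner (G x) (∇ φ x)]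
    refine Finset.sum_congr rfl fun i _ => ?_
    rw [← inner_gradient, real_inner_comm (∇ φ x)]
  simp only [h1, h2]
  rw [integral_finsetSum _ fun i _ => hu.integrable_mul'
      ((testFunction_fderiv hφ _).fderiv_memLp _),
    integral_finsetSum _ fun i _ => (hG.inner_const _).integrable_mul' (hφ.fderiv_memLp _),
    ← Finset.sum_neg_distrib]
  exact Finset.sum_congr rfl fun i _ => h _ (testFunction_fderiv hφ _) _

lemma hasWeakLaplacian_of_contDiff (hΩ : Bornology.IsBounded Ω) {f : Plane → ℝ}
    (hf : ContDiff ℝ ∞ f) : HasWeakLaplacian Ω f (Δ f) := fun φ hφ => by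
  have h1 : ∀ x, f x * (Δ φ) x = ∑ i, f x *
      fderiv ℝ (fun y => fderiv ℝ φ y (EuclideanSpace.basisFun (Fin 2) ℝ i)) x
      (EuclideanSpace.basisFun (Fin 2) ℝ i) := fun x => by
    rw [laplacian_eq_sum_fderiv hφ.smooth, Finset.mul_sum]
  have h2 : ∀ x, (Δ f) x * φ x = ∑ i,
      fderiv ℝ (fun y => fderiv ℝ f y (EuclideanSpace.basisFun (Fin 2) ℝ i)) x
      (EuclideanSpace.basisFun (Fin 2) ℝ i) * φ x := fun x => by
    rw [laplacian_eq_sum_fderiv hf, Finset.sum_mul]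
  have hm : ∀ g : Plane → ℝ, ContDiff ℝ ∞ g → MemL2 Ω g := fun g hg =>
    memL2_of_continuous hΩ hg.continuous
  simp only [h1, h2]
  rw [integral_finsetSum _ fun i _ => (hm f hf).integrable_mul'
      ((testFunction_fderiv hφ _).fderiv_memLp _),
    integral_finsetSum _ fun i _ => (hm _ (fderiv_contDiff_infty
      (fderiv_contDiff_infty hf _) _)).integrable_mul' hφ.memLp]
  refine Finset.sum_congr rfl fun i _ => ?_
  rw [integral_mul_fderiv_testFunction hf (testFunction_fderiv hφ _),
    integral_mul_fderiv_testFunction (fderiv_contDiff_infty hf _) hφ, neg_neg]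

/-! ### Orthogonality of solutions -/

lemma tendsto_integral_inner {F : Type} [NormedAddCommGroup F] [InnerProductSpace ℝ F]
    {a b : Plane → F} {c : ℕ → Plane → F} (ha : MemL2 Ω a) (hb : MemL2 Ω b)
    (hc : ∀ n, MemL2 Ω (c n))
    (h : Tendsto (fun n => eLpNorm (c n - b) 2 (volume.restrict Ω)) atTop (𝓝 0)) :
    Tendsto (fun n => ∫ x in Ω, inner ℝ (a x) (c n x)) atTop
      (𝓝 (∫ x in Ω, inner ℝ (a x) (b x))) := by
  have h1 := (Lp.tendsto_Lp_iff_tendsto_eLpNorm'' c hc b hb).2 h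
  have h2 : ∀ (g : Plane → F) (hg : MemL2 Ω g),
      inner ℝ (MemLp.toLp a ha) (MemLp.toLp g hg) = ∫ x in Ω, inner ℝ (a x) (g x) := fun g hg => by
    rw [L2.inner_def]
    refine integral_congr_ae ?_
    filter_upwards [MemLp.coeFn_toLp ha, MemLp.coeFn_toLp hg] with x hx hy
    rw [hx, hy]
  have h3 := (tendsto_const_nhds (x := MemLp.toLp a ha)).inner (𝕜 := ℝ) h1
  simpa only [h2] using h3

lemma memL2_gradient {φ : Plane → ℝ} (hφ : IsTestFunction Ω φ) : MemL2 Ω (∇ φ) := by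
  refine Continuous.memLp_of_hasCompactSupport (μ := volume) (continuous_gradient hφ.smooth) ?_
    |>.restrict Ω
  exact (hφ.compact.fderiv ℝ).comp_left (g := (InnerProductSpace.toDual ℝ Plane).symm)
    (map_zero _)

/-- The equation is only known against test functions; L² convergence of functions and gradients
carries it to the H¹₀ limit `f`. This is the variational form of the eigenvalue problem. -/
lemma SolvesHelmholtz.integral_inner_gradient {lam : ℝ} {u : Plane → ℝ} {G : Plane → Plane}
    (h : SolvesHelmholtz Ω lam u) (hG : MemL2 Ω G) (hw : HasWeakGradient Ω u G)
    {f : Plane → ℝ} {F : Plane → Plane} (hf : MemL2 Ω f) (hF : MemL2 Ω F) {φ : ℕ → Plane → ℝ}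
    (hφ : ∀ n, IsTestFunction Ω (φ n))
    (h1 : Tendsto (fun n => eLpNorm (φ n - f) 2 (volume.restrict Ω)) atTop (𝓝 0))
    (h2 : Tendsto (fun n => eLpNorm (∇ (φ n) - F) 2 (volume.restrict Ω)) atTop (𝓝 0)) :
    ∫ x in Ω, inner ℝ (G x) (F x) = lam * ∫ x in Ω, inner ℝ (u x) (f x) := by
  have t1 := (tendsto_integral_inner h.memH2.1 hf (fun n => (hφ n).memLp) h1).const_mul lam
  have t2 := tendsto_integral_inner hG hF (fun n => memL2_gradient (hφ n)) h2
  refine tendsto_nhds_unique t2 (t1.congr fun n => ?_)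
  have e1 := integral_mul_laplacian h.memH2.1 hG hw (hφ n)
  rw [h.eqn (φ n) (hφ n)] at e1
  rw [eq_comm, ← neg_inj, ← e1, ← integral_const_mul, ← integral_neg]
  refine integral_congr_ae (Eventually.of_forall fun x => ?_)
  simp only [RCLike.inner_apply, conj_trivial]
  ring

/-- Solutions for different spectral parameters are orthogonal. -/
lemma SolvesHelmholtz.integral_mul_eq_zero {lam mu : ℝ} {u f : Plane → ℝ}
    (hu : SolvesHelmholtz Ω lam u) (hf : SolvesHelmholtz Ω mu f) (hne : lam ≠ mu) :
    ∫ x in Ω, u x * f x = 0 := by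
  obtain ⟨-, G, hG, hw, φ, hφ, p1, p2⟩ := hu.memH10
  obtain ⟨-, F, hF, hv, ψ, hψ, q1, q2⟩ := hf.memH10
  -- Each solution is tested against the approximating sequence of the other; symmetry of both
  -- bilinear forms then leaves (λ - μ) ∫ u f = 0.
  have e1 := SolvesHelmholtz.integral_inner_gradient hu hG hw hf.memH2.1 hF hψ q1 q2
  have e2 := SolvesHelmholtz.integral_inner_gradient hf hF hv hu.memH2.1 hG hφ p1 p2
  have e3 : ∫ x in Ω, inner ℝ (F x) (G x) = ∫ x in Ω, inner ℝ (G x) (F x) :=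
    integral_congr_ae (Eventually.of_forall fun x => real_inner_comm _ _)
  have e4 : ∫ x in Ω, inner ℝ (f x) (u x) = ∫ x in Ω, inner ℝ (u x) (f x) :=
    integral_congr_ae (Eventually.of_forall fun x => real_inner_comm _ _)
  rw [e3, e4, e1, ← sub_eq_zero, ← sub_mul] at e2
  have e5 := (mul_eq_zero.1 e2).resolve_left (sub_ne_zero.2 hne)
  rw [← e5]
  refine integral_congr_ae (Eventually.of_forall fun x => ?_)
  simp only [RCLike.inner_apply, conj_trivial]
  ring

end

section

/-! ### Zero sets of analytic functions -/

lemma ae_ne_zero_of_analytic_real {f : ℝ → ℝ} (hf : AnalyticOnNhd ℝ f univ) {x₀ : ℝ}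
    (h : f x₀ ≠ 0) : ∀ᵐ x, f x ≠ 0 := by
  have h1 := hf.preimage_zero_mem_codiscreteWithin (x := x₀) h (mem_univ _) isConnected_univ
  have h2 := ae_restrict_le_codiscreteWithin (μ := volume) MeasurableSet.univ h1
  rw [Measure.restrict_univ] at h2
  exact h2

/-- Fubini and the one-variable case used twice: on the horizontal line through `x₀` almost every
point is a nonzero, and every vertical line through such a point meets the zero set in a null set.
-/
lemma ae_ne_zero_of_analytic {f : Plane → ℝ} (hf : AnalyticOnNhd ℝ f univ) {x₀ : Plane}
    (h : f x₀ ≠ 0) : ∀ᵐ x, f x ≠ 0 := by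
  let L : ℝ × ℝ → Plane := fun p => !₂[p.1, p.2]
  have hL0 : ∀ x : Plane, L (x 0, x 1) = x := fun x => by
    ext i; fin_cases i <;> simp [L]
  have hcont : Continuous f := continuousOn_univ.1 hf.continuousOn
  have hmp : MeasurePreserving
      (fun x : Plane => (x 0, x 1)) volume (volume : Measure (ℝ × ℝ)) :=
    (volume_preserving_finTwoArrow ℝ).comp
      (EuclideanSpace.volume_preserving_symm_measurableEquiv_toLp (Fin 2))
  have hLc : Continuous L := by fun_prop
  have hs1 : ∀ a, AnalyticOnNhd ℝ (fun b => f (L (a, b))) univ := fun a b _ => by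
    have hb : AnalyticAt ℝ (fun b => L (a, b)) b := by
      have : (fun b => L (a, b)) = fun b => a • EuclideanSpace.single (0 : Fin 2) (1 : ℝ)
          + b • EuclideanSpace.single (1 : Fin 2) (1 : ℝ) := by
        funext b; ext i; fin_cases i <;> simp [L]
      rw [this]
      exact analyticAt_const.add (analyticAt_id.smul analyticAt_const)
    exact (hf _ (mem_univ _)).comp (g := f) (f := fun b => L (a, b)) hb
  have hs2 : ∀ b, AnalyticOnNhd ℝ (fun a => f (L (a, b))) univ := fun b a _ => by
    have hb : AnalyticAt ℝ (fun a => L (a, b)) a := by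
      have : (fun a => L (a, b)) = fun a => a • EuclideanSpace.single (0 : Fin 2) (1 : ℝ)
          + b • EuclideanSpace.single (1 : Fin 2) (1 : ℝ) := by
        funext b; ext i; fin_cases i <;> simp [L]
      rw [this]
      exact (analyticAt_id.smul analyticAt_const).add analyticAt_const
    exact (hf _ (mem_univ _)).comp (g := f) (f := fun a => L (a, b)) hb
  have hmeas : MeasurableSet {p : ℝ × ℝ | f (L p) = 0} :=
    (isClosed_eq (hcont.comp hLc) continuous_const).measurableSet
  have hnull : volume {p : ℝ × ℝ | f (L p) = 0} = 0 := by
    rw [Measure.volume_eq_prod, Measure.measure_prod_null hmeas]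
    have h1 : ∀ᵐ a, f (L (a, x₀ 1)) ≠ 0 :=
      ae_ne_zero_of_analytic_real (hs2 (x₀ 1)) (x₀ := x₀ 0) (by rw [hL0]; exact h)
    filter_upwards [h1] with a ha
    have := ae_ne_zero_of_analytic_real (hs1 a) ha
    simpa [ae_iff] using this
  have h2 := hmp.measure_preimage hmeas.nullMeasurableSet
  rw [hnull] at h2
  rw [ae_iff]
  convert h2 using 2
  ext x
  simp [hL0]

/-! ### Smooth functions vanishing on the boundary -/

lemma tendsto_eLpNorm_two_of_bounded {α F : Type} [MeasurableSpace α] [NormedAddCommGroup F]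
    {μ : Measure α} [IsFiniteMeasure μ] {g : ℕ → α → F} (C : ℝ)
    (hm : ∀ n, AEStronglyMeasurable (g n) μ) (hb : ∀ n, ∀ᵐ x ∂μ, ‖g n x‖ ≤ C)
    (hlim : ∀ᵐ x ∂μ, Tendsto (fun n => g n x) atTop (𝓝 0)) :
    Tendsto (fun n => eLpNorm (g n) 2 μ) atTop (𝓝 0) := by
  have h1 : Tendsto (fun n => ∫⁻ x, ‖g n x‖ₑ ^ (2 : ℝ) ∂μ) atTop (𝓝 (∫⁻ _, 0 ∂μ)) := by
    refine tendsto_lintegral_of_dominated_convergence' (fun _ => (ENNReal.ofReal C) ^ (2 : ℝ))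
      (fun n => (hm n).enorm.pow_const _) (fun n => ?_) ?_ ?_
    · filter_upwards [hb n] with x hx
      gcongr
      rw [← ofReal_norm]
      exact ENNReal.ofReal_le_ofReal hx
    · simp only [lintegral_const]
      exact ENNReal.mul_ne_top (by simp) (measure_ne_top _ _)
    · filter_upwards [hlim] with x hx
      have h2 := (hx.enorm).ennrpow_const (2 : ℝ)
      simpa using h2
  have h3 := h1.ennrpow_const (1 / 2 : ℝ)
  simp only [lintegral_zero] at h3
  rw [ENNReal.zero_rpow_of_pos (by norm_num)] at h3
  refine h3.congr fun n => ?_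
  rw [eLpNorm_eq_lintegral_rpow_enorm_toReal (by norm_num) (by norm_num)]
  simp

/-- A smooth function that vanishes on `[-1, 1]` and equals the identity far out. -/
def softCut (r : ℝ) : ℝ := r * Real.smoothTransition (r ^ 2 - 1)

lemma contDiff_softCut : ContDiff ℝ ∞ softCut :=
  contDiff_id.mul (Real.smoothTransition.contDiff.comp ((contDiff_id.pow 2).sub contDiff_const))

lemma softCut_eq_zero {r : ℝ} (h : |r| ≤ 1) : softCut r = 0 := by
  rw [softCut, Real.smoothTransition.zero_of_nonpos, mul_zero]
  have := sq_abs r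
  nlinarith [abs_nonneg r]

lemma softCut_eq_self {r : ℝ} (h : 2 ≤ |r|) : softCut r = r := by
  rw [softCut, Real.smoothTransition.one_of_one_le, mul_one]
  have := sq_abs r
  nlinarith [abs_nonneg r]

lemma abs_softCut_le (r : ℝ) : |softCut r| ≤ |r| := by
  rw [softCut, abs_mul, abs_of_nonneg (Real.smoothTransition.nonneg _)]
  exact mul_le_of_le_one_right (abs_nonneg _) (Real.smoothTransition.le_one _)

lemma deriv_softCut_eq_one {r : ℝ} (h : 2 < |r|) : deriv softCut r = 1 := by
  have : softCut =ᶠ[𝓝 r] id := by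
    filter_upwards [(isOpen_lt continuous_const continuous_abs).mem_nhds h] with x hx
    exact softCut_eq_self (le_of_lt hx)
  rw [this.deriv_eq, deriv_id]

lemma exists_abs_deriv_softCut_le : ∃ C, 1 ≤ C ∧ ∀ r, |deriv softCut r| ≤ C := by
  have hc : Continuous (deriv softCut) := contDiff_softCut.continuous_deriv (by simp)
  obtain ⟨C, hC⟩ := (isCompact_Icc (a := (-2 : ℝ)) (b := 2)).exists_bound_of_continuousOn
    hc.continuousOn
  refine ⟨max C 1, le_max_right _ _, fun r => ?_⟩
  rcases le_or_gt |r| 2 with h | h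
  · exact (hC r (abs_le.1 h)).trans (le_max_left _ _)
  · rw [deriv_softCut_eq_one h]; simp

/-- Truncation of `f` near its zero set. -/
def truncation (Ω : Set Plane) (f : Plane → ℝ) (N : ℝ) : Plane → ℝ :=
  Ω.indicator fun x => N⁻¹ * softCut (N * f x)

variable {Ω : Set Plane}

/-- The support lies where |N f| ≥ 1 in the closure of Ω, a compact set that misses the boundary
because `f` vanishes there. -/
lemma isTestFunction_truncation (hΩ : IsOpen Ω) (hb : Bornology.IsBounded Ω) {f : Plane → ℝ}
    (hf : ContDiff ℝ ∞ f) (h0 : ∀ x ∈ closure Ω, x ∉ Ω → f x = 0) {N : ℝ} :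
    IsTestFunction Ω (truncation Ω f N) := by
  set K := closure Ω ∩ {x | 1 ≤ |N * f x|} with hK
  have hKc : IsCompact K := hb.isCompact_closure.inter_right
    (isClosed_le continuous_const (by have := hf.continuous; fun_prop))
  have hKs : K ⊆ Ω := fun x hx => by
    by_contra h
    have := hx.2
    simp only [mem_ofPred_eq, h0 x hx.1 h, mul_zero, abs_zero] at this
    linarith
  have hsupp : Function.support (truncation Ω f N) ⊆ K := fun x hx => by
    rw [Function.mem_support, truncation] at hx
    have hxΩ : x ∈ Ω := by by_contra h; simp [h] at hx
    refine ⟨subset_closure hxΩ, ?_⟩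
    by_contra h
    simp only [mem_ofPred_eq, not_le] at h
    simp [hxΩ, softCut_eq_zero h.le] at hx
  have hts : tsupport (truncation Ω f N) ⊆ K := closure_minimal hsupp hKc.isClosed
  refine ⟨contDiff_iff_contDiffAt.2 fun x => ?_,
    HasCompactSupport.of_support_subset_isCompact hKc hsupp, hts.trans hKs⟩
  by_cases hx : x ∈ tsupport (truncation Ω f N)
  swap
  · exact contDiffAt_const.congr_of_eventuallyEq (notMem_tsupport_iff_eventuallyEq.1 hx)
  have hxΩ := hKs (hts hx)
  have h1 : ContDiff ℝ ∞ fun x => N⁻¹ * softCut (N * f x) :=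
    contDiff_const.mul (contDiff_softCut.comp (contDiff_const.mul hf))
  refine h1.contDiffAt.congr_of_eventuallyEq ?_
  filter_upwards [hΩ.mem_nhds hxΩ] with y hy
  simp [truncation, hy]

lemma gradient_truncation (hΩ : IsOpen Ω) {f : Plane → ℝ} (hf : ContDiff ℝ ∞ f) {N : ℝ}
    (hN : N ≠ 0) {x : Plane} (hx : x ∈ Ω) :
    ∇ (truncation Ω f N) x = deriv softCut (N * f x) • ∇ f x := by
  have h1 : truncation Ω f N =ᶠ[𝓝 x] fun x => N⁻¹ * softCut (N * f x) := by
    filter_upwards [hΩ.mem_nhds hx] with y hy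
    simp [truncation, hy]
  have h2 : HasFDerivAt f (fderiv ℝ f x) x := (hf.differentiable (by simp) x).hasFDerivAt
  have h3 : HasDerivAt softCut (deriv softCut (N * f x)) (N * f x) :=
    (contDiff_softCut.differentiable (by simp) _).hasDerivAt
  have h4 := (h3.comp_hasFDerivAt x (h2.const_mul N)).const_mul N⁻¹
  rw [gradient, h1.fderiv_eq]
  have h5 := h4.fderiv
  simp only [Function.comp_def] at h5
  rw [h5, gradient, ← map_smul]
  congr 1
  ext v
  simp
  field_simp

/-- A smooth function that vanishes on the boundary of a bounded open set is in `H¹₀`. -/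
lemma memH10_of_contDiff (hΩ : IsOpen Ω) (hb : Bornology.IsBounded Ω) {f : Plane → ℝ}
    (hf : ContDiff ℝ ∞ f) (h0 : ∀ x ∈ closure Ω, x ∉ Ω → f x = 0)
    (hne : ∀ᵐ x, f x ≠ 0) : MemH10 Ω f := by
  have hfin : IsFiniteMeasure (volume.restrict Ω) :=
    ⟨by simpa using hb.measure_lt_top⟩
  have hne' : ∀ᵐ x ∂(volume.restrict Ω), f x ≠ 0 := ae_restrict_of_ae hne
  have hin : ∀ᵐ x ∂(volume.restrict Ω), x ∈ Ω := ae_restrict_mem hΩ.measurableSet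
  have hgc := continuous_gradient hf
  obtain ⟨C₁, hC₁⟩ := hb.isCompact_closure.exists_bound_of_continuousOn hf.continuous.continuousOn
  obtain ⟨C₂, hC₂⟩ := hb.isCompact_closure.exists_bound_of_continuousOn hgc.continuousOn
  obtain ⟨C, hC1, hC⟩ := exists_abs_deriv_softCut_le
  have hN : ∀ n : ℕ, (0 : ℝ) < n + 1 := fun n => by positivity
  -- Where `f` is nonzero, the truncation and its gradient eventually coincide with `f` and its
  -- gradient; with uniform bounds, dominated convergence applies.
  have hbig : ∀ x, f x ≠ 0 → ∀ᶠ n : ℕ in atTop, 2 < |((n : ℝ) + 1) * f x| := fun x hx => by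
    have h1 : Tendsto (fun n : ℕ => ((n : ℝ) + 1) * |f x|) atTop atTop :=
      (tendsto_atTop_add_const_right _ _ tendsto_natCast_atTop_atTop).atTop_mul_const
        (abs_pos.2 hx)
    filter_upwards [h1.eventually_gt_atTop 2] with n hn
    rwa [abs_mul, abs_of_pos (hN n)]
  have htest : ∀ n : ℕ, IsTestFunction Ω (truncation Ω f (n + 1)) := fun n =>
    isTestFunction_truncation hΩ hb hf h0
  refine ⟨memL2_of_continuous hb hf.continuous, ∇ f, memL2_of_continuous hb hgc,
    hasWeakGradient_of_contDiff hf, fun n => truncation Ω f (n + 1), htest, ?_, ?_⟩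
  · refine tendsto_eLpNorm_two_of_bounded (C₁ + C₁)
      (fun n => (htest n).memLp.1.sub hf.continuous.aestronglyMeasurable) (fun n => ?_) ?_
    · filter_upwards [hin] with x hx
      have h1 := hC₁ x (subset_closure hx)
      have h2 : ‖truncation Ω f (n + 1) x‖ ≤ C₁ := by
        refine le_trans ?_ h1
        simp only [truncation, indicator_of_mem hx, norm_mul, norm_inv, Real.norm_eq_abs]
        rw [inv_mul_le_iff₀ (abs_pos.2 (hN n).ne'), ← abs_mul]
        exact abs_softCut_le _
      exact (norm_sub_le _ _).trans (add_le_add h2 h1)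
    · filter_upwards [hin, hne'] with x hx hfx
      refine tendsto_const_nhds.congr' ?_
      filter_upwards [hbig x hfx] with n hn
      have := (hN n).ne'
      simp only [Pi.sub_apply, truncation, indicator_of_mem hx, softCut_eq_self hn.le]
      field_simp
      ring
  · refine tendsto_eLpNorm_two_of_bounded (C * C₂ + C₂)
      (fun n => (memL2_gradient (htest n)).1.sub hgc.aestronglyMeasurable) (fun n => ?_) ?_
    · filter_upwards [hin] with x hx
      have h1 := hC₂ x (subset_closure hx)
      refine (norm_sub_le _ _).trans (add_le_add ?_ h1)
      rw [gradient_truncation hΩ hf (hN n).ne' hx, norm_smul]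
      exact mul_le_mul (hC _) h1 (norm_nonneg _) (by linarith)
    · filter_upwards [hin, hne'] with x hx hfx
      refine tendsto_const_nhds.congr' ?_
      filter_upwards [hbig x hfx] with n hn
      rw [Pi.sub_apply, gradient_truncation hΩ hf (hN n).ne' hx, deriv_softCut_eq_one hn,
        one_smul, sub_self]

end

section

/-! ### The triangle in adapted coordinates -/

/-- Two vectors of squared length `κ` at an angle of 120 degrees. -/
structure IsHexFrame (w₁ w₂ : Plane) (κ : ℝ) : Prop where
  pos : 0 < κ
  inner_one : inner ℝ w₁ w₁ = κ
  inner_two : inner ℝ w₂ w₂ = κ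
  inner_one_two : inner ℝ w₁ w₂ = -κ / 2

/-- The affine functional `x ↦ ⟪w, x - A⟫`. -/
def phase (A w x : Plane) : ℝ := inner ℝ w (x - A)

/-- `Ω` is the alcove `0 < θ₂ < θ₁ < π - θ₂ / 2` in the phases of the frame. -/
structure IsAlcove (A w₁ w₂ : Plane) (Ω : Set Plane) : Prop where
  isOpen : IsOpen Ω
  isBounded : Bornology.IsBounded Ω
  nonempty : Ω.Nonempty
  two_nonneg : ∀ x ∈ closure Ω, 0 ≤ phase A w₂ x
  two_le_one : ∀ x ∈ closure Ω, phase A w₂ x ≤ phase A w₁ x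
  sum_le : ∀ x ∈ closure Ω, 2 * phase A w₁ x + phase A w₂ x ≤ 2 * Real.pi
  boundary : ∀ x ∈ closure Ω, x ∉ Ω → phase A w₂ x = 0 ∨ phase A w₁ x = phase A w₂ x ∨
    2 * phase A w₁ x + phase A w₂ x = 2 * Real.pi

/-- By Lagrange's identity the squared determinant of the pair is the product of the squared
lengths, so Cramer's rule applies. -/
lemma eq_zero_of_orthogonal_pair {f g r : Plane} (hfg : inner ℝ f g = 0)
    (hf : inner ℝ f f ≠ 0) (hg : inner ℝ g g ≠ 0) (e1 : inner ℝ f r = 0) (e2 : inner ℝ g r = 0) :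
    r = 0 := by
  simp only [PiLp.inner_apply, Fin.sum_univ_two, RCLike.inner_apply, conj_trivial] at *
  have hdet : (f 0 * g 1 - f 1 * g 0) ^ 2 =
      (f 0 * f 0 + f 1 * f 1) * (g 0 * g 0 + g 1 * g 1) := by
    linear_combination -(f 0 * g 0 + f 1 * g 1) * hfg
  have hd : f 0 * g 1 - f 1 * g 0 ≠ 0 := fun h => by
    rw [h] at hdet
    exact mul_ne_zero hf hg (by linarith)
  have z0 : r 0 = 0 := by
    have : r 0 * (f 0 * g 1 - f 1 * g 0) = 0 := by linear_combination g 1 * e1 - f 1 * e2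
    exact (mul_eq_zero.1 this).resolve_right hd
  have z1 : r 1 = 0 := by
    have : r 1 * (f 0 * g 1 - f 1 * g 0) = 0 := by linear_combination f 0 * e2 - g 0 * e1
    exact (mul_eq_zero.1 this).resolve_right hd
  ext i
  fin_cases i
  · simpa using z0
  · simpa using z1

lemma eq_combination_of_orthogonal {f g : Plane} (hfg : inner ℝ f g = 0)
    (hf : inner ℝ f f ≠ 0) (hg : inner ℝ g g ≠ 0) (v : Plane) :
    v = (inner ℝ f v / inner ℝ f f) • f + (inner ℝ g v / inner ℝ g g) • g := by
  have hgf : inner ℝ g f = 0 := by rw [real_inner_comm]; exact hfg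
  refine sub_eq_zero.1 (eq_zero_of_orthogonal_pair hfg hf hg ?_ ?_)
  · rw [inner_sub_right, inner_add_right, real_inner_smul_right, real_inner_smul_right, hfg,
      div_mul_cancel₀ _ hf]
    ring
  · rw [inner_sub_right, inner_add_right, real_inner_smul_right, real_inner_smul_right, hgf,
      div_mul_cancel₀ _ hg]
    ring

lemma IsHemiEquilateral.inner_legs {A B C : Plane} {ℓ : ℝ} (h : IsHemiEquilateral A B C ℓ) :
    inner ℝ (C - A) (B - C) = 0 ∧ inner ℝ (C - A) (C - A) = 3 / 4 * ℓ ^ 2 ∧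
      inner ℝ (B - C) (B - C) = 1 / 4 * ℓ ^ 2 := by
  have hAC : dist A C = √3 / 2 * ℓ := by
    have := EuclideanGeometry.cos_angle_mul_dist_of_angle_eq_pi_div_two (p₁ := B) (p₂ := C)
      (p₃ := A) (by rw [EuclideanGeometry.angle_comm]; exact h.angle_C)
    rw [EuclideanGeometry.angle_comm, h.angle_A, Real.cos_pi_div_six, dist_comm B,
      h.hypotenuse] at this
    exact this.symm
  have hBC : dist B C = 1 / 2 * ℓ := by
    have := EuclideanGeometry.cos_angle_mul_dist_of_angle_eq_pi_div_two (p₁ := A) (p₂ := C)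
      (p₃ := B) h.angle_C
    rw [EuclideanGeometry.angle_comm, h.angle_B, Real.cos_pi_div_three, h.hypotenuse] at this
    exact this.symm
  refine ⟨?_, ?_, ?_⟩
  · have h1 : inner ℝ (A -ᵥ C) (B -ᵥ C) = 0 :=
      InnerProductGeometry.inner_eq_zero_iff_angle_eq_pi_div_two _ _ |>.2 h.angle_C
    rw [← neg_sub A C, inner_neg_left]
    simpa using h1
  · rw [real_inner_self_eq_norm_sq, ← dist_eq_norm, dist_comm, hAC, mul_pow, div_pow,
      Real.sq_sqrt (by norm_num)]
    norm_num
  · rw [real_inner_self_eq_norm_sq, ← dist_eq_norm, hBC]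
    ring

lemma continuous_phase (A w : Plane) : Continuous (phase A w) := by
  unfold phase; fun_prop

lemma phase_combination (A w x y : Plane) {a b : ℝ} (hab : a + b = 1) :
    phase A w (a • x + b • y) = a * phase A w x + b * phase A w y := by
  have : a • x + b • y - A = a • (x - A) + b • (y - A) := by
    have hA : A = a • A + b • A := by rw [← add_smul, hab, one_smul]
    nth_rewrite 1 [hA]
    module
  simp only [phase, this, inner_add_right, real_inner_smul_right]

/-- The closed alcove. -/
def closedAlcove (A w₁ w₂ : Plane) : Set Plane :=
  {x | 0 ≤ phase A w₂ x ∧ phase A w₂ x ≤ phase A w₁ x ∧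
    2 * phase A w₁ x + phase A w₂ x ≤ 2 * Real.pi}

/-- The open alcove. -/
def openAlcove (A w₁ w₂ : Plane) : Set Plane :=
  {x | 0 < phase A w₂ x ∧ phase A w₂ x < phase A w₁ x ∧
    2 * phase A w₁ x + phase A w₂ x < 2 * Real.pi}

lemma isClosed_closedAlcove (A w₁ w₂ : Plane) : IsClosed (closedAlcove A w₁ w₂) := by
  have h1 := continuous_phase A w₁
  have h2 := continuous_phase A w₂
  exact (isClosed_le continuous_const h2).inter ((isClosed_le h2 h1).inter
    (isClosed_le ((continuous_const.mul h1).add h2) continuous_const))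

lemma isOpen_openAlcove (A w₁ w₂ : Plane) : IsOpen (openAlcove A w₁ w₂) := by
  have h1 := continuous_phase A w₁
  have h2 := continuous_phase A w₂
  exact (isOpen_lt continuous_const h2).inter ((isOpen_lt h2 h1).inter
    (isOpen_lt ((continuous_const.mul h1).add h2) continuous_const))

lemma convex_closedAlcove (A w₁ w₂ : Plane) : Convex ℝ (closedAlcove A w₁ w₂) := by
  rintro x ⟨x1, x2, x3⟩ y ⟨y1, y2, y3⟩ a b ha hb hab
  simp only [closedAlcove, mem_ofPred_eq, phase_combination _ _ _ _ hab]
  refine ⟨by positivity, by gcongr, ?_⟩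
  have e : 2 * Real.pi = a * (2 * Real.pi) + b * (2 * Real.pi) := by rw [← add_mul, hab, one_mul]
  rw [e]
  have h1 := mul_le_mul_of_nonneg_left x3 ha
  have h2 := mul_le_mul_of_nonneg_left y3 hb
  linarith

/-- A triangle with phases `(0, 0)`, `(2π/3, 2π/3)`, `(π, 0)` at its vertices is an alcove. -/
lemma isAlcove_openTriangle {A B C w₁ w₂ : Plane}
    (h : ∀ x, ∃ s t : ℝ, x = (1 - s) • A + t • B + (s - t) • C ∧
      phase A w₁ x = Real.pi * s - Real.pi / 3 * t ∧ phase A w₂ x = 2 * Real.pi / 3 * t)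
    (hB1 : phase A w₁ B = 2 * Real.pi / 3) (hB2 : phase A w₂ B = 2 * Real.pi / 3)
    (hC1 : phase A w₁ C = Real.pi) (hC2 : phase A w₂ C = 0) :
    IsAlcove A w₁ w₂ (openTriangle A B C) := by
  have hpi := Real.pi_pos
  have hA : ∀ w, phase A w A = 0 := fun w => by simp [phase]
  have hsub : convexHull ℝ {A, B, C} ⊆ closedAlcove A w₁ w₂ := by
    refine convexHull_min ?_ (convex_closedAlcove A w₁ w₂)
    rintro x (rfl | rfl | rfl) <;> simp only [closedAlcove, mem_ofPred_eq]
    · simp only [hA]; refine ⟨le_rfl, le_rfl, by linarith⟩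
    · rw [hB1, hB2]; refine ⟨by positivity, le_rfl, by linarith⟩
    · rw [hC1, hC2]; refine ⟨le_rfl, hpi.le, by linarith⟩
  have hcl : closure (openTriangle A B C) ⊆ closedAlcove A w₁ w₂ :=
    closure_minimal (interior_subset.trans hsub) (isClosed_closedAlcove A w₁ w₂)
  -- In these coordinates the three wall functionals are 2πt/3, π(s - t) and 2π(1 - s), positive
  -- multiples of the barycentric coordinates.
  have hUsub : openAlcove A w₁ w₂ ⊆ convexHull ℝ {A, B, C} := by
    rintro x ⟨x1, x2, x3⟩
    obtain ⟨s, t, hx, e1, e2⟩ := h x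
    rw [e2] at x1
    rw [e1, e2] at x2 x3
    have t0 : 0 < t := (mul_pos_iff_of_pos_left (by positivity)).1 x1
    have ts : 0 < s - t := (mul_pos_iff_of_pos_left hpi).1 (by linarith)
    have s1 : 0 < 1 - s := (mul_pos_iff_of_pos_left hpi).1 (by linarith)
    rw [hx]
    refine mem_convexHull_of_exists_fintype (w := ![1 - s, t, s - t]) (z := ![A, B, C]) ?_ ?_ ?_ ?_
    · intro i; fin_cases i
      exacts [s1.le, t0.le, ts.le]
    · simp [Fin.sum_univ_three]
    · intro i; fin_cases i <;> simp
    · simp [Fin.sum_univ_three]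
  have hopen : openAlcove A w₁ w₂ ⊆ openTriangle A B C :=
    interior_maximal hUsub (isOpen_openAlcove A w₁ w₂)
  refine ⟨isOpen_interior, ?_, ?_, fun x hx => (hcl hx).1, fun x hx => (hcl hx).2.1,
    fun x hx => (hcl hx).2.2, fun x hx hx' => ?_⟩
  · exact ((toFinite {A, B, C}).isCompact_convexHull (𝕜 := ℝ)).isBounded.subset interior_subset
  · have e : ∀ w, phase A w ((1 / 2 : ℝ) • A + (1 / 2 : ℝ) • ((1 / 2 : ℝ) • B + (1 / 2 : ℝ) • C))
        = 1 / 4 * (phase A w B + phase A w C) := fun w => by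
      rw [phase_combination _ _ _ _ (by norm_num), phase_combination _ _ _ _ (by norm_num), hA]
      ring
    refine ⟨_, hopen (a := (1 / 2 : ℝ) • A + (1 / 2 : ℝ) • ((1 / 2 : ℝ) • B + (1 / 2 : ℝ) • C)) ?_⟩
    simp only [openAlcove, mem_ofPred_eq, e, hB1, hB2, hC1, hC2]
    refine ⟨by positivity, by linarith, by linarith⟩
  · obtain ⟨x1, x2, x3⟩ := hcl hx
    by_contra hne
    simp only [not_or] at hne
    exact hx' (hopen ⟨lt_of_le_of_ne x1 (Ne.symm hne.1), lt_of_le_of_ne x2 (Ne.symm hne.2.1),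
      lt_of_le_of_ne x3 hne.2.2⟩)

/-- A 30-60-90 triangle is an alcove of a hexagonal frame. -/
lemma exists_frame {A B C : Plane} {ℓ : ℝ} (hℓ : 0 < ℓ) (h : IsHemiEquilateral A B C ℓ) :
    ∃ w₁ w₂, IsHexFrame w₁ w₂ (16 * Real.pi ^ 2 / (9 * ℓ ^ 2)) ∧
      IsAlcove A w₁ w₂ (openTriangle A B C) := by
  have hpi := Real.pi_pos
  obtain ⟨hfg, hff, hgg⟩ := IsHemiEquilateral.inner_legs h
  have hB1 : B - A = (C - A) + (B - C) := by abel
  generalize hf : C - A = f at *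
  generalize hg : B - C = g at *
  have hgf : inner ℝ g f = 0 := by rw [real_inner_comm]; exact hfg
  -- For the orthogonal legs f, g with |f|² = 3ℓ²/4 and |g|² = ℓ²/4, the vectors f - g and 2g have
  -- length ℓ and inner product -ℓ²/2. The scale `c` makes the phases at B and C equal to (2π/3,
  -- 2π/3) and (π, 0).
  set c := 4 * Real.pi / (3 * ℓ ^ 2) with hc
  have hcl : c * ℓ ^ 2 = 4 * Real.pi / 3 := by rw [hc]; field_simp
  have hk : 16 * Real.pi ^ 2 / (9 * ℓ ^ 2) = c ^ 2 * ℓ ^ 2 := by rw [hc]; field_simp; ring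
  have p1 : ∀ x, phase A (c • (f - g)) x = c * (inner ℝ f (x - A) - inner ℝ g (x - A)) :=
    fun x => by rw [phase, real_inner_smul_left, inner_sub_left]
  have p2 : ∀ x, phase A ((2 * c) • g) x = 2 * c * inner ℝ g (x - A) := fun x => by
    rw [phase, real_inner_smul_left]
  refine ⟨c • (f - g), (2 * c) • g, ⟨by positivity, ?_, ?_, ?_⟩, ?_⟩
  · rw [hk, real_inner_smul_left, real_inner_smul_right, inner_sub_left, inner_sub_right,
      inner_sub_right, hff, hgg, hfg, hgf]
    ring
  · rw [hk, real_inner_smul_left, real_inner_smul_right, hgg]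
    ring
  · rw [hk, real_inner_smul_left, real_inner_smul_right, inner_sub_left, hgg, hfg]
    ring
  refine isAlcove_openTriangle (fun x => ?_) ?_ ?_ ?_ ?_
  · refine ⟨inner ℝ f (x - A) / inner ℝ f f, inner ℝ g (x - A) / inner ℝ g g, ?_, ?_, ?_⟩
    · have hx := eq_combination_of_orthogonal hfg (by rw [hff]; positivity)
        (by rw [hgg]; positivity) (x - A)
      generalize inner ℝ f (x - A) / inner ℝ f f = s at *
      generalize inner ℝ g (x - A) / inner ℝ g g = t at *
      have : x = A + (s • f + t • g) := by rw [← hx]; abel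
      rw [this, ← hf, ← hg]
      module
    · rw [p1, hff, hgg, hc]; field_simp
    · rw [p2, hgg, hc]; field_simp
  · rw [p1, hB1, inner_add_right, inner_add_right, hff, hgg, hfg, hgf]
    linear_combination 1 / 2 * hcl
  · rw [p2, hB1, inner_add_right, hgg, hgf]
    linear_combination 1 / 2 * hcl
  · rw [p1, hf, hff, hgf]
    linear_combination 3 / 4 * hcl
  · rw [p2, hf, hgf]; ring

end

section

/-! ### Lamé's eigenfunctions -/

/-- The plane wave of integral frequency `(a, b)`. -/
def wave (a b : ℤ) (x y : ℝ) : ℝ := Real.cos (a * x + b * y)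

/-- The antisymmetrization of a plane wave over the hexagonal Weyl group. -/
def modeFun (p q : ℤ) (x y : ℝ) : ℝ :=
  wave p q x y - wave q p x y + wave (-q) (p - q) x y - wave (-p) (q - p) x y
    + wave (q - p) (-p) x y - wave (p - q) (-q) x y

lemma wave_neg (a b : ℤ) (x y : ℝ) : wave (-a) (-b) x y = wave a b x y := by
  rw [wave, wave, ← Real.cos_neg]
  congr 1
  push_cast
  ring

lemma modeFun_swap (p q : ℤ) (x y : ℝ) : modeFun q p x y = -modeFun p q x y := by
  simp only [modeFun]; ring

lemma modeFun_neg (p q : ℤ) (x y : ℝ) : modeFun (-p) (-q) x y = modeFun p q x y := by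
  simp only [modeFun, ← neg_sub', wave_neg]

lemma modeFun_sub (p q : ℤ) (x y : ℝ) : modeFun p (p - q) x y = -modeFun p q x y := by
  have h1 := wave_neg p q x y
  have h2 := wave_neg q p x y
  have h3 := wave_neg p (p - q) x y
  have h4 := wave_neg (p - q) p x y
  have h5 := wave_neg (q - p) q x y
  have h6 := wave_neg q (q - p) x y
  simp only [modeFun, sub_sub_cancel, neg_sub, sub_sub_cancel_left] at *
  linarith

lemma modeFun_rotate (p q : ℤ) (x y : ℝ) : modeFun (p - q) p x y = modeFun p q x y := by
  rw [modeFun_swap, modeFun_sub, neg_neg]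

lemma modeFun_zero_right (p : ℤ) (x y : ℝ) : modeFun p 0 x y = 0 := by
  have := modeFun_neg p 0 x y
  simp only [modeFun, sub_zero, zero_sub, neg_zero] at *
  ring

lemma modeFun_two_mul (q : ℤ) (x y : ℝ) : modeFun (2 * q) q x y = 0 := by
  have := modeFun_sub (2 * q) q x y
  rw [show 2 * q - q = q by ring] at this
  linarith

/-- The mode with index `i = (j, n)` is the antisymmetrized wave of frequency `(2 n + j, n)`. -/
def dominantFun (i : ℕ+ × ℕ+) : ℝ → ℝ → ℝ := modeFun (2 * (i.2 : ℕ) + (i.1 : ℕ)) (i.2 : ℕ)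

/-- The sign rules above describe the dihedral action on frequencies, which carries any (p, q) into
the closed chamber 0 ≤ 2q ≤ p. On its walls q = 0 and p = 2q the mode vanishes; the interior is
parametrized by p = 2n + j, q = n. -/
lemma modeFun_eq_dominant (p q : ℤ) : (∀ x y, modeFun p q x y = 0) ∨
    ∃ i, (∀ x y, modeFun p q x y = dominantFun i x y) ∨
      ∀ x y, modeFun p q x y = -dominantFun i x y := by
  have key : ∀ p q : ℤ, 0 ≤ p → 0 ≤ q → 2 * q ≤ p → (∀ x y, modeFun p q x y = 0) ∨
    ∃ i, (∀ x y, modeFun p q x y = dominantFun i x y) ∨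
      ∀ x y, modeFun p q x y = -dominantFun i x y := by
    intro p q hp hq hpq
    rcases hq.eq_or_lt with rfl | hq
    · exact Or.inl (modeFun_zero_right p)
    rcases hpq.eq_or_lt with rfl | hpq
    · exact Or.inl (modeFun_two_mul q)
    refine Or.inr ⟨⟨⟨(p - 2 * q).toNat, by lia⟩, ⟨q.toNat, by lia⟩⟩, Or.inl fun x y => ?_⟩
    simp only [dominantFun, PNat.mk_coe]
    congr 1 <;> lia
  have key2 : ∀ p q : ℤ, 0 ≤ p → 2 * q ≤ p → (∀ x y, modeFun p q x y = 0) ∨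
    ∃ i, (∀ x y, modeFun p q x y = dominantFun i x y) ∨
      ∀ x y, modeFun p q x y = -dominantFun i x y := by
    intro p q hp hpq
    rcases le_or_gt 0 q with hq | hq
    · exact key p q hp hq hpq
    rcases le_total (2 * p) (p - q) with h | h
    · have := key (p - q) p (by lia) hp h
      simpa only [modeFun_rotate] using this
    · have := key (p - q) (p - q - p) (by lia) (by lia) (by lia)
      simp only [modeFun_sub, modeFun_rotate, neg_eq_iff_eq_neg] at this
      simpa only [neg_neg, neg_zero, or_comm] using this
  have key3 : ∀ p q : ℤ, 0 ≤ p → (∀ x y, modeFun p q x y = 0) ∨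
    ∃ i, (∀ x y, modeFun p q x y = dominantFun i x y) ∨
      ∀ x y, modeFun p q x y = -dominantFun i x y := by
    intro p q hp
    rcases le_total (2 * q) p with hq | hq
    · exact key2 p q hp hq
    · have := key2 p (p - q) hp (by lia)
      simp only [modeFun_sub, neg_eq_iff_eq_neg] at this
      simpa only [neg_neg, neg_zero, or_comm] using this
  rcases le_total 0 p with hp | hp
  · exact key3 p q hp
  · have := key3 (-p) (-q) (by lia)
    simpa only [modeFun_neg] using this

lemma wave_mul_cos (n a b : ℤ) (x y : ℝ) :
    2 * (Real.cos (n * x) + Real.cos (n * y) + Real.cos (n * (x + y))) * wave a b x y =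
      wave (a + n) b x y + wave (a - n) b x y + wave a (b + n) x y + wave a (b - n) x y
        + wave (a + n) (b + n) x y + wave (a - n) (b - n) x y := by
  have h : ∀ s t : ℝ, 2 * Real.cos s * Real.cos t = Real.cos (t + s) + Real.cos (t - s) :=
    fun s t => by rw [Real.cos_add, Real.cos_sub]; ring
  have h1 := h (n * x) (a * x + b * y)
  have h2 := h (n * y) (a * x + b * y)
  have h3 := h (n * (x + y)) (a * x + b * y)
  simp only [wave]
  push_cast
  rw [show ((a : ℝ) + n) * x + b * y = a * x + b * y + n * x by ring,
    show ((a : ℝ) - n) * x + b * y = a * x + b * y - n * x by ring,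
    show (a : ℝ) * x + (b + n) * y = a * x + b * y + n * y by ring,
    show (a : ℝ) * x + (b - n) * y = a * x + b * y - n * y by ring,
    show ((a : ℝ) + n) * x + (b + n) * y = a * x + b * y + n * (x + y) by ring,
    show ((a : ℝ) - n) * x + (b - n) * y = a * x + b * y - n * (x + y) by ring]
  linarith

/-- The frequencies ±(n, 0), ±(0, n), ±(n, n) form a union of orbits, so the cosine sum is invariant
and its product with an antisymmetric sum is again antisymmetric. -/
lemma modeFun_mul_cos (n p q : ℤ) (x y : ℝ) :
    2 * (Real.cos (n * x) + Real.cos (n * y) + Real.cos (n * (x + y))) * modeFun p q x y =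
      modeFun (p + n) q x y + modeFun (p - n) q x y + modeFun p (q + n) x y
        + modeFun p (q - n) x y + modeFun (p + n) (q + n) x y + modeFun (p - n) (q - n) x y := by
  have h := fun a b => wave_mul_cos n a b x y
  rw [modeFun, mul_sub, mul_add, mul_sub, mul_add, mul_sub, h, h, h, h, h, h]
  simp only [modeFun]
  ring_nf

/-- On each of the three walls a wave of frequency (a, b) depends on one integer only (a, a + b or a
- 2b, the last after removing a multiple of 2π), and the six signed waves cancel in pairs. -/
lemma modeFun_eq_zero_of_two {p q : ℤ} {x : ℝ} : modeFun p q x 0 = 0 := by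
  have h1 : Real.cos ((-q : ℤ) * x) = Real.cos (q * x) := by
    rw [← Real.cos_neg]; push_cast; ring_nf
  have h2 : Real.cos ((-p : ℤ) * x) = Real.cos (p * x) := by
    rw [← Real.cos_neg]; push_cast; ring_nf
  have h3 : Real.cos ((q - p : ℤ) * x) = Real.cos ((p - q : ℤ) * x) := by
    rw [← Real.cos_neg]; push_cast; ring_nf
  simp only [modeFun, wave, mul_zero, add_zero, h1, h2, h3]
  ring

lemma modeFun_eq_zero_of_eq {p q : ℤ} {x : ℝ} : modeFun p q x x = 0 := by
  have h : ∀ a b : ℤ, wave a b x x = Real.cos ((a + b : ℤ) * x) := fun a b => by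
    rw [wave]; push_cast; ring_nf
  simp only [modeFun, h]
  ring_nf

lemma modeFun_eq_zero_of_sum {p q : ℤ} {x y : ℝ} (hxy : 2 * x + y = 2 * Real.pi) :
    modeFun p q x y = 0 := by
  obtain rfl : y = 2 * Real.pi - 2 * x := by linarith
  have h : ∀ a b : ℤ, wave a b x (2 * Real.pi - 2 * x) = Real.cos ((a - 2 * b : ℤ) * x) :=
    fun a b => by
      rw [wave, ← Real.cos_add_int_mul_two_pi ((a - 2 * b : ℤ) * x) b]
      push_cast; ring_nf
  simp only [modeFun, h]
  ring_nf

/-! ### The modes on the plane -/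

lemma phase_add_smul (A w₁ w₂ x : Plane) (a b : ℝ) :
    phase A (a • w₁ + b • w₂) x = a * phase A w₁ x + b * phase A w₂ x := by
  simp only [phase, inner_add_left, real_inner_smul_left]

lemma hasFDerivAt_phase (A w x : Plane) : HasFDerivAt (phase A w) (innerSL ℝ w) x :=
  (innerSL ℝ w).hasFDerivAt.comp x ((hasFDerivAt_id x).sub_const A)

lemma contDiff_phase (A w : Plane) : ContDiff ℝ ω (phase A w) :=
  (innerSL ℝ w).contDiff.comp (contDiff_id.sub contDiff_const)

lemma contDiff_cos_phase (A w : Plane) : ContDiff ℝ ω (fun x => Real.cos (phase A w x)) :=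
  Real.contDiff_cos.comp (contDiff_phase A w)

lemma laplacian_cos_phase (A w x : Plane) :
    (Δ fun x => Real.cos (phase A w x)) x = -(inner ℝ w w * Real.cos (phase A w x)) := by
  rw [laplacian_eq_sum_fderiv ((contDiff_cos_phase A w).of_le le_top)]
  have h1 : ∀ v y, fderiv ℝ (fun x => Real.cos (phase A w x)) y v
      = -Real.sin (phase A w y) * inner ℝ w v := fun v y => by
    rw [(hasFDerivAt_phase A w y).cos.fderiv]
    simp
  have h2 : ∀ v, fderiv ℝ (fun y => -Real.sin (phase A w y) * inner ℝ w v) x v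
      = -Real.cos (phase A w x) * (inner ℝ w v * inner ℝ w v) := fun v => by
    have := ((hasFDerivAt_phase A w x).sin.neg.mul_const (inner ℝ w v)).fderiv
    simp only [Pi.neg_apply] at this
    rw [this]
    simp
    ring
  simp only [h1, h2, Fin.sum_univ_two]
  simp only [PiLp.inner_apply, Fin.sum_univ_two, RCLike.inner_apply, conj_trivial,
    EuclideanSpace.basisFun_apply]
  simp
  ring

/-- The modes in the phases of a frame. -/
def mode (A w₁ w₂ : Plane) (p q : ℤ) (x : Plane) : ℝ :=
  modeFun p q (phase A w₁ x) (phase A w₂ x)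

lemma wave_phase (A w₁ w₂ x : Plane) (a b : ℤ) : wave a b (phase A w₁ x) (phase A w₂ x) =
    Real.cos (phase A ((a : ℝ) • w₁ + (b : ℝ) • w₂) x) := by
  rw [wave, phase_add_smul]

lemma contDiff_mode (A w₁ w₂ : Plane) (p q : ℤ) : ContDiff ℝ ω (mode A w₁ w₂ p q) := by
  have h := contDiff_cos_phase A
  unfold mode modeFun
  simp only [wave_phase]
  exact (((((h _).sub (h _)).add (h _)).sub (h _)).add (h _)).sub (h _)

lemma analyticOnNhd_mode (A w₁ w₂ : Plane) (p q : ℤ) :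
    AnalyticOnNhd ℝ (mode A w₁ w₂ p q) univ := fun _ _ =>
  (contDiff_mode A w₁ w₂ p q).contDiffAt.analyticAt

variable {A w₁ w₂ : Plane} {κ : ℝ} {Ω : Set Plane}

/-- The form a² + b² - ab takes the same value on all six frequencies of the antisymmetrization. -/
lemma laplacian_mode (h : IsHexFrame w₁ w₂ κ) (p q : ℤ) (x : Plane) :
    (Δ (mode A w₁ w₂ p q)) x = -(κ * (p ^ 2 + q ^ 2 - p * q) * mode A w₁ w₂ p q x) := by
  let W : Plane → Plane → ℝ := fun w x => Real.cos (phase A w x)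
  have hW : ∀ w, ContDiffAt ℝ 2 (W w) x := fun w =>
    ((contDiff_cos_phase A w).of_le le_top).contDiffAt
  have hm : mode A w₁ w₂ p q = W ((p : ℝ) • w₁ + (q : ℝ) • w₂) - W ((q : ℝ) • w₁ + (p : ℝ) • w₂)
      + W (((-q : ℤ) : ℝ) • w₁ + ((p - q : ℤ) : ℝ) • w₂)
      - W (((-p : ℤ) : ℝ) • w₁ + ((q - p : ℤ) : ℝ) • w₂)
      + W (((q - p : ℤ) : ℝ) • w₁ + ((-p : ℤ) : ℝ) • w₂)
      - W (((p - q : ℤ) : ℝ) • w₁ + ((-q : ℤ) : ℝ) • w₂) := by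
    funext y
    simp only [mode, modeFun, wave_phase, Pi.add_apply, Pi.sub_apply, W]
  have hin : ∀ a b : ℝ, inner ℝ (a • w₁ + b • w₂) (a • w₁ + b • w₂) = κ * (a ^ 2 + b ^ 2 - a * b) :=
    fun a b => by
      have h12 := h.inner_one_two
      have h21 : inner ℝ w₂ w₁ = -κ / 2 := by rw [real_inner_comm]; exact h12
      simp only [inner_add_left, inner_add_right, real_inner_smul_left, real_inner_smul_right,
        h.inner_one, h.inner_two, h12, h21]
      ring
  have hL : ∀ w, (Δ (W w)) x = -(inner ℝ w w * W w x) := fun w => laplacian_cos_phase A w x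
  rw [hm, ContDiffAt.laplacian_sub, ContDiffAt.laplacian_add, ContDiffAt.laplacian_sub,
    ContDiffAt.laplacian_add, ContDiffAt.laplacian_sub]
  · simp only [hL, hin, Pi.add_apply, Pi.sub_apply]
    push_cast
    ring
  all_goals first
    | exact hW _
    | exact (hW _).sub (hW _)
    | exact ((hW _).sub (hW _)).add (hW _)
    | exact (((hW _).sub (hW _)).add (hW _)).sub (hW _)
    | exact ((((hW _).sub (hW _)).add (hW _)).sub (hW _)).add (hW _)

lemma solvesHelmholtz_mode (h : IsHexFrame w₁ w₂ κ) (hΩ : IsAlcove A w₁ w₂ Ω) (p q : ℤ) :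
    SolvesHelmholtz Ω (κ * (p ^ 2 + q ^ 2 - p * q)) (mode A w₁ w₂ p q) := by
  -- A mode may vanish identically; the H¹₀ criterion, which needs a null zero set, does not apply
  -- to it.
  by_cases h0 : ∃ x₀, mode A w₁ w₂ p q x₀ ≠ 0
  · obtain ⟨x₀, h0⟩ := h0
    have hc : ContDiff ℝ ∞ (mode A w₁ w₂ p q) := (contDiff_mode A w₁ w₂ p q).of_le le_top
    refine ⟨memH2_of_contDiff hΩ.isBounded hc, memH10_of_contDiff hΩ.isOpen hΩ.isBounded hc ?_
      (ae_ne_zero_of_analytic (analyticOnNhd_mode A w₁ w₂ p q) h0), ?_⟩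
    · intro x hx hx'
      unfold mode
      rcases hΩ.boundary x hx hx' with e | e | e
      · rw [e]; exact modeFun_eq_zero_of_two
      · rw [e]; exact modeFun_eq_zero_of_eq
      · exact modeFun_eq_zero_of_sum e
    · have := hasWeakLaplacian_of_contDiff hΩ.isBounded hc
      have e : Δ (mode A w₁ w₂ p q) =
          fun x => -(κ * (p ^ 2 + q ^ 2 - p * q) * mode A w₁ w₂ p q x) :=
        funext (laplacian_mode h p q)
      rwa [e] at this
  · push Not at h0
    rw [show mode A w₁ w₂ p q = 0 from funext h0]
    exact SolvesHelmholtz.zero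

end

section

/-! ### Linear independence of the modes -/

/-- The character `(x, y) ↦ exp (i (a x + b y))`. -/
def planeChar (k : ℤ × ℤ) : Multiplicative (ℝ × ℝ) →* ℂ where
  toFun z := Complex.exp ((k.1 * z.toAdd.1 + k.2 * z.toAdd.2 : ℝ) * Complex.I)
  map_one' := by simp
  map_mul' z w := by
    rw [← Complex.exp_add]
    congr 1
    simp only [toAdd_mul, Prod.fst_add, Prod.snd_add]
    push_cast
    ring

lemma planeChar_injective : Function.Injective planeChar := by
  have key : ∀ a b : ℤ, (∀ t : ℝ, Complex.exp ((a * t : ℝ) * Complex.I)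
      = Complex.exp ((b * t : ℝ) * Complex.I)) → a = b := by
    intro a b h
    have hd : ∀ a : ℤ, HasDerivAt (fun t : ℝ => Complex.exp ((a * t : ℝ) * Complex.I))
        (a * Complex.I) 0 := fun a => by
      have h1 : HasDerivAt (fun t : ℝ => (((a * t : ℝ) : ℂ) * Complex.I)) (a * Complex.I) 0 := by
        have := (((hasDerivAt_id (0 : ℝ)).const_mul (a : ℝ)).ofReal_comp).mul_const Complex.I
        simpa using this
      simpa using h1.cexp
    have := (hd a).unique ((hd b).congr_of_eventuallyEq (Eventually.of_forall h))
    simpa using this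
  intro k l h
  have h' : ∀ z : ℝ × ℝ, planeChar k (Multiplicative.ofAdd z) = planeChar l (Multiplicative.ofAdd z) :=
    fun z => by rw [h]
  refine Prod.ext (key _ _ fun t => ?_) (key _ _ fun t => ?_)
  · simpa [planeChar] using h' (t, 0)
  · simpa [planeChar] using h' (0, t)

lemma linearIndependent_planeChar :
    LinearIndependent ℂ (fun k => (planeChar k : Multiplicative (ℝ × ℝ) → ℂ)) :=
  (linearIndependent_monoidHom (Multiplicative (ℝ × ℝ)) ℂ).comp _ planeChar_injective

/-- The Fourier coefficients of a plane wave. -/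
def waveCoeff (a b : ℤ) : ℤ × ℤ →₀ ℂ :=
  Finsupp.single (a, b) (1 / 2) + Finsupp.single (-a, -b) (1 / 2)

/-- The Fourier coefficients of an antisymmetrized plane wave. -/
def modeCoeff (p q : ℤ) : ℤ × ℤ →₀ ℂ :=
  waveCoeff p q - waveCoeff q p + waveCoeff (-q) (p - q) - waveCoeff (-p) (q - p)
    + waveCoeff (q - p) (-p) - waveCoeff (p - q) (-q)

lemma linearCombination_waveCoeff (a b : ℤ) (x y : ℝ) :
    Finsupp.linearCombination ℂ (fun k => (planeChar k : Multiplicative (ℝ × ℝ) → ℂ))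
      (waveCoeff a b) (Multiplicative.ofAdd (x, y)) = wave a b x y := by
  simp only [waveCoeff, map_add, Finsupp.linearCombination_single, Pi.add_apply, Pi.smul_apply,
    planeChar, MonoidHom.coe_mk, OneHom.coe_mk, toAdd_ofAdd, smul_eq_mul, wave, Complex.ofReal_cos,
    Complex.cos]
  push_cast
  ring_nf

lemma linearCombination_modeCoeff (p q : ℤ) (x y : ℝ) :
    Finsupp.linearCombination ℂ (fun k => (planeChar k : Multiplicative (ℝ × ℝ) → ℂ))
      (modeCoeff p q) (Multiplicative.ofAdd (x, y)) = modeFun p q x y := by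
  simp only [modeCoeff, map_add, map_sub, Pi.add_apply, Pi.sub_apply, linearCombination_waveCoeff,
    modeFun]
  push_cast
  rfl

/-- Among the twelve exponentials of a dominant mode, only one has its frequency in the open chamber
0 < 2q < p. Reading off that coefficient separates the modes. -/
lemma modeCoeff_apply {p q p' q' : ℤ} (hq : 0 < q) (hp : 2 * q < p) (hq' : 0 < q')
    (hp' : 2 * q' < p') : modeCoeff p q (p', q') = if p = p' ∧ q = q' then 1 / 2 else 0 := by
  simp only [modeCoeff, waveCoeff, Finsupp.add_apply, Finsupp.sub_apply, Finsupp.single_apply,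
    Prod.mk.injEq]
  rw [if_neg (c := -p = p' ∧ _) (by lia), if_neg (c := q = p' ∧ _) (by lia),
    if_neg (c := -q = p' ∧ -p = q') (by lia), if_neg (c := -q = p' ∧ p - q = q') (by lia),
    if_neg (c := - -q = p' ∧ _) (by lia), if_neg (c := -p = p' ∧ _) (by lia),
    if_neg (c := - -p = p' ∧ _) (by lia), if_neg (c := q - p = p' ∧ _) (by lia),
    if_neg (c := -(q - p) = p' ∧ _) (by lia), if_neg (c := p - q = p' ∧ _) (by lia),
    if_neg (c := -(p - q) = p' ∧ _) (by lia)]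
  simp

lemma dominantFun_independent (s : Finset (ℕ+ × ℕ+)) (c : ℕ+ × ℕ+ → ℝ)
    (h : ∀ x y, ∑ i ∈ s, c i * dominantFun i x y = 0) : ∀ i ∈ s, c i = 0 := by
  have h0 : ∑ i ∈ s, (c i : ℂ) • modeCoeff (2 * (i.2 : ℕ) + (i.1 : ℕ)) (i.2 : ℕ) = 0 := by
    refine (linearIndependent_planeChar.finsuppLinearCombination_injective) ?_
    rw [map_zero]
    funext z
    obtain ⟨⟨x, y⟩, rfl⟩ := Multiplicative.ofAdd.surjective z
    simp only [map_sum, map_smul, Finset.sum_apply, Pi.smul_apply, linearCombination_modeCoeff,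
      Pi.zero_apply, smul_eq_mul]
    exact_mod_cast h x y
  intro i hi
  have h1 := DFunLike.congr_fun h0 ((2 * (i.2 : ℕ) + (i.1 : ℕ) : ℤ), ((i.2 : ℕ) : ℤ))
  rw [Finsupp.finsetSum_apply, Finset.sum_eq_single i] at h1
  · have := i.1.pos
    have := i.2.pos
    rw [Finsupp.smul_apply, modeCoeff_apply (by lia) (by lia) (by lia) (by lia)] at h1
    simpa using h1
  · intro j hj hji
    have := i.1.pos
    have := i.2.pos
    have := j.1.pos
    have := j.2.pos
    rw [Finsupp.smul_apply, modeCoeff_apply (by lia) (by lia) (by lia) (by lia), if_neg, smul_zero]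
    rintro ⟨e1, e2⟩
    refine hji (Prod.ext (PNat.eq ?_) (PNat.eq ?_)) <;> lia
  · exact fun h => absurd hi h

variable {A w₁ w₂ : Plane} {κ : ℝ} {Ω : Set Plane}

lemma eq_zero_of_frame (h : IsHexFrame w₁ w₂ κ) {r : Plane} (h1 : inner ℝ w₁ r = 0)
    (h2 : inner ℝ w₂ r = 0) : r = 0 := by
  have h12 := h.inner_one_two
  have h21 : inner ℝ w₂ w₁ = -κ / 2 := by rw [real_inner_comm]; exact h12
  have hκ := h.pos
  -- The angle of 120 degrees makes w₁ + 2w₂ orthogonal to w₁.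
  refine eq_zero_of_orthogonal_pair (f := w₁) (g := w₁ + (2 : ℝ) • w₂) ?_ ?_ ?_ h1 ?_
  · rw [inner_add_right, real_inner_smul_right, h.inner_one, h12]; ring
  · rw [h.inner_one]; exact hκ.ne'
  · simp only [inner_add_left, inner_add_right, real_inner_smul_left, real_inner_smul_right,
      h.inner_one, h.inner_two, h12, h21]
    linarith
  · rw [inner_add_left, real_inner_smul_left, h1, h2]; ring

lemma exists_phase_eq (A : Plane) (h : IsHexFrame w₁ w₂ κ) (x y : ℝ) :
    ∃ z, phase A w₁ z = x ∧ phase A w₂ z = y := by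
  have h12 := h.inner_one_two
  have h21 : inner ℝ w₂ w₁ = -κ / 2 := by rw [real_inner_comm]; exact h12
  have hκ := h.pos.ne'
  -- The coefficients come from the inverse of the Gram matrix of the frame.
  refine ⟨A + ((4 * x + 2 * y) / (3 * κ)) • w₁ + ((2 * x + 4 * y) / (3 * κ)) • w₂, ?_, ?_⟩ <;>
  · rw [phase, add_assoc, add_sub_cancel_left]
    simp only [inner_add_right, real_inner_smul_right, h.inner_one, h.inner_two, h12, h21]
    field_simp
    ring

/-- The eigenfunction with index `i`. -/
def dominantMode (A w₁ w₂ : Plane) (i : ℕ+ × ℕ+) : Plane → ℝ :=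
  mode A w₁ w₂ (2 * (i.2 : ℕ) + (i.1 : ℕ)) (i.2 : ℕ)

/-- A relation on Ω extends to the whole plane by analyticity; since the phases are coordinates, it
becomes a relation between trigonometric polynomials. -/
lemma dominantMode_independent (h : IsHexFrame w₁ w₂ κ) (hΩ : IsAlcove A w₁ w₂ Ω)
    (s : Finset (ℕ+ × ℕ+)) (c : ℕ+ × ℕ+ → ℝ)
    (h0 : ∀ᵐ x ∂(volume.restrict Ω), ∑ i ∈ s, c i * dominantMode A w₁ w₂ i x = 0) :
    ∀ i ∈ s, c i = 0 := by
  refine dominantFun_independent s c fun x y => ?_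
  obtain ⟨z, rfl, rfl⟩ := exists_phase_eq A h x y
  by_contra hne
  have han : AnalyticOnNhd ℝ (fun x => ∑ i ∈ s, c i * dominantMode A w₁ w₂ i x) univ :=
    fun x hx => Finset.analyticAt_fun_sum _ fun i _ =>
      analyticAt_const.mul (analyticOnNhd_mode A w₁ w₂ _ _ x hx)
  have h1 := ae_restrict_of_ae (s := Ω) (ae_ne_zero_of_analytic han hne)
  have h2 : ∀ᵐ x ∂(volume.restrict Ω), False := by
    filter_upwards [h0, h1] with x hx hx' using hx' hx
  rw [eventually_false_iff_eq_bot, ae_eq_bot, Measure.restrict_eq_zero] at h2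
  exact (hΩ.isOpen.measure_pos volume hΩ.nonempty).ne' h2

lemma ae_dominantMode_ne_zero (h : IsHexFrame w₁ w₂ κ) (hΩ : IsAlcove A w₁ w₂ Ω) (i : ℕ+ × ℕ+) :
    ∀ᵐ x, dominantMode A w₁ w₂ i x ≠ 0 := by
  have : ∃ x, dominantMode A w₁ w₂ i x ≠ 0 := by
    by_contra! h0
    have := dominantMode_independent h hΩ {i} (fun _ => 1) (Eventually.of_forall fun x => by
      simp [h0]) i (Finset.mem_singleton_self i)
    exact one_ne_zero this
  obtain ⟨x, hx⟩ := this
  exact ae_ne_zero_of_analytic (analyticOnNhd_mode A w₁ w₂ _ _) hx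

end

section

/-! ### Completeness of the modes -/

/-- Two decreasing triples with the same power sums of order one and two and the same product
agree. -/
lemma sorted_triple_eq {a b c a' b' c' : ℝ} (h1 : b ≤ a) (h2 : c ≤ b) (h1' : b' ≤ a')
    (h2' : c' ≤ b') (hs : a + b + c = a' + b' + c')
    (hq : a ^ 2 + b ^ 2 + c ^ 2 = a' ^ 2 + b' ^ 2 + c' ^ 2) (hp : a * b * c = a' * b' * c') :
    a = a' ∧ b = b' := by
  have he : a * b + b * c + c * a = a' * b' + b' * c' + c' * a' := by
    linear_combination 1 / 2 * (a + b + c + (a' + b' + c')) * hs - 1 / 2 * hq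
  have e : ∀ t, (t - a) * (t - b) * (t - c) = (t - a') * (t - b') * (t - c') := fun t => by
    linear_combination -t ^ 2 * hs + t * he - hp
  have top : ∀ {a b c a' b' c' : ℝ}, b' ≤ a' → c' ≤ b' →
      (∀ t : ℝ, (t - a) * (t - b) * (t - c) = (t - a') * (t - b') * (t - c')) → a ≤ a' := by
    intro a b c a' b' c' h1 h2 e
    have := e a
    rw [sub_self, zero_mul, zero_mul, eq_comm, mul_eq_zero, mul_eq_zero] at this
    rcases this with (h | h) | h <;> linarith
  have bot : ∀ {a b c a' b' c' : ℝ}, b' ≤ a' → c' ≤ b' →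
      (∀ t : ℝ, (t - a) * (t - b) * (t - c) = (t - a') * (t - b') * (t - c')) → c' ≤ c := by
    intro a b c a' b' c' h1 h2 e
    have := e c
    rw [sub_self, mul_zero, eq_comm, mul_eq_zero, mul_eq_zero] at this
    rcases this with (h | h) | h <;> linarith
  have ha := (top h1' h2' e).antisymm (top h1 h2 fun t => (e t).symm)
  have hc := (bot h1 h2 fun t => (e t).symm).antisymm (bot h1' h2' e)
  exact ⟨ha, by linarith⟩

/-- The invariant `∑ cos (n θ)` of the hexagonal Weyl group. -/
def cosSum (n : ℤ) (x y : ℝ) : ℝ :=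
  Real.cos (n * x) + Real.cos (n * y) + Real.cos (n * (x + y))

/-- On the closed alcove cos y ≥ cos x ≥ cos (x + y). The two invariants give the first two power
sums of this triple, and 1 + 2 cos x cos y cos (x + y) = cos² x + cos² y + cos² (x + y) then gives
its product, so the sorted triple is determined. -/
lemma cosSum_injOn {x y x' y' : ℝ} (h0 : 0 ≤ y) (h1 : y ≤ x) (h2 : 2 * x + y ≤ 2 * Real.pi)
    (h0' : 0 ≤ y') (h1' : y' ≤ x') (h2' : 2 * x' + y' ≤ 2 * Real.pi)
    (e1 : cosSum 1 x y = cosSum 1 x' y') (e2 : cosSum 2 x y = cosSum 2 x' y') :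
    x = x' ∧ y = y' := by
  have anti : ∀ {s t : ℝ}, 0 ≤ s → s ≤ t → s + t ≤ 2 * Real.pi → Real.cos t ≤ Real.cos s := by
    intro s t hs hst hsum
    have : Real.cos t - Real.cos s = -2 * Real.sin ((t + s) / 2) * Real.sin ((t - s) / 2) :=
      Real.cos_sub_cos t s
    have p1 := Real.sin_nonneg_of_nonneg_of_le_pi (x := (t + s) / 2) (by linarith) (by linarith)
    have p2 := Real.sin_nonneg_of_nonneg_of_le_pi (x := (t - s) / 2) (by linarith) (by linarith)
    nlinarith [mul_nonneg p1 p2]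
  have prod : ∀ x y : ℝ, 1 + 2 * (Real.cos y * Real.cos x * Real.cos (x + y)) =
      Real.cos y ^ 2 + Real.cos x ^ 2 + Real.cos (x + y) ^ 2 := fun x y => by
    rw [Real.cos_add]
    linear_combination -Real.sin y ^ 2 * Real.sin_sq_add_cos_sq x
      - (1 - Real.cos x ^ 2) * Real.sin_sq_add_cos_sq y
  have sq : ∀ x y : ℝ, cosSum 2 x y =
      2 * (Real.cos y ^ 2 + Real.cos x ^ 2 + Real.cos (x + y) ^ 2) - 3 := fun x y => by
    simp only [cosSum, Int.cast_ofNat, Real.cos_two_mul]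
    ring
  have hsq : Real.cos y ^ 2 + Real.cos x ^ 2 + Real.cos (x + y) ^ 2 =
      Real.cos y' ^ 2 + Real.cos x' ^ 2 + Real.cos (x' + y') ^ 2 := by
    rw [sq, sq] at e2
    linarith
  have hs : Real.cos y + Real.cos x + Real.cos (x + y) =
      Real.cos y' + Real.cos x' + Real.cos (x' + y') := by
    simp only [cosSum, Int.cast_one, one_mul] at e1
    linarith
  obtain ⟨hy, hx⟩ := sorted_triple_eq (anti h0 h1 (by linarith))
    (anti (by linarith) (by linarith) (by linarith)) (anti h0' h1' (by linarith))
    (anti (by linarith) (by linarith) (by linarith)) hs hsq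
    (by linarith [prod x y, prod x' y'])
  exact ⟨Real.injOn_cos ⟨by linarith, by linarith⟩ ⟨by linarith, by linarith⟩ hx,
    Real.injOn_cos ⟨by linarith, by linarith⟩ ⟨by linarith, by linarith⟩ hy⟩

variable {A w₁ w₂ : Plane} {κ : ℝ} {Ω : Set Plane}

/-- An invariant trigonometric polynomial as a continuous function on `K`. -/
def invariantMap (A w₁ w₂ : Plane) (K : Set Plane) (n : ℤ) : C(K, ℝ) where
  toFun x := cosSum n (phase A w₁ x) (phase A w₂ x)
  continuous_toFun := by
    have h1 := continuous_phase A w₁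
    have h2 := continuous_phase A w₂
    unfold cosSum
    fun_prop

lemma invariantMap_separatesPoints (h : IsHexFrame w₁ w₂ κ) (hΩ : IsAlcove A w₁ w₂ Ω) :
    (Algebra.adjoin ℝ (range (invariantMap A w₁ w₂ (closure Ω)))).SeparatesPoints := by
  intro x y hxy
  by_contra! hne
  have e : ∀ n : ℤ, cosSum n (phase A w₁ x) (phase A w₂ x) =
      cosSum n (phase A w₁ y) (phase A w₂ y) := fun n =>
    hne _ ⟨_, Algebra.subset_adjoin (mem_range_self n), rfl⟩
  obtain ⟨e1, e2⟩ := cosSum_injOn (hΩ.two_nonneg x x.2) (hΩ.two_le_one x x.2) (hΩ.sum_le x x.2)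
    (hΩ.two_nonneg y y.2) (hΩ.two_le_one y y.2) (hΩ.sum_le y y.2) (e 1) (e 2)
  refine hxy (Subtype.ext (sub_eq_zero.1 (eq_zero_of_frame h ?_ ?_)))
  · rw [← sub_sub_sub_cancel_right (x : Plane) y A, inner_sub_right]
    exact sub_eq_zero.2 e1
  · rw [← sub_sub_sub_cancel_right (x : Plane) y A, inner_sub_right]
    exact sub_eq_zero.2 e2

/-- The span of the modes is a module over the algebra of invariants; on generators this is
`modeFun_mul_cos`. -/
lemma exists_span_eq_mul {K : Set Plane} {a : C(K, ℝ)}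
    (ha : a ∈ Algebra.adjoin ℝ (range (invariantMap A w₁ w₂ K))) {m : Plane → ℝ}
    (hm : m ∈ Submodule.span ℝ (range fun k : ℤ × ℤ => mode A w₁ w₂ k.1 k.2)) :
    ∃ m' ∈ Submodule.span ℝ (range fun k : ℤ × ℤ => mode A w₁ w₂ k.1 k.2),
      ∀ x : K, m' x = a x * m x := by
  induction ha using Algebra.adjoin_induction generalizing m with
  | mem a ha =>
    obtain ⟨n, rfl⟩ := ha
    induction hm using Submodule.span_induction with
    | mem m hm =>
      obtain ⟨⟨p, q⟩, rfl⟩ := hm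
      have hs : ∀ k l : ℤ, mode A w₁ w₂ k l ∈
          Submodule.span ℝ (range fun k : ℤ × ℤ => mode A w₁ w₂ k.1 k.2) := fun k l =>
        Submodule.subset_span ⟨(k, l), rfl⟩
      refine ⟨(1 / 2 : ℝ) • (mode A w₁ w₂ (p + n) q + mode A w₁ w₂ (p - n) q
        + mode A w₁ w₂ p (q + n) + mode A w₁ w₂ p (q - n) + mode A w₁ w₂ (p + n) (q + n)
        + mode A w₁ w₂ (p - n) (q - n)), Submodule.smul_mem _ _ (add_mem (add_mem (add_mem
          (add_mem (add_mem (hs _ _) (hs _ _)) (hs _ _)) (hs _ _)) (hs _ _)) (hs _ _)),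
        fun x => ?_⟩
      have := modeFun_mul_cos n p q (phase A w₁ x) (phase A w₂ x)
      simp only [Pi.smul_apply, Pi.add_apply, smul_eq_mul, mode, invariantMap, ContinuousMap.coe_mk,
        cosSum] at this ⊢
      linarith
    | zero => exact ⟨0, zero_mem _, fun x => by simp⟩
    | add m₁ m₂ _ _ h1 h2 =>
      obtain ⟨m₁', h1, e1⟩ := h1
      obtain ⟨m₂', h2, e2⟩ := h2
      exact ⟨m₁' + m₂', add_mem h1 h2, fun x => by simp only [Pi.add_apply, e1, e2]; ring⟩
    | smul c m _ h =>
      obtain ⟨m', h, e⟩ := h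
      exact ⟨c • m', Submodule.smul_mem _ _ h, fun x => by
        simp only [Pi.smul_apply, smul_eq_mul, e]; ring⟩
  | algebraMap r => exact ⟨r • m, Submodule.smul_mem _ _ hm, fun x => by simp⟩
  | add a b _ _ h1 h2 =>
    obtain ⟨m₁', h1, e1⟩ := h1 hm
    obtain ⟨m₂', h2, e2⟩ := h2 hm
    exact ⟨m₁' + m₂', add_mem h1 h2, fun x => by
      simp only [Pi.add_apply, ContinuousMap.add_apply, e1, e2]; ring⟩
  | mul a b _ _ h1 h2 =>
    obtain ⟨m₂', h2, e2⟩ := h2 hm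
    obtain ⟨m₁', h1, e1⟩ := h1 h2
    exact ⟨m₁', h1, fun x => by simp only [ContinuousMap.mul_apply, e1, e2]; ring⟩

/-- Completeness. An invariant times the first mode is a combination of modes, so `u` times the
first mode integrates to zero against every invariant. Invariants are uniformly dense in the
continuous functions by Stone–Weierstrass, hence that product vanishes almost everywhere, and the
first mode is analytic with null zero set. -/
lemma ae_eq_zero_of_orthogonal (h : IsHexFrame w₁ w₂ κ) (hΩ : IsAlcove A w₁ w₂ Ω) {u : Plane → ℝ}
    (hu : MemL2 Ω u) (h0 : ∀ p q, ∫ x in Ω, u x * mode A w₁ w₂ p q x = 0) :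
    ∀ᵐ x ∂(volume.restrict Ω), u x = 0 := by
  have hK : CompactSpace (closure Ω) := isCompact_iff_compactSpace.1 hΩ.isBounded.isCompact_closure
  have hml2 : ∀ p q, MemL2 Ω (mode A w₁ w₂ p q) := fun p q =>
    memL2_of_continuous hΩ.isBounded (contDiff_mode A w₁ w₂ p q).continuous
  have hspan : ∀ m ∈ Submodule.span ℝ (range fun k : ℤ × ℤ => mode A w₁ w₂ k.1 k.2),
      MemL2 Ω m ∧ ∫ x in Ω, u x * m x = 0 := by
    intro m hm
    induction hm using Submodule.span_induction with
    | mem m hm =>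
      obtain ⟨⟨p, q⟩, rfl⟩ := hm
      exact ⟨hml2 p q, h0 p q⟩
    | zero => exact ⟨MemLp.zero, by simp⟩
    | add m₁ m₂ _ _ h1 h2 =>
      refine ⟨MemLp.add h1.1 h2.1, ?_⟩
      simp only [Pi.add_apply, mul_add]
      rw [integral_add (hu.integrable_mul' h1.1) (hu.integrable_mul' h2.1), h1.2, h2.2, add_zero]
    | smul c m _ h =>
      refine ⟨MemLp.const_smul h.1 c, ?_⟩
      simp only [Pi.smul_apply, smul_eq_mul, mul_left_comm, integral_const_mul, h.2, mul_zero]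
  let f : Plane → ℝ := fun x => u x * dominantMode A w₁ w₂ (1, 1) x
  have hf : Integrable f (volume.restrict Ω) := hu.integrable_mul' (hml2 _ _)
  have hg : ∀ g : Plane → ℝ, Continuous g → ∫ x in Ω, g x • f x = 0 := by
    intro g hg
    have hbound : ∀ ε > 0, ‖∫ x in Ω, g x • f x‖ ≤ ε * ∫ x in Ω, ‖f x‖ := by
      intro ε hε
      obtain ⟨⟨a, ha⟩, hclose⟩ :=
        ContinuousMap.exists_mem_subalgebra_near_continuousMap_of_separatesPoints _
          (invariantMap_separatesPoints h hΩ) (ContinuousMap.restrict (closure Ω) ⟨g, hg⟩) ε hε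
      obtain ⟨m, hm, e⟩ := exists_span_eq_mul (A := A) (w₁ := w₁) (w₂ := w₂) ha
        (m := dominantMode A w₁ w₂ (1, 1)) (Submodule.subset_span ⟨(_, _), rfl⟩)
      obtain ⟨hm2, hm0⟩ := hspan m hm
      have hgf : Integrable (fun x => g x • f x) (volume.restrict Ω) :=  by
        have : MemL2 Ω (fun x => g x * dominantMode A w₁ w₂ (1, 1) x) :=
          memL2_of_continuous hΩ.isBounded (hg.mul (contDiff_mode A w₁ w₂ _ _).continuous)
        refine (hu.integrable_mul' this).congr (Eventually.of_forall fun x => ?_)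
        simp only [f, smul_eq_mul]
        ring
      have hsub : ∫ x in Ω, g x • f x = ∫ x in Ω, (g x • f x - u x * m x) := by
        rw [integral_sub hgf (hu.integrable_mul' hm2), hm0, sub_zero]
      rw [hsub, ← integral_const_mul]
      refine norm_integral_le_of_norm_le (hf.norm.const_mul ε) ?_
      filter_upwards [ae_restrict_mem hΩ.isOpen.measurableSet] with x hx
      have hx' := subset_closure hx
      have h1 := (ContinuousMap.norm_coe_le_norm _ (⟨x, hx'⟩ : closure Ω)).trans hclose.le
      have h2 := e ⟨x, hx'⟩
      simp only at h2
      have h3 : g x • f x - u x * m x = -((a ⟨x, hx'⟩ - g x) * f x) := by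
        rw [h2]; simp only [f, smul_eq_mul]; ring
      rw [h3, norm_neg, norm_mul]
      gcongr
      simpa using h1
    have hlim : Tendsto (fun ε : ℝ => ε * ∫ x in Ω, ‖f x‖) (𝓝[>] 0) (𝓝 0) := by
      have : Tendsto (fun ε : ℝ => ε * ∫ x in Ω, ‖f x‖) (𝓝 0) (𝓝 (0 * ∫ x in Ω, ‖f x‖)) :=
        tendsto_id.mul_const _
      rw [zero_mul] at this
      exact this.mono_left nhdsWithin_le_nhds
    have := ge_of_tendsto hlim (eventually_mem_nhdsWithin.mono fun ε hε => hbound ε hε)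
    exact norm_le_zero_iff.1 this
  have hzero := ae_eq_zero_of_integral_contDiff_smul_eq_zero hf.locallyIntegrable
    fun g hgd _ => hg g hgd.continuous
  filter_upwards [hzero, ae_restrict_of_ae (ae_dominantMode_ne_zero h hΩ (1, 1))] with x h1 h2
  exact (mul_eq_zero.1 h1).resolve_right h2

end

section

/-! ### The Dirichlet spectrum -/

variable {A w₁ w₂ : Plane} {κ : ℝ} {Ω : Set Plane}

lemma solvesHelmholtz_dominantMode (h : IsHexFrame w₁ w₂ κ) (hΩ : IsAlcove A w₁ w₂ Ω)
    (i : ℕ+ × ℕ+) : SolvesHelmholtz Ω (κ * modeForm i) (dominantMode A w₁ w₂ i) := by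
  have := solvesHelmholtz_mode h hΩ (2 * (i.2 : ℕ) + (i.1 : ℕ)) (i.2 : ℕ)
  rw [show κ * modeForm i = κ * (((2 * (i.2 : ℕ) + (i.1 : ℕ) : ℤ) : ℝ) ^ 2 + (((i.2 : ℕ) : ℤ) : ℝ) ^ 2
    - ((2 * (i.2 : ℕ) + (i.1 : ℕ) : ℤ) : ℝ) * (((i.2 : ℕ) : ℤ) : ℝ)) by
      simp only [modeForm, hexForm]; push_cast; ring]
  exact this

/-- The eigenfunctions as elements of `L²(Ω)`. -/
def dominantLp (h : IsHexFrame w₁ w₂ κ) (hΩ : IsAlcove A w₁ w₂ Ω) (i : ℕ+ × ℕ+) :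
    Lp ℝ 2 (volume.restrict Ω) :=
  MemLp.toLp (dominantMode A w₁ w₂ i) (solvesHelmholtz_dominantMode h hΩ i).memH2.1

lemma coeFn_dominantLp (h : IsHexFrame w₁ w₂ κ) (hΩ : IsAlcove A w₁ w₂ Ω) (i : ℕ+ × ℕ+) :
    dominantLp h hΩ i =ᵐ[volume.restrict Ω] dominantMode A w₁ w₂ i :=
  MemLp.coeFn_toLp _

lemma dominantLp_mem (h : IsHexFrame w₁ w₂ κ) (hΩ : IsAlcove A w₁ w₂ Ω) (i : ℕ+ × ℕ+) :
    dominantLp h hΩ i ∈ dirichletEigenspace Ω (κ * modeForm i) :=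
  (solvesHelmholtz_dominantMode h hΩ i).congr (coeFn_dominantLp h hΩ i).symm

lemma linearIndependent_dominantLp (h : IsHexFrame w₁ w₂ κ) (hΩ : IsAlcove A w₁ w₂ Ω) :
    LinearIndependent ℝ (dominantLp h hΩ) := by
  refine linearIndependent_iff'.2 fun s c hc => dominantMode_independent h hΩ s c ?_
  have h1 := Lp.coeFn_finsetSum s fun i => c i • dominantLp h hΩ i
  rw [hc] at h1
  have h2 : ∀ᵐ x ∂(volume.restrict Ω), ∀ i, (c i • dominantLp h hΩ i : Lp ℝ 2 _) x
      = c i * dominantMode A w₁ w₂ i x := ae_all_iff.2 fun i => by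
    filter_upwards [Lp.coeFn_smul (c i) (dominantLp h hΩ i), coeFn_dominantLp h hΩ i] with x hx hx'
    rw [hx, Pi.smul_apply, hx', smul_eq_mul]
  filter_upwards [h1, h2, Lp.coeFn_zero ℝ 2 (volume.restrict Ω)] with x hx hx' hx0
  rw [hx0, Finset.sum_apply] at hx
  simpa [hx'] using hx.symm

/-- The indices of the modes of eigenvalue `lam`. -/
def modeFiber (κ lam : ℝ) : Set (ℕ+ × ℕ+) := {i | κ * modeForm i = lam}

/-- The terms of the convergent series at s = 2 tend to zero, so no value is repeated infinitely
often. -/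
lemma finite_modeFiber (hκ : 0 < κ) (lam : ℝ) : (modeFiber κ lam).Finite := by
  rcases (modeFiber κ lam).eq_empty_or_nonempty with he | ⟨i₀, hi₀⟩
  · rw [he]; exact finite_empty
  have ht := (hasSum_modeForm (s := 2) (by norm_num)).summable.tendsto_cofinite_zero
  have hne : (0 : ℂ) ≠ 1 / (modeForm i₀ : ℂ) ^ (2 : ℂ) :=
    (div_ne_zero one_ne_zero (by simp [(modeForm_pos i₀).ne'])).symm
  have := ht.eventually_ne hne
  rw [eventually_cofinite] at this
  refine this.subset fun i hi => ?_
  have e : modeForm i = modeForm i₀ := mul_left_cancel₀ hκ.ne' (Eq.trans hi hi₀.symm)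
  simp [e]

lemma integral_mul_mode_eq_zero (h : IsHexFrame w₁ w₂ κ) (hΩ : IsAlcove A w₁ w₂ Ω) {lam : ℝ}
    {u : Plane → ℝ} (hu : SolvesHelmholtz Ω lam u)
    (h0 : ∀ i ∈ modeFiber κ lam, ∫ x in Ω, u x * dominantMode A w₁ w₂ i x = 0) (p q : ℤ) :
    ∫ x in Ω, u x * mode A w₁ w₂ p q x = 0 := by
  have key : ∀ i, ∫ x in Ω, u x * dominantMode A w₁ w₂ i x = 0 := fun i => by
    by_cases hi : i ∈ modeFiber κ lam
    · exact h0 i hi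
    · exact SolvesHelmholtz.integral_mul_eq_zero hu (solvesHelmholtz_dominantMode h hΩ i)
        fun e => hi e.symm
  rcases modeFun_eq_dominant p q with h1 | ⟨i, h1 | h1⟩
  · simp [mode, h1]
  · simp only [mode, h1]
    exact key i
  · simp only [mode, h1, mul_neg, integral_neg]
    rw [neg_eq_zero]
    exact key i

/-- Subtract from a solution its projection to the span. The remainder still solves the equation and
is orthogonal to the modes of this eigenvalue by construction and to all others because the
eigenvalues differ, so completeness makes it zero. -/
lemma dirichletEigenspace_eq_span (h : IsHexFrame w₁ w₂ κ) (hΩ : IsAlcove A w₁ w₂ Ω) (lam : ℝ) :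
    dirichletEigenspace Ω lam =
      Submodule.span ℝ (range fun i : modeFiber κ lam => dominantLp h hΩ i) := by
  have hfin := (finite_modeFiber h.pos lam).to_subtype
  have hle : Submodule.span ℝ (range fun i : modeFiber κ lam => dominantLp h hΩ i) ≤
      dirichletEigenspace Ω lam := by
    rw [Submodule.span_le]
    rintro _ ⟨⟨i, hi⟩, rfl⟩
    have := dominantLp_mem h hΩ i
    rwa [show κ * modeForm i = lam from hi] at this
  refine le_antisymm (fun u hu => ?_) hle
  set V := Submodule.span ℝ (range fun i : modeFiber κ lam => dominantLp h hΩ i) with hV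
  have hVfin : FiniteDimensional ℝ V := FiniteDimensional.span_of_finite ℝ (finite_range _)
  have hv : u - V.starProjection u ∈ dirichletEigenspace Ω lam :=
    sub_mem hu (hle (V.starProjection_apply_mem u))
  have hv0 : u - V.starProjection u = 0 := by
    rw [Lp.eq_zero_iff_ae_eq_zero]
    refine ae_eq_zero_of_orthogonal h hΩ (Lp.memLp _) (integral_mul_mode_eq_zero h hΩ hv ?_)
    intro i hi
    have h1 : inner ℝ (u - V.starProjection u) (dominantLp h hΩ i) = 0 :=
      V.starProjection_inner_eq_zero u _ (Submodule.subset_span ⟨⟨i, hi⟩, rfl⟩)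
    rw [L2.inner_def] at h1
    rw [← h1]
    refine integral_congr_ae ?_
    filter_upwards [coeFn_dominantLp h hΩ i] with x hx
    rw [hx, RCLike.inner_apply, conj_trivial, mul_comm]
  rw [sub_eq_zero.1 hv0]
  exact V.starProjection_apply_mem u

lemma finiteDimensional_dirichletEigenspace (h : IsHexFrame w₁ w₂ κ) (hΩ : IsAlcove A w₁ w₂ Ω)
    (lam : ℝ) : FiniteDimensional ℝ (dirichletEigenspace Ω lam) := by
  have hfin := (finite_modeFiber h.pos lam).to_subtype
  rw [dirichletEigenspace_eq_span h hΩ]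
  exact FiniteDimensional.span_of_finite ℝ (finite_range _)

lemma dirichletMultiplicity_eq (h : IsHexFrame w₁ w₂ κ) (hΩ : IsAlcove A w₁ w₂ Ω) (lam : ℝ) :
    dirichletMultiplicity Ω lam = Nat.card (modeFiber κ lam) := by
  have := (finite_modeFiber h.pos lam).fintype
  rw [dirichletMultiplicity, dirichletEigenspace_eq_span h hΩ, Nat.card_eq_fintype_card]
  exact finrank_span_eq_card ((linearIndependent_dominantLp h hΩ).comp _ Subtype.val_injective)

lemma mem_dirichletSpectrum_iff (h : IsHexFrame w₁ w₂ κ) (hΩ : IsAlcove A w₁ w₂ Ω) (lam : ℝ) :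
    lam ∈ dirichletSpectrum Ω ↔ ∃ i, κ * modeForm i = lam := by
  constructor
  · intro hl
    by_contra! hne
    have : IsEmpty (modeFiber κ lam) := ⟨fun i => hne i i.2⟩
    refine hl ?_
    rw [dirichletEigenspace_eq_span h hΩ, range_eq_empty, Submodule.span_empty]
  · rintro ⟨i, rfl⟩ hb
    have := dominantLp_mem h hΩ i
    rw [hb, Submodule.mem_bot] at this
    exact (linearIndependent_dominantLp h hΩ).ne_zero i this

/-- Group the sum over modes by eigenvalue; the number of modes in a group is the multiplicity. -/
lemma hasSum_dirichletSpectrum (h : IsHexFrame w₁ w₂ κ) (hΩ : IsAlcove A w₁ w₂ Ω) {s : ℂ}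
    (hs : 1 < s.re) : HasSum (fun lam : dirichletSpectrum Ω =>
      (dirichletMultiplicity Ω lam : ℂ) * ((lam : ℝ) : ℂ) ^ (-s)) ((κ : ℂ) ^ (-s) * modeZeta s) := by
  let g : ℕ+ × ℕ+ → dirichletSpectrum Ω := fun i =>
    ⟨κ * modeForm i, (mem_dirichletSpectrum_iff h hΩ _).2 ⟨i, rfl⟩⟩
  have h1 : HasSum (fun i => ((g i : ℝ) : ℂ) ^ (-s)) ((κ : ℂ) ^ (-s) * modeZeta s) := by
    refine ((hasSum_modeForm hs).mul_left ((κ : ℂ) ^ (-s))).congr_fun fun i => ?_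
    simp only [g]
    rw [Complex.ofReal_mul, Complex.mul_cpow_ofReal_nonneg h.pos.le (modeForm_pos i).le,
      Complex.cpow_neg (modeForm i : ℂ), one_div]
  refine ((Equiv.sigmaFiberEquiv g).hasSum_iff.2 h1).sigma fun lam => ?_
  have e : {i // g i = lam} ≃ modeFiber κ lam :=
    Equiv.subtypeEquivRight fun i => by simp [g, modeFiber, Subtype.ext_iff]
  have := (finite_modeFiber h.pos lam).fintype
  have := Fintype.ofEquiv _ e.symm
  have h2 := hasSum_fintype fun c : {i // g i = lam} =>
    ((fun i => ((g i : ℝ) : ℂ) ^ (-s)) ∘ (Equiv.sigmaFiberEquiv g)) ⟨lam, c⟩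
  convert h2 using 1
  have h3 : ∀ c : {i // g i = lam},
      ((fun i => ((g i : ℝ) : ℂ) ^ (-s)) ∘ (Equiv.sigmaFiberEquiv g)) ⟨lam, c⟩
        = ((lam : ℝ) : ℂ) ^ (-s) := fun c => by
    simp [Equiv.sigmaFiberEquiv, c.2]
  rw [Finset.sum_congr rfl fun c _ => h3 c, Finset.sum_const, Finset.card_univ, nsmul_eq_mul,
    dirichletMultiplicity_eq h hΩ, ← Nat.card_congr e, Nat.card_eq_fintype_card]

end

section

/-! ### The spectral zeta function -/

/-- The difference has infinite order at 2, hence at every point by connectedness. Normal form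
upgrades equality on punctured neighbourhoods to equality at the points themselves. -/
lemma isSpectralZeta_unique {Ω : Set Plane} {Z Z' : ℂ → ℂ} (h : IsSpectralZeta Ω Z)
    (h' : IsSpectralZeta Ω Z') : Z = Z' := by
  have hm : MeromorphicOn (Z - Z') univ := h.meromorphic.meromorphicOn.sub h'.meromorphic.meromorphicOn
  have hopen : IsOpen {s : ℂ | 1 < s.re} := isOpen_lt continuous_const Complex.continuous_re
  have h2 : meromorphicOrderAt (Z - Z') 2 = ⊤ := by
    rw [meromorphicOrderAt_eq_top_iff]
    refine Filter.Eventually.filter_mono nhdsWithin_le_nhds ?_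
    filter_upwards [hopen.mem_nhds (show (1 : ℝ) < (2 : ℂ).re by norm_num)] with s hs
    exact sub_eq_zero.2 ((h.hasSum s hs).unique (h'.hasSum s hs))
  funext s
  have hs : meromorphicOrderAt (Z - Z') s = ⊤ := by
    by_contra hne
    exact hm.meromorphicOrderAt_ne_top_of_isPreconnected isPreconnected_univ (mem_univ s)
      (mem_univ 2) hne h2
  rw [meromorphicOrderAt_eq_top_iff] at hs
  have : Z =ᶠ[𝓝[≠] s] Z' := hs.mono fun z hz => sub_eq_zero.1 hz
  exact ((h.meromorphic (mem_univ s)).eventuallyEq_nhdsNE_iff_eventuallyEq_nhds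
    (h'.meromorphic (mem_univ s)) |>.1 this).eq_of_nhds

lemma spectralZeta_eq {Ω : Set Plane} {Z : ℂ → ℂ} (h : IsSpectralZeta Ω Z) :
    spectralZeta Ω = Z := by
  have hex : ∃ Z : ℂ → ℂ, IsSpectralZeta Ω Z := ⟨Z, h⟩
  rw [spectralZeta, dif_pos hex]
  exact isSpectralZeta_unique hex.choose_spec h

/-- Normalization changes nothing near a point of analyticity, so the derivative at 0 can be taken
from the explicit formula. -/
lemma toMeromorphicNFOn_eventuallyEq {f : ℂ → ℂ} (hf : MeromorphicOn f univ) {s : ℂ}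
    (hs : AnalyticAt ℂ f s) : toMeromorphicNFOn f univ =ᶠ[𝓝 s] f :=
  ((meromorphicNFOn_toMeromorphicNFOn f univ (mem_univ s)).eventuallyEq_nhdsNE_iff_eventuallyEq_nhds
    hs.meromorphicNFAt).1 (hf.toMeromorphicNFOn_eq_self_on_nhdsNE (mem_univ s))

/-- The meromorphic continuation of `∑ (κ Q)⁻ˢ` over the values `Q` of `modeForm`. -/
def scaledZeta (κ : ℝ) (s : ℂ) : ℂ := (κ : ℂ) ^ (-s) * modeZeta s

section

variable {κ : ℝ}

lemma differentiable_scale (hκ : 0 < κ) : Differentiable ℂ fun s : ℂ => (κ : ℂ) ^ (-s) := fun s =>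
  DifferentiableAt.const_cpow (by fun_prop) (Or.inl (by exact_mod_cast hκ.ne'))

lemma meromorphicOn_scaledZeta (hκ : 0 < κ) : MeromorphicOn (scaledZeta κ) univ := fun s _ =>
  ((differentiable_scale hκ).analyticAt s).meromorphicAt.mul (meromorphicAt_modeZeta s)

lemma analyticAt_scaledZeta (hκ : 0 < κ) {U : Set ℂ} (hU : IsOpen U)
    (h : ∀ s ∈ U, DifferentiableAt ℂ modeZeta s) {s : ℂ} (hs : s ∈ U) :
    AnalyticAt ℂ (scaledZeta κ) s :=
  DifferentiableOn.analyticAt (s := U)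
    (fun z hz => ((differentiable_scale hκ z).mul (h z hz)).differentiableWithinAt)
    (hU.mem_nhds hs)

lemma analyticAt_scaledZeta_of_one_lt (hκ : 0 < κ) {s : ℂ} (hs : 1 < s.re) :
    AnalyticAt ℂ (scaledZeta κ) s := by
  refine analyticAt_scaledZeta hκ (isOpen_lt continuous_const Complex.continuous_re) ?_ hs
  intro s (hs : 1 < s.re)
  refine differentiableAt_modeZeta (fun m e => ?_) (fun e => ?_) (fun e => ?_)
  · have := congrArg Complex.re e
    norm_num at this
    have hm : (0 : ℝ) ≤ m := m.cast_nonneg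
    linarith
  · have := congrArg Complex.re e
    norm_num at this
    linarith
  · have := congrArg Complex.re e
    norm_num at this
    linarith

lemma analyticAt_scaledZeta_zero (hκ : 0 < κ) : AnalyticAt ℂ (scaledZeta κ) 0 := by
  -- The singularities of the individual factors nearest to 0 are at ±1/2.
  have ho : IsOpen {s : ℂ | ‖s‖ < 1 / 2} := isOpen_lt continuous_norm continuous_const
  refine analyticAt_scaledZeta hκ ho ?_ (by simp)
  intro s (hs : ‖s‖ < 1 / 2)
  have hre := (abs_lt.1 ((Complex.abs_re_le_norm s).trans_lt hs))
  refine differentiableAt_modeZeta (fun m e => ?_) (fun e => ?_) (fun e => ?_)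
  · have := congrArg Complex.re e
    norm_num at this
    rcases m with _ | m
    · norm_num at this
      linarith
    · have hm : (0 : ℝ) ≤ m := m.cast_nonneg
      push_cast at this
      linarith
  · have := congrArg Complex.re e
    norm_num at this
    linarith
  · have := congrArg Complex.re e
    norm_num at this
    linarith

lemma hasDerivAt_scaledZeta_zero (hκ : 0 < κ) : HasDerivAt (scaledZeta κ)
    ((-(5 / 12) * Real.log κ + (Real.pi * √3 / 72 + thetaConst / 6
      + 5 / 6 * Real.log (2 * Real.pi) - 1 / 4 * Real.log 3) : ℝ) : ℂ) 0 := by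
  have h1 : HasDerivAt (fun s : ℂ => (κ : ℂ) ^ (-s)) (-(Real.log κ : ℂ)) 0 := by
    have := (hasDerivAt_neg (0 : ℂ)).const_cpow (c := (κ : ℂ)) (Or.inl (by exact_mod_cast hκ.ne'))
    simpa [Complex.ofReal_log hκ.le] using this
  have h2 := h1.mul hasDerivAt_modeZeta_zero
  refine h2.congr_deriv ?_
  rw [modeZeta_zero, thetaConst]
  push_cast
  simp
  ring

variable {A w₁ w₂ : Plane} {Ω : Set Plane}

lemma isSpectralZeta_scaledZeta (h : IsHexFrame w₁ w₂ κ) (hΩ : IsAlcove A w₁ w₂ Ω) :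
    IsSpectralZeta Ω (toMeromorphicNFOn (scaledZeta κ) univ) := by
  refine ⟨fun s hs => ?_, meromorphicNFOn_toMeromorphicNFOn _ _⟩
  rw [(toMeromorphicNFOn_eventuallyEq (meromorphicOn_scaledZeta h.pos)
    (analyticAt_scaledZeta_of_one_lt h.pos hs)).eq_of_nhds]
  exact hasSum_dirichletSpectrum h hΩ hs

lemma spectralZeta_eventuallyEq (h : IsHexFrame w₁ w₂ κ) (hΩ : IsAlcove A w₁ w₂ Ω) :
    spectralZeta Ω =ᶠ[𝓝 0] scaledZeta κ := by
  rw [spectralZeta_eq (isSpectralZeta_scaledZeta h hΩ)]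
  exact toMeromorphicNFOn_eventuallyEq (meromorphicOn_scaledZeta h.pos)
    (analyticAt_scaledZeta_zero h.pos)

end

/-- The logarithms of π cancel, since κ contains π² and -5/12 · 2 + 5/6 = 0; those of 3 combine to
5/6 - 1/4 = 7/12. -/
lemma zeta_deriv_eq_series {ℓ : ℝ} (hℓ : 0 < ℓ) :
    -(5 / 12) * Real.log (16 * Real.pi ^ 2 / (9 * ℓ ^ 2)) + (Real.pi * √3 / 72 + thetaConst / 6
      + 5 / 6 * Real.log (2 * Real.pi) - 1 / 4 * Real.log 3) =
    5 / 6 * Real.log (ℓ / 2) + 7 / 12 * Real.log 3 + Real.pi * √3 / 72 + 1 / 3 * (thetaConst / 2) := by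
  have hpi := Real.pi_pos
  rw [Real.log_div (by positivity) (by positivity), Real.log_mul (by norm_num) (by positivity),
    Real.log_mul (by norm_num) (by positivity), Real.log_pow, Real.log_pow,
    Real.log_mul (by norm_num) (by positivity), Real.log_div (by positivity) (by norm_num),
    show (16 : ℝ) = 2 ^ 4 by norm_num, show (9 : ℝ) = 3 ^ 2 by norm_num, Real.log_pow, Real.log_pow]
  push_cast
  ring

/-- A third of -log|η| absorbs both π√3/72 and the series; the remaining coefficients split as 5/6 =
1/3 + 1/2 and 7/12 = 1/3 + 1/4. -/
lemma zeta_deriv_series_eq_eta {ℓ : ℝ} (hℓ : 0 < ℓ) :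
    5 / 6 * Real.log (ℓ / 2) + 7 / 12 * Real.log 3 + Real.pi * √3 / 72 + 1 / 3 * (thetaConst / 2) =
    1 / 3 * Real.log (3 * ℓ / (2 * ‖ModularForm.eta ((-3 + Complex.I * (√3 : ℝ)) / 2)‖))
        + 1 / 4 * Real.log 3 + 1 / 2 * Real.log (ℓ / 2) := by
  have hne : ‖ModularForm.eta ((-3 + Complex.I * (√3 : ℝ)) / 2)‖ ≠ 0 := by
    rw [norm_ne_zero_iff]
    exact ModularForm.eta_ne_zero (by simp)
  have e : Real.log (3 * ℓ / (2 * ‖ModularForm.eta ((-3 + Complex.I * (√3 : ℝ)) / 2)‖)) =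
      Real.log 3 + Real.log (ℓ / 2) + (Real.pi * √3 / 24 + thetaConst / 2) := by
    rw [Real.log_div (by positivity) (mul_ne_zero two_ne_zero hne),
      Real.log_mul (by norm_num) hℓ.ne', Real.log_mul two_ne_zero hne, log_norm_eta,
      Real.log_div hℓ.ne' two_ne_zero]
    ring
  rw [e]
  ring

end

end

end HemiEquilateral

open HemiEquilateral

theorem mainTheorem10 (A B C : Plane) (ℓ : ℝ) (hℓ : 0 < ℓ)
    (hABC : IsHemiEquilateral A B C ℓ) :
    -- the eigenvalues are positive and of finite multiplicity, and the spectral zeta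
    -- function has a unique meromorphic extension to the plane, which is regular at `0`
    (∀ lam ∈ dirichletSpectrum (openTriangle A B C),
      0 < lam ∧ FiniteDimensional ℝ (dirichletEigenspace (openTriangle A B C) lam)) ∧
    (∃! Z : ℂ → ℂ, IsSpectralZeta (openTriangle A B C) Z) ∧
    AnalyticAt ℂ (spectralZeta (openTriangle A B C)) 0 ∧
    -- the series converges
    Summable (fun n : ℕ+ => (-1 : ℝ) ^ (n : ℕ) / ((n : ℝ) * Real.exp (Real.pi * n * √3))
      * ∑ d ∈ (n : ℕ).divisors, (d : ℝ)) ∧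
    -- the value `D` of the derivative at `0`, its two expressions, and the determinant
    ∃ D : ℝ,
      deriv (spectralZeta (openTriangle A B C)) 0 = (D : ℂ) ∧
      zetaRegularizedDet (openTriangle A B C) = ((Real.exp (-D) : ℝ) : ℂ) ∧
      D = 5 / 6 * Real.log (ℓ / 2) + 7 / 12 * Real.log 3 + Real.pi * √3 / 72
        + 1 / 3 * ∑' n : ℕ+, (-1 : ℝ) ^ (n : ℕ) / ((n : ℝ) * Real.exp (Real.pi * n * √3))
          * ∑ d ∈ (n : ℕ).divisors, (d : ℝ) ∧
      D = 1 / 3 * Real.log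
          (3 * ℓ / (2 * ‖ModularForm.eta ((-3 + Complex.I * (√3 : ℝ)) / 2)‖))
        + 1 / 4 * Real.log 3 + 1 / 2 * Real.log (ℓ / 2) := by
  obtain ⟨w₁, w₂, h, hΩ⟩ := exists_frame hℓ hABC
  have hev := spectralZeta_eventuallyEq h hΩ
  have hd := ((hasDerivAt_scaledZeta_zero h.pos).congr_of_eventuallyEq hev).deriv
  refine ⟨fun lam hlam => ⟨?_, finiteDimensional_dirichletEigenspace h hΩ lam⟩,
    ⟨_, isSpectralZeta_scaledZeta h hΩ, fun Z hZ =>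
      isSpectralZeta_unique hZ (isSpectralZeta_scaledZeta h hΩ)⟩,
    (analyticAt_scaledZeta_zero h.pos).congr hev.symm, hasSum_divisor_series.summable,
    _, hd, ?_, ?_, ?_⟩
  · obtain ⟨i, rfl⟩ := (mem_dirichletSpectrum_iff h hΩ lam).1 hlam
    exact mul_pos h.pos (modeForm_pos i)
  · rw [zetaRegularizedDet, hd, Complex.ofReal_exp, Complex.ofReal_neg]
  · rw [hasSum_divisor_series.tsum_eq]
    exact zeta_deriv_eq_series hℓ
  · exact (zeta_deriv_eq_series hℓ).trans (zeta_deriv_series_eq_eta hℓ)
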